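/- Let $M$ be a smooth Riemann surface with (possibly empty) boundary, with complex structure $J$ and a smooth Riemannian metric $g$ compatible with $J$ (that is, $g(J\cdot,J\cdot)=g$). Let $n\ge 0$ be an integer and let $r,s,p$ be real numbers with $$0<r<s,\qquad 1<p<\infty,\qquad r+s>1,\qquad r\notin\mathbb N,\qquad sp>2n+2 .$$ Let $E\to M$ be a smooth complex vector bundle of rank $2n$ with a smooth Hermitian metric $\langle\cdot,\cdot\rangle$, a Clifford multiplication $\gamma:T^*M\to \mathrm{End}(E)$ and a Hermitian connection $\nabla$ such that, for all smooth $1$-forms $\eta,\omega$, sections $u,v$ of $E$ and vector fields $W$, $$\gamma(\eta)\gamma(\omega)+\gamma(\omega)\gamma(\eta)=-2g(\eta,\omega),\qquad \langle\gamma(\omega)u,v\rangle=-\langle u,\gamma(\omega)v\rangle,\qquad [\nabla_W,\gamma(\omega)]=\gamma(\nabla_W\omega),$$ where $\nabla_W\omega$ is the Levi-Civita derivative and the last identity is understood in the weak sense. Assume that $\gamma$ and the local connection forms of $\nabla$ are of class $C^r\cap W^{s,p}$ in smooth charts and smooth local frames (locally, up to the boundary). Let $D=\gamma\circ\nabla$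 be the associated Dirac operator, acting on sections of class $H^1$. Then there exist a complex subbundle $E_0\subset E$ of rank $n$, of class $C^{r+1}$, and a bundle isomorphism of class $C^{r+1}$ $$B:E\longrightarrow E_0\oplus\bigl(E_0\otimes(T^{0,1}M)^*\bigr)$$ such that $$B\,D\,B^{-1}=\sqrt2\,\bigl(\bar\partial^\nabla+(\bar\partial^\nabla)^*\bigr)$$ as operators with domain the sections of class $H^1$; in particular $B$ and $B^{-1}$ preserve the class $H^1$. Here $\bar\partial^\nabla\sigma=(\nabla\sigma)^{0,1}$ for sections $\sigma$ of $E_0$ (this is again an $E_0$-valued form), and $(\bar\partial^\nabla)^*$ is its formal adjoint for the Hermitian metric of $E$, the Hermitian extension of $g$ to $(0,1)$-forms and the Riemannian area measure. On a non-compact $M$ the class $H^1$ means locally $H^1$ up to the boundary; on a compact $M$ it is the usual $H^1$. -/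

import Mathlib

open Bundle MeasureTheory
open scoped Manifold ContDiff

noncomputable section

namespace DiracSurface

/-! ### Function spaces on relatively open subsets of a half-plane -/

/-- The coordinate plane. -/
abbrev Plane : Type := EuclideanSpace ℝ (Fin 2)

/-- The standard basis of the coordinate plane. -/
def stdVec (i : Fin 2) : Plane := EuclideanSpace.single i 1

section FunctionSpaces

variable {V : Type*} [NormedAddCommGroup V] [NormedSpace ℝ V]

/-- `f'` is the weak derivative of `f` in the direction `a` on the open set `Ω`
(the test functions are the compactly supported functions of class `C¹`). -/
def HasWeakDeriv (Ω : Set Plane) (a : Plane) (f f' : Plane → V) : Prop :=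
  LocallyIntegrableOn f Ω ∧ LocallyIntegrableOn f' Ω ∧
    ∀ φ : Plane → ℝ, ContDiff ℝ 1 φ → HasCompactSupport φ → tsupport φ ⊆ Ω →
      ∫ y in Ω, (fderiv ℝ φ y a) • f y = - ∫ y in Ω, φ y • f' y

/-- The Hölder class `C^ρ` on `S`: `⌊ρ⌋` continuous derivatives, the top one being Hölder
continuous with exponent `ρ - ⌊ρ⌋` on the compact subsets of `S`.  It is used for sets `S` that are
relatively open in a half-plane, so that it includes regularity up to the boundary. -/
def MemHolderLoc (ρ : ℝ) (f : Plane → V) (S : Set Plane) : Prop :=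
  ContDiffOn ℝ (⌊ρ⌋₊ : ℕ∞) f S ∧
    ∀ K ⊆ S, IsCompact K → ∃ C : NNReal,
      HolderOnWith C (ρ - ⌊ρ⌋₊).toNNReal (iteratedFDerivWithin ℝ ⌊ρ⌋₊ f S) K

/-- `f ∈ L^p(K)` for all compact `K ⊆ S`. -/
def MemLpLoc (p : ℝ) (f : Plane → V) (S : Set Plane) : Prop :=
  ∀ K ⊆ S, IsCompact K → MemLp f (ENNReal.ofReal p) (volume.restrict K)

/-- The Sobolev–Slobodeckij class `W^{k+σ,p}` on the compact subsets of `S`, for an integer `k` and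
`0 ≤ σ < 1`: weak derivatives up to order `k` in `L^p`, and, if `σ > 0`, finite Gagliardo seminorm
of order `σ` of the derivatives of order `k`. -/
def MemSobolevAux (σ p : ℝ) (S : Set Plane) : ℕ → (Plane → V) → Prop
  | 0, f => MemLpLoc p f S ∧ (0 < σ → ∀ K ⊆ S, IsCompact K →
      ∫⁻ y in K, ∫⁻ z in K, ‖f y - f z‖ₑ ^ p / ‖y - z‖ₑ ^ (2 + σ * p) < ⊤)
  | k + 1, f => MemLpLoc p f S ∧
      ∀ i : Fin 2, ∃ f' : Plane → V,
        HasWeakDeriv (interior S) (stdVec i) f f' ∧ MemSobolevAux σ p S k f'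

/-- The class `W^{s,p}` on the compact subsets of `S`. -/
def MemSobolevLoc (s p : ℝ) (f : Plane → V) (S : Set Plane) : Prop :=
  MemSobolevAux (s - ⌊s⌋₊) p S ⌊s⌋₊ f

end FunctionSpaces

/-! ### Surfaces -/

section Surface

variable {M : Type*} [TopologicalSpace M] [ChartedSpace (EuclideanHalfSpace 2) M]
  [IsManifold (𝓡∂ 2) ∞ M]

/-- The coordinate vector field of the chart at `x₀` with constant coefficients `a`. -/
def coordVec (x₀ : M) (a : Plane) (x : M) : TangentSpace (𝓡∂ 2) x :=
  (trivializationAt Plane (TangentSpace (𝓡∂ 2)) x₀).symmL ℝ x a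

/-- The coordinates, in the chart at `x₀`, of a tangent vector. -/
def tangentCoord (x₀ : M) (x : M) : TangentSpace (𝓡∂ 2) x →L[ℝ] Plane :=
  (trivializationAt Plane (TangentSpace (𝓡∂ 2)) x₀).continuousLinearMapAt ℝ x

/-- The coordinate 1-form of the chart at `x₀` with constant coefficients `ℓ`. -/
def coordForm (x₀ : M) (ℓ : Plane →L[ℝ] ℝ) (x : M) : TangentSpace (𝓡∂ 2) x →L[ℝ] ℝ :=
  ℓ.comp (tangentCoord x₀ x)

variable (M) in
/-- A smooth Riemannian metric on the surface. -/
abbrev SurfaceMetric :=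
  ContMDiffRiemannianMetric (𝓡∂ 2) ∞ Plane (fun x : M => TangentSpace (𝓡∂ 2) x)

variable (M) in
/-- A smooth complex structure on the tangent bundle of a real surface with boundary (in real
dimension two it is automatically integrable, so this is a Riemann surface with boundary). -/
structure ComplexStructure where
  /-- multiplication by `i` on tangent vectors -/
  J : ∀ x : M, TangentSpace (𝓡∂ 2) x →L[ℝ] TangentSpace (𝓡∂ 2) x
  sq : ∀ (x : M) (v : TangentSpace (𝓡∂ 2) x), J x (J x v) = -v
  smooth : ∀ (x₀ : M) (a : Plane),
    ContDiffOn ℝ ∞ (fun y : Plane =>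
        tangentCoord x₀ ((extChartAt (𝓡∂ 2) x₀).symm y)
          (J _ (coordVec x₀ a ((extChartAt (𝓡∂ 2) x₀).symm y))))
      (extChartAt (𝓡∂ 2) x₀).target

/-- The metric is Hermitian (conformal) for the complex structure. -/
def IsConformal (g : SurfaceMetric M) (c : ComplexStructure M) : Prop :=
  ∀ (x : M) (v w : TangentSpace (𝓡∂ 2) x), g.inner x (c.J x v) (c.J x w) = g.inner x v w

/-- The coefficients `g_{ij}` of the metric in the chart at `x₀`. -/
def metricMatrix (g : SurfaceMetric M) (x₀ : M) (y : Plane) : Matrix (Fin 2) (Fin 2) ℝ :=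
  fun i j => g.inner ((extChartAt (𝓡∂ 2) x₀).symm y)
    (coordVec x₀ (stdVec i) _) (coordVec x₀ (stdVec j) _)

/-- `∂_k g_{ij}` in the chart at `x₀`. -/
def metricDeriv (g : SurfaceMetric M) (x₀ : M) (k i j : Fin 2) (y : Plane) : ℝ :=
  fderivWithin ℝ (fun z => metricMatrix g x₀ z i j) (extChartAt (𝓡∂ 2) x₀).target y (stdVec k)

/-- The Christoffel symbols `Γ^k_{ij}` of the Levi-Civita connection in the chart at `x₀`. -/
def christoffel (g : SurfaceMetric M) (x₀ : M) (k i j : Fin 2) (y : Plane) : ℝ :=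
  (1 / 2) * ∑ l, (metricMatrix g x₀ y)⁻¹ k l *
    (metricDeriv g x₀ i j l y + metricDeriv g x₀ j i l y - metricDeriv g x₀ l i j y)

/-- The coefficient `η_k` of a 1-form in the chart at `x₀`. -/
def formCoeff (x₀ : M) (η : ∀ x : M, TangentSpace (𝓡∂ 2) x →L[ℝ] ℝ) (k : Fin 2) (y : Plane) : ℝ :=
  η ((extChartAt (𝓡∂ 2) x₀).symm y) (coordVec x₀ (stdVec k) _)

/-- The Levi-Civita derivative of a 1-form in the direction of the `i`-th coordinate vector field
of the chart at `x₀`, namely `∑_k (∂_i η_k - ∑_j Γ^j_{ik} η_j) dx^k`. -/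
def leviCivitaForm (g : SurfaceMetric M) (x₀ : M) (i : Fin 2)
    (η : ∀ x : M, TangentSpace (𝓡∂ 2) x →L[ℝ] ℝ) (x : M) : TangentSpace (𝓡∂ 2) x →L[ℝ] ℝ :=
  ∑ k, (fderivWithin ℝ (formCoeff x₀ η k) (extChartAt (𝓡∂ 2) x₀).target
          (extChartAt (𝓡∂ 2) x₀ x) (stdVec i)
        - ∑ j, christoffel g x₀ j i k (extChartAt (𝓡∂ 2) x₀ x)
            * formCoeff x₀ η j (extChartAt (𝓡∂ 2) x₀ x)) •
      coordForm x₀ (EuclideanSpace.proj k) x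

/-- The density of the Riemannian area measure in the chart at `x₀`. -/
def areaDensity (g : SurfaceMetric M) (x₀ : M) (y : Plane) : ℝ :=
  Real.sqrt (metricMatrix g x₀ y).det

/-- `P` holds at almost every point of the surface. -/
def AEOnSurface (P : M → Prop) : Prop :=
  ∀ x₀ : M, ∀ᵐ y : Plane, y ∈ (extChartAt (𝓡∂ 2) x₀).target →
    P ((extChartAt (𝓡∂ 2) x₀).symm y)

end Surface

/-! ### Sections of a complex vector bundle -/

section Bundles

variable {M : Type*} [TopologicalSpace M] [ChartedSpace (EuclideanHalfSpace 2) M]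
  [IsManifold (𝓡∂ 2) ∞ M]
  (F : Type*) [NormedAddCommGroup F] [NormedSpace ℂ F]
  {E : M → Type*} [∀ x, AddCommGroup (E x)] [∀ x, Module ℂ (E x)]
  [∀ x, TopologicalSpace (E x)] [∀ x, IsTopologicalAddGroup (E x)] [∀ x, ContinuousSMul ℂ (E x)]
  [TopologicalSpace (TotalSpace F E)] [FiberBundle F E] [VectorBundle ℂ F E]

/-- Real scalar multiplication is continuous on the fibres. -/
instance fiberContinuousSMulReal (V : Type*) [AddCommGroup V] [Module ℂ V] [TopologicalSpace V]
    [ContinuousSMul ℂ V] : ContinuousSMul ℝ V :=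
  IsScalarTower.continuousSMul ℂ

variable (E) in
/-- The part of the plane that corresponds to the domain on which both the chart at `x₀` and the
trivialization at `x₀` are defined; it is relatively open in the half-plane. -/
def locDom (x₀ : M) : Set Plane :=
  (extChartAt (𝓡∂ 2) x₀).target ∩
    (extChartAt (𝓡∂ 2) x₀).symm ⁻¹' (trivializationAt F E x₀).baseSet

/-- A section in the chart and the trivialization at `x₀`. -/
def locRep (x₀ : M) (u : ∀ x, E x) (y : Plane) : F :=
  (trivializationAt F E x₀).continuousLinearMapAt ℂ ((extChartAt (𝓡∂ 2) x₀).symm y) (u _)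

variable (E) in
/-- The local section that is constant in the trivialization at `x₀`. -/
def constSec (x₀ : M) (f : F) (x : M) : E x :=
  (trivializationAt F E x₀).symmL ℂ x f

/-- The section is differentiable at `x`. -/
def SecDiffAt (u : ∀ x, E x) (x : M) : Prop :=
  MDifferentiableAt (𝓡∂ 2) ((𝓡∂ 2).prod 𝓘(ℝ, F)) (fun x => TotalSpace.mk' F x (u x)) x

/-- An `E`-valued 1-form. -/
abbrev FormField (E : M → Type*) [∀ x, AddCommGroup (E x)] [∀ x, Module ℂ (E x)]
    [∀ x, TopologicalSpace (E x)] :=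
  ∀ x : M, TangentSpace (𝓡∂ 2) x →L[ℝ] E x

/-- The component of an `E`-valued 1-form along a coordinate vector field of the chart at `x₀`. -/
def component (x₀ : M) (a : Plane) (w : FormField E) (x : M) : E x := w x (coordVec x₀ a x)

/-- Sections of class `C^ρ` on the open set `U`. -/
def SecHolderOn (ρ : ℝ) (U : Set M) (u : ∀ x, E x) : Prop :=
  ∀ x₀ : M, MemHolderLoc ρ (locRep F x₀ u)
    (locDom F E x₀ ∩ (extChartAt (𝓡∂ 2) x₀).symm ⁻¹' U)

/-- `E`-valued 1-forms of class `C^ρ` on the open set `U`. -/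
def FormHolderOn (ρ : ℝ) (U : Set M) (w : FormField E) : Prop :=
  ∀ (x₀ : M) (a : Plane), MemHolderLoc ρ (locRep F x₀ (component x₀ a w))
    (locDom F E x₀ ∩ (extChartAt (𝓡∂ 2) x₀).symm ⁻¹' U)

/-- Sections locally in `L²`. -/
def SecL2 (u : ∀ x, E x) : Prop :=
  ∀ x₀ : M, MemLpLoc 2 (locRep F x₀ u) (locDom F E x₀)

/-- Sections locally in `H¹`, up to the boundary; this is `H¹(M; E)` if `M` is compact. -/
def SecH1 (u : ∀ x, E x) : Prop :=
  ∀ x₀ : M, MemSobolevLoc 1 2 (locRep F x₀ u) (locDom F E x₀)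

/-- `E`-valued 1-forms locally in `H¹`, up to the boundary. -/
def FormH1 (w : FormField E) : Prop :=
  ∀ (x₀ : M) (a : Plane), MemSobolevLoc 1 2 (locRep F x₀ (component x₀ a w)) (locDom F E x₀)

/-! ### Connections -/

variable {F}

/-- The connection form of `∇` in the chart and the trivialization at `x₀`. -/
def connForm (conn : CovariantDerivative (𝓡∂ 2) F E) (x₀ : M) (a : Plane) (y : Plane) (f : F) : F :=
  locRep F x₀ (component x₀ a (conn (constSec F E x₀ f))) y

/-- In the chart domain at `x₀`, the section `u` has the weak covariant derivative `w` along the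
coordinate vector field `∂_a`, i.e. `∂_a u + A(∂_a) u = w` weakly for the connection form `A`. -/
def HasWeakCovAlong (conn : CovariantDerivative (𝓡∂ 2) F E) (x₀ : M) (a : Plane)
    (u w : ∀ x, E x) : Prop :=
  HasWeakDeriv (interior (locDom F E x₀)) a (locRep F x₀ u)
    (fun y => locRep F x₀ w y - connForm conn x₀ a y (locRep F x₀ u y))

/-- `w = ∇u` weakly. -/
def HasWeakCov (conn : CovariantDerivative (𝓡∂ 2) F E) (u : ∀ x, E x) (w : FormField E) : Prop :=
  ∀ (x₀ : M) (a : Plane), HasWeakCovAlong conn x₀ a u (component x₀ a w)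

variable (F E) in
/-- A Dirac vector bundle structure on the smooth complex vector bundle `E` over the surface with
metric `g`: a smooth Hermitian metric (conjugate linear in the first argument), a Clifford
multiplication by covectors and a Hermitian connection. -/
structure DiracBundle (g : SurfaceMetric M) where
  /-- the Hermitian metric -/
  herm : ∀ x, E x →L⋆[ℂ] E x →L[ℂ] ℂ
  herm_symm : ∀ (x : M) (s t : E x), herm x t s = star (herm x s t)
  herm_pos : ∀ (x : M) (s : E x), s ≠ 0 → 0 < (herm x s s).re
  herm_smooth : ∀ (x₀ : M) (f f' : F),
    ContDiffOn ℝ ∞ (fun y : Plane => herm ((extChartAt (𝓡∂ 2) x₀).symm y)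
      (constSec F E x₀ f _) (constSec F E x₀ f' _)) (locDom F E x₀)
  /-- the connection -/
  conn : CovariantDerivative (𝓡∂ 2) F E
  conn_smul : ∀ (c : ℂ) (s : ∀ x, E x) (x : M), SecDiffAt F s x →
    conn (fun z => c • s z) x = c • conn s x
  conn_herm : ∀ (s t : ∀ x, E x) (x : M), SecDiffAt F s x → SecDiffAt F t x →
    ∀ v : TangentSpace (𝓡∂ 2) x,
      (mfderiv (𝓡∂ 2) 𝓘(ℝ, ℂ) (fun z => herm z (s z) (t z)) x v : ℂ) =
        herm x (conn s x v) (t x) + herm x (s x) (conn t x v)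
  /-- the Clifford multiplication -/
  γ : ∀ x : M, (TangentSpace (𝓡∂ 2) x →L[ℝ] ℝ) →ₗ[ℝ] (E x →L[ℂ] E x)
  /-- `γ(η)γ(ξ) + γ(ξ)γ(η) = -2 g(η, ξ)`, where `η = g(v, ·)` and `ξ = g(w, ·)` -/
  clifford : ∀ (x : M) (v w : TangentSpace (𝓡∂ 2) x) (s : E x),
    γ x (g.inner x v) (γ x (g.inner x w) s) + γ x (g.inner x w) (γ x (g.inner x v) s) =
      ((-2 * g.inner x v w : ℝ) : ℂ) • s
  γ_skew : ∀ (x : M) (η : TangentSpace (𝓡∂ 2) x →L[ℝ] ℝ) (s t : E x),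
    herm x (γ x η s) t = - herm x s (γ x η t)
  /-- `∇_W (γ(η) s) = γ(∇_W η) s + γ(η) ∇_W s` for smooth local 1-forms `η` and smooth local
  sections `s`, the derivative on the left being taken weakly because `γ` may not be
  differentiable a priori. -/
  γ_compat : ∀ (x₀ : M) (i : Fin 2) (η : ∀ x : M, TangentSpace (𝓡∂ 2) x →L[ℝ] ℝ) (s : ∀ x, E x),
    (∀ k, ContDiffOn ℝ ∞ (formCoeff x₀ η k) (locDom F E x₀)) →
    ContDiffOn ℝ ∞ (locRep F x₀ s) (locDom F E x₀) →
    HasWeakCovAlong conn x₀ (stdVec i) (fun x => γ x (η x) (s x))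
      (fun x => γ x (leviCivitaForm g x₀ i η x) (s x) +
        γ x (η x) (component x₀ (stdVec i) (conn s) x))

section Dirac

variable {g : SurfaceMetric M} (c : ComplexStructure M) (D : DiracBundle F E g)

/-- The coefficient of the Clifford multiplication by a coordinate 1-form, in the chart and the
trivialization at `x₀`. -/
def DiracBundle.γCoeff (x₀ : M) (ℓ : Plane →L[ℝ] ℝ) (f : F) (y : Plane) : F :=
  locRep F x₀ (fun x => D.γ x (coordForm x₀ ℓ x) (constSec F E x₀ f x)) y

/-- The connection and the Clifford multiplication have the regularity `C^r ∩ W^{s,p}`. -/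
def DiracBundle.HasRegularity (r s p : ℝ) : Prop :=
  (∀ (x₀ : M) (a : Plane) (f : F),
    MemHolderLoc r (fun y => connForm D.conn x₀ a y f) (locDom F E x₀) ∧
    MemSobolevLoc s p (fun y => connForm D.conn x₀ a y f) (locDom F E x₀)) ∧
  (∀ (x₀ : M) (ℓ : Plane →L[ℝ] ℝ) (f : F),
    MemHolderLoc r (D.γCoeff x₀ ℓ f) (locDom F E x₀) ∧
    MemSobolevLoc s p (D.γCoeff x₀ ℓ f) (locDom F E x₀))

/-- The `i`-th vector of a basis of the tangent space. -/
def tangentBasis (x : M) (i : Fin 2) : TangentSpace (𝓡∂ 2) x := stdVec i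

/-- The `i`-th vector of the dual basis. -/
def cotangentBasis (x : M) (i : Fin 2) : TangentSpace (𝓡∂ 2) x →L[ℝ] ℝ :=
  (EuclideanSpace.proj i : Plane →L[ℝ] ℝ)

/-- Clifford multiplication as a map `T*M ⊗ E → E`: the form `∑ᵢ eⁱ ⊗ wᵢ` is sent to `∑ᵢ γ(eⁱ) wᵢ`
(this does not depend on the basis). -/
def DiracBundle.contract (w : FormField E) (x : M) : E x :=
  ∑ i, D.γ x (cotangentBasis x i) (w x (tangentBasis x i))

/-- The graph of the Dirac operator `D = γ ∘ ∇` with domain `H¹`: `u ∈ H¹` and `Du = f`. -/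
def DiracBundle.IsDirac (u f : ∀ x, E x) : Prop :=
  SecH1 F u ∧ ∃ w : FormField E, HasWeakCov D.conn u w ∧
    AEOnSurface (fun x => f x = D.contract w x)

/-- The (0,1)-part `(w + i w ∘ J)/2` of an `E`-valued 1-form. -/
def zeroOnePart (w : FormField E) (x : M) : TangentSpace (𝓡∂ 2) x →L[ℝ] E x :=
  (1 / 2 : ℂ) • (w x + Complex.I • (w x).comp (c.J x))

/-- The fibre at `x` of `E₀ ⊗ (T^{0,1}M)*`: the `E₀`-valued forms of type (0,1), i.e. the real linear
maps `α : T_x M → (E₀)_x` with `α(Jv) = -i α(v)`. -/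
def ZeroOneForms (E₀ : ∀ x, Submodule ℂ (E x)) (x : M) :
    Submodule ℂ (TangentSpace (𝓡∂ 2) x →L[ℝ] E x) where
  carrier := {α | ∀ v, α v ∈ E₀ x ∧ α (c.J x v) = -(Complex.I • α v)}
  add_mem' := by
    intro α β hα hβ v
    refine ⟨(E₀ x).add_mem (hα v).1 (hβ v).1, ?_⟩
    simp only [add_apply, (hα v).2, (hβ v).2, smul_add, neg_add]
  zero_mem' := by
    intro v
    simp
  smul_mem' := by
    intro z α hα v
    refine ⟨(E₀ x).smul_mem z (hα v).1, ?_⟩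
    simp only [smul_apply, (hα v).2, smul_neg, smul_comm z Complex.I]

/-- The Hermitian product on `T*M ⊗ E`, `∑ⱼ ⟨α(eⱼ), β(eⱼ)⟩` for the orthonormal basis
`v/|v|, Jv/|v|` with `v ≠ 0` (this does not depend on the basis). -/
def DiracBundle.formInner (x : M) (α β : TangentSpace (𝓡∂ 2) x →L[ℝ] E x) : ℂ :=
  (D.herm x (α (tangentBasis x 0)) (β (tangentBasis x 0)) +
    D.herm x (α (c.J x (tangentBasis x 0))) (β (c.J x (tangentBasis x 0)))) /
  (g.inner x (tangentBasis x 0) (tangentBasis x 0) : ℂ)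

/-- `ψ` is, over the chart domain at `x₀`, a section of `E₀` of class `C¹` with compact support in
the interior. -/
def IsTestSection (E₀ : ∀ x, Submodule ℂ (E x)) (x₀ : M) (ψ : ∀ x, E x) : Prop :=
  (∀ x, ψ x ∈ E₀ x) ∧ ContDiffOn ℝ 1 (locRep F x₀ ψ) (locDom F E x₀) ∧
    ∃ K ⊆ interior (locDom F E x₀), IsCompact K ∧
      ∀ y ∈ locDom F E x₀, y ∉ K → ψ ((extChartAt (𝓡∂ 2) x₀).symm y) = 0

/-- `b = ∂̄^∇ σ` for `σ ∈ H¹`, where `∂̄^∇ σ = (∇σ)^{0,1}`. -/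
def DiracBundle.IsDbar (σ : ∀ x, E x) (b : FormField E) : Prop :=
  SecH1 F σ ∧ ∃ w : FormField E, HasWeakCov D.conn σ w ∧
    AEOnSurface (fun x => b x = zeroOnePart c w x)

/-- `a = (∂̄^∇)* τ` for `τ ∈ H¹`, where `(∂̄^∇)*` is the formal adjoint of `∂̄^∇` on the sections of
`E₀`: `a` is locally in `L²` and `∫ ⟨ψ, a⟩ = ∫ ⟨∂̄^∇ ψ, τ⟩` for all test sections `ψ` of `E₀`. -/
def DiracBundle.IsDbarAdjoint (E₀ : ∀ x, Submodule ℂ (E x)) (τ : FormField E) (a : ∀ x, E x) :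
    Prop :=
  FormH1 F τ ∧ SecL2 F a ∧ ∀ (x₀ : M) (ψ : ∀ x, E x), IsTestSection (F := F) E₀ x₀ ψ →
    ∫ y in interior (locDom F E x₀), (areaDensity g x₀ y : ℂ) *
        D.herm ((extChartAt (𝓡∂ 2) x₀).symm y) (ψ _) (a _) =
      ∫ y in interior (locDom F E x₀), (areaDensity g x₀ y : ℂ) *
        D.formInner c ((extChartAt (𝓡∂ 2) x₀).symm y) (zeroOnePart c (D.conn ψ) _) (τ _)

/-- The graph of `√2 (∂̄^∇ + (∂̄^∇)*)` on `E₀ ⊕ E₀ ⊗ (T^{0,1}M)*` with domain `H¹`: the pair `(σ, τ)`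
is in `H¹` and it is mapped to `(a, b) = (√2 (∂̄^∇)* τ, √2 ∂̄^∇ σ)`. -/
def DiracBundle.IsDolbeaultDirac (E₀ : ∀ x, Submodule ℂ (E x))
    (S T : ∀ x, E₀ x × ZeroOneForms c E₀ x) : Prop :=
  ∃ (a : ∀ x, E x) (b : FormField E),
    D.IsDbar c (fun x => ((S x).1 : E x)) b ∧
    D.IsDbarAdjoint c E₀ (fun x => ((S x).2 : TangentSpace (𝓡∂ 2) x →L[ℝ] E x)) a ∧
    AEOnSurface (fun x => ((T x).1 : E x) = (Real.sqrt 2 : ℂ) • a x ∧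
      ((T x).2 : TangentSpace (𝓡∂ 2) x →L[ℝ] E x) = (Real.sqrt 2 : ℂ) • b x)

variable (F) in
/-- `E₀` is a complex subbundle of `E` of rank `n` and of class `C^ρ`: it has local frames of class
`C^ρ` consisting of `n` sections. -/
def IsSubbundle (ρ : ℝ) (n : ℕ) (E₀ : ∀ x, Submodule ℂ (E x)) : Prop :=
  ∀ x₁ : M, ∃ U : Set M, IsOpen U ∧ x₁ ∈ U ∧ ∃ e : Fin n → ∀ x, E x,
    (∀ j, SecHolderOn F ρ U (e j)) ∧
    ∀ x ∈ U, LinearIndependent ℂ (fun j => e j x) ∧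
      Submodule.span ℂ (Set.range fun j => e j x) = E₀ x

variable (F) in
/-- The fibrewise isomorphism `B : E → E₀ ⊕ E₀ ⊗ (T^{0,1}M)*` and its inverse are of class `C^ρ`, in
the sense that, on every open set, `u` is of class `C^ρ` if and only if `B u` is. -/
def IsBundleIso (ρ : ℝ) (E₀ : ∀ x, Submodule ℂ (E x))
    (B : ∀ x, E x ≃ₗ[ℂ] (E₀ x × ZeroOneForms c E₀ x)) : Prop :=
  ∀ (U : Set M) (u : ∀ x, E x), IsOpen U →
    (SecHolderOn F ρ U u ↔
      SecHolderOn F ρ U (fun x => ((B x (u x)).1 : E x)) ∧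
      FormHolderOn F ρ U (fun x => ((B x (u x)).2 : TangentSpace (𝓡∂ 2) x →L[ℝ] E x)))

end Dirac

end Bundles

end DiracSurface

end

open DiracSurface

/-! ### Calculus of weak derivatives in the plane. -/

noncomputable section

namespace DiracSurface

section WeakDerivatives

open Set Filter Topology

variable {V W X : Type*} [NormedAddCommGroup V] [NormedSpace ℝ V]
  [NormedAddCommGroup W] [NormedSpace ℝ W] {Ω : Set Plane}

/-! On a surface the Clifford multiplication carries its own splitting of E. For v ≠ 0 the chirality
operator Γ = iγ(v)γ(Jv)/|v|² does not depend on v, is self-adjoint, squares to 1 and anticommutes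
with every γ(w) (`chir_eq`, `herm_chir`, `chir_chir`, `chir_cl`). Its eigenbundles E₊ and E₋ are
interchanged by γ(v), so each has rank n; put E₀ = E₊. On E₋ one has γ(Jv) = −iγ(v), so v ↦
−γ(v)s/√2 is an E₊-valued form of type (0,1), and B sends s to P₊s together with the form of P₋s.

Regularity. Compatibility of γ with ∇ expresses the weak derivatives of the coefficients of γ by γ,
the connection form and the Christoffel symbols, without any derivative of γ. All of these are C^r
up to the boundary, so γ is C^{r+1} (`HasRegularity.memHolderLoc_gammaOp`), and with it Γ, E₀ and B.
The analytic input is that weak derivatives which are continuous up to the boundary are classical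
there.

Γ is parallel (`HasRegularity.covOp_chirOp`). Let N = −iΓ and C = ∇N. Differentiating N² = −1 shows
that C anticommutes with N. Differentiating Nγ + γN = 0, where ∇γ is again a combination of γ's,
shows that C anticommutes with every γ; as N is a product of two γ's, C also commutes with N. Hence
CN = 0 and C = 0.

The operators. Since Γ is parallel and γ exchanges its eigenbundles, D maps sections of E₊ to
sections of E₋ and conversely. From E₊ to E₋ it is √2 ∂̄ by a pointwise computation
(`toForm_contract`). From E₋ to E₊ it is the formal adjoint, because D is formally self-adjoint
(`HasRegularity.integral_contract`) and the fibrewise adjoint identity `formInner_zeroOnePart`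
holds. Equality of the graphs also needs that H¹ sections have a global weak covariant derivative
(`exists_hasWeakCov`), unique almost everywhere, and that test sections of E₀ detect the positive
part of a section (`HasRegularity.ae_projPlus_eq_zero`). The first of these rests on invariance
under changes of chart and trivialization. -/

theorem integrable_smul_of_tsupport_subset {f : Plane → V} (hf : LocallyIntegrableOn f Ω)
    {φ : Plane → ℝ} (hφ : Continuous φ) (hc : HasCompactSupport φ) (hs : tsupport φ ⊆ Ω) :
    Integrable fun y => φ y • f y := by
  have h1 : IntegrableOn f (tsupport φ) := hf.integrableOn_compact_subset hs hc
  have h2 : IntegrableOn (fun y => φ y • f y) (tsupport φ) :=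
    h1.continuousOn_smul hφ.continuousOn hc
  refine (integrableOn_iff_integrable_of_support_subset ?_).1 h2
  intro y hy
  by_contra h
  exact hy (by simp [image_eq_zero_of_notMem_tsupport h])

theorem fderiv_apply_eq_zero_of_notMem_tsupport {φ : Plane → ℝ} {y : Plane} (h : y ∉ tsupport φ)
    (a : Plane) : fderiv ℝ φ y a = 0 := by
  have h' : y ∉ tsupport (fderiv ℝ φ) := fun h' => h (tsupport_fderiv_subset ℝ h')
  rw [image_eq_zero_of_notMem_tsupport h']; simp

theorem tsupport_fderiv_apply_subset' (φ : Plane → ℝ) (a : Plane) :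
    tsupport (fun y => fderiv ℝ φ y a) ⊆ tsupport φ :=
  closure_minimal (fun y hy => by
    by_contra h
    exact hy (fderiv_apply_eq_zero_of_notMem_tsupport h a)) (isClosed_tsupport φ)

theorem hasCompactSupport_fderiv_apply {φ : Plane → ℝ} (hc : HasCompactSupport φ) (a : Plane) :
    HasCompactSupport fun y => fderiv ℝ φ y a :=
  hc.of_isClosed_subset (isClosed_tsupport _) (tsupport_fderiv_apply_subset' φ a)

theorem integrable_fderiv_smul {f : Plane → V} (hf : LocallyIntegrableOn f Ω)
    {φ : Plane → ℝ} (hφ : ContDiff ℝ 1 φ) (hc : HasCompactSupport φ) (hs : tsupport φ ⊆ Ω)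
    (a : Plane) : Integrable fun y => fderiv ℝ φ y a • f y :=
  integrable_smul_of_tsupport_subset hf
    ((hφ.continuous_fderiv one_ne_zero).clm_apply continuous_const)
    (hasCompactSupport_fderiv_apply hc a) ((tsupport_fderiv_apply_subset' φ a).trans hs)

theorem setIntegral_fderiv_smul (f : Plane → V) {φ : Plane → ℝ} (hs : tsupport φ ⊆ Ω) (a : Plane) :
    ∫ y in Ω, fderiv ℝ φ y a • f y = ∫ y, fderiv ℝ φ y a • f y :=
  setIntegral_eq_integral_of_forall_compl_eq_zero fun y hy => by
    rw [fderiv_apply_eq_zero_of_notMem_tsupport fun h => hy (hs h), zero_smul]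

theorem setIntegral_smul_of_tsupport (f : Plane → V) {φ : Plane → ℝ} (hs : tsupport φ ⊆ Ω) :
    ∫ y in Ω, φ y • f y = ∫ y, φ y • f y :=
  setIntegral_eq_integral_of_forall_compl_eq_zero fun y hy => by
    rw [image_eq_zero_of_notMem_tsupport fun h => hy (hs h), zero_smul]

/-- Test functions vanish off Ω, so both integrals may be taken over the whole plane. In this form
the notion is visibly monotone in Ω and no measurability of Ω is involved. -/
theorem hasWeakDeriv_iff {a : Plane} {f f' : Plane → V} :
    HasWeakDeriv Ω a f f' ↔ LocallyIntegrableOn f Ω ∧ LocallyIntegrableOn f' Ω ∧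
      ∀ φ : Plane → ℝ, ContDiff ℝ 1 φ → HasCompactSupport φ → tsupport φ ⊆ Ω →
        ∫ y, fderiv ℝ φ y a • f y = - ∫ y, φ y • f' y := by
  refine and_congr_right fun _ => and_congr_right fun _ => forall_congr' fun φ =>
    forall_congr' fun _ => forall_congr' fun _ => forall_congr' fun hs => ?_
  rw [setIntegral_fderiv_smul f hs, setIntegral_smul_of_tsupport f' hs]

theorem HasWeakDeriv.mono {Ω' : Set Plane} {a : Plane} {f f' : Plane → V}
    (h : HasWeakDeriv Ω a f f') (hΩ : Ω' ⊆ Ω) : HasWeakDeriv Ω' a f f' := by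
  rw [hasWeakDeriv_iff] at h ⊢
  exact ⟨h.1.mono_set hΩ, h.2.1.mono_set hΩ, fun φ h1 h2 h3 => h.2.2 φ h1 h2 (h3.trans hΩ)⟩

theorem HasWeakDeriv.add {a : Plane} {f f' g g' : Plane → V} (hf : HasWeakDeriv Ω a f f')
    (hg : HasWeakDeriv Ω a g g') :
    HasWeakDeriv Ω a (fun y => f y + g y) (fun y => f' y + g' y) := by
  rw [hasWeakDeriv_iff] at hf hg ⊢
  refine ⟨hf.1.add hg.1, hf.2.1.add hg.2.1, fun φ h1 h2 h3 => ?_⟩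
  simp only [smul_add]
  rw [integral_add (integrable_fderiv_smul hf.1 h1 h2 h3 a) (integrable_fderiv_smul hg.1 h1 h2 h3 a),
    integral_add (integrable_smul_of_tsupport_subset hf.2.1 h1.continuous h2 h3)
      (integrable_smul_of_tsupport_subset hg.2.1 h1.continuous h2 h3),
    hf.2.2 φ h1 h2 h3, hg.2.2 φ h1 h2 h3, neg_add]

theorem hasWeakDeriv_zero (Ω : Set Plane) (a : Plane) :
    HasWeakDeriv Ω a (fun _ => (0 : V)) (fun _ => 0) := by
  rw [hasWeakDeriv_iff]
  exact ⟨locallyIntegrableOn_zero, locallyIntegrableOn_zero, by simp⟩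

theorem HasWeakDeriv.sum {ι : Type*} (s : Finset ι) {a : Plane} {f f' : ι → Plane → V}
    (h : ∀ i ∈ s, HasWeakDeriv Ω a (f i) (f' i)) :
    HasWeakDeriv Ω a (fun y => ∑ i ∈ s, f i y) (fun y => ∑ i ∈ s, f' i y) := by
  classical
  induction s using Finset.induction_on with
  | empty => simpa using hasWeakDeriv_zero Ω a
  | insert i s hi ih =>
    simp only [Finset.sum_insert hi]
    exact (h i (Finset.mem_insert_self i s)).add
      (ih fun j hj => h j (Finset.mem_insert_of_mem hj))

theorem LocallyIntegrableOn.clm_comp (L : V →L[ℝ] W) {f : Plane → V}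
    (hf : LocallyIntegrableOn f Ω) : LocallyIntegrableOn (fun y => L (f y)) Ω := fun x hx =>
  let ⟨t, ht, h⟩ := hf x hx
  ⟨t, ht, L.integrable_comp h⟩

theorem HasWeakDeriv.clm_comp [CompleteSpace V] [CompleteSpace W] (L : V →L[ℝ] W) {a : Plane}
    {f f' : Plane → V} (h : HasWeakDeriv Ω a f f') :
    HasWeakDeriv Ω a (fun y => L (f y)) (fun y => L (f' y)) := by
  rw [hasWeakDeriv_iff] at h ⊢
  refine ⟨LocallyIntegrableOn.clm_comp L h.1, LocallyIntegrableOn.clm_comp L h.2.1,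
    fun φ h1 h2 h3 => ?_⟩
  simp only [← map_smul]
  rw [L.integral_comp_comm (integrable_fderiv_smul h.1 h1 h2 h3 a),
    L.integral_comp_comm (integrable_smul_of_tsupport_subset h.2.1 h1.continuous h2 h3),
    h.2.2 φ h1 h2 h3, map_neg]

theorem contDiff_mul_of_tsupport_subset (hΩ : IsOpen Ω) {φ θ : Plane → ℝ} (hφ : ContDiff ℝ 1 φ)
    (hs : tsupport φ ⊆ Ω) (hθ : ContDiffOn ℝ 1 θ Ω) : ContDiff ℝ 1 fun y => φ y * θ y := by
  rw [contDiff_iff_contDiffAt]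
  intro y
  by_cases hy : y ∈ tsupport φ
  · exact hφ.contDiffAt.mul (hθ.contDiffAt (hΩ.mem_nhds (hs hy)))
  · have : (fun y => φ y * θ y) =ᶠ[𝓝 y] fun _ => 0 := by
      filter_upwards [(isClosed_tsupport φ).isOpen_compl.mem_nhds hy] with z hz
      rw [image_eq_zero_of_notMem_tsupport hz, zero_mul]
    exact contDiffAt_const.congr_of_eventuallyEq this

theorem LocallyIntegrableOn.smul_continuousOn (hΩ : IsOpen Ω) {f : Plane → V}
    (hf : LocallyIntegrableOn f Ω) {θ : Plane → ℝ} (hθ : ContinuousOn θ Ω) :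
    LocallyIntegrableOn (fun y => θ y • f y) Ω :=
  hf.continuousOn_smul hΩ.isLocallyClosed hθ

/-- The product φθ is again an admissible test function: it is C¹ on the whole plane because φ is
supported in Ω. This is where test functions of class C¹, rather than smooth ones, are convenient.
-/
theorem HasWeakDeriv.smul (hΩ : IsOpen Ω) {a : Plane} {f f' : Plane → V}
    (h : HasWeakDeriv Ω a f f') {θ : Plane → ℝ} (hθ : ContDiffOn ℝ 1 θ Ω) :
    HasWeakDeriv Ω a (fun y => θ y • f y) (fun y => fderiv ℝ θ y a • f y + θ y • f' y) := by
  rw [hasWeakDeriv_iff] at h ⊢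
  have hθ' : ContinuousOn (fun y => fderiv ℝ θ y a) Ω :=
    (hθ.continuousOn_fderiv_of_isOpen hΩ le_rfl).clm_apply continuousOn_const
  have i1 := LocallyIntegrableOn.smul_continuousOn hΩ h.1 hθ'
  have i2 := LocallyIntegrableOn.smul_continuousOn hΩ h.2.1 hθ.continuousOn
  refine ⟨LocallyIntegrableOn.smul_continuousOn hΩ h.1 hθ.continuousOn, i1.add i2,
    fun φ h1 h2 h3 => ?_⟩
  have hs : tsupport (fun y => φ y * θ y) ⊆ tsupport φ := tsupport_mul_subset_left
  have hd := contDiff_mul_of_tsupport_subset hΩ h1 h3 hθ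
  have hc : HasCompactSupport fun y => φ y * θ y := h2.mul_right
  have key := h.2.2 _ hd hc (hs.trans h3)
  have e1 : ∀ y, fderiv ℝ (fun y => φ y * θ y) y a • f y
      = fderiv ℝ φ y a • θ y • f y + φ y • fderiv ℝ θ y a • f y := by
    intro y
    by_cases hy : y ∈ tsupport φ
    · rw [fderiv_fun_mul (h1.differentiable one_ne_zero y)
        ((hθ.contDiffAt (hΩ.mem_nhds (h3 hy))).differentiableAt one_ne_zero)]
      simp only [add_apply, smul_apply, smul_eq_mul, smul_smul, add_smul]
      rw [add_comm, mul_comm (θ y)]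
    · rw [fderiv_apply_eq_zero_of_notMem_tsupport fun h' => hy (hs h'),
        fderiv_apply_eq_zero_of_notMem_tsupport hy, image_eq_zero_of_notMem_tsupport hy]
      simp
  simp only [e1, mul_smul] at key
  rw [integral_add (integrable_fderiv_smul
      (LocallyIntegrableOn.smul_continuousOn hΩ h.1 hθ.continuousOn) h1 h2 h3 a)
      (integrable_smul_of_tsupport_subset i1 h1.continuous h2 h3)] at key
  simp only [smul_add]
  rw [integral_add (integrable_smul_of_tsupport_subset i1 h1.continuous h2 h3)
    (integrable_smul_of_tsupport_subset i2 h1.continuous h2 h3), neg_add, ← key]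
  abel

theorem HasWeakDeriv.congr_ae (hΩ : MeasurableSet Ω) {a : Plane} {f g f' g' : Plane → V}
    (h : HasWeakDeriv Ω a f f')
    (hf : ∀ᵐ y, y ∈ Ω → f y = g y) (hf' : ∀ᵐ y, y ∈ Ω → f' y = g' y) :
    HasWeakDeriv Ω a g g' := by
  have e1 : f =ᵐ[volume.restrict Ω] g := (ae_restrict_iff' hΩ).2 hf
  have e2 : f' =ᵐ[volume.restrict Ω] g' := (ae_restrict_iff' hΩ).2 hf'
  have loc : ∀ {f g : Plane → V}, f =ᵐ[volume.restrict Ω] g → LocallyIntegrableOn f Ω →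
      LocallyIntegrableOn g Ω := by
    intro f g e h x hx
    obtain ⟨t, ht, ht'⟩ := h x hx
    refine ⟨t ∩ Ω, inter_mem ht self_mem_nhdsWithin, ?_⟩
    have h3 := (ht'.mono_set (inter_subset_left : t ∩ Ω ⊆ t))
    exact h3.congr (ae_mono (Measure.restrict_mono inter_subset_right le_rfl) e)
  refine ⟨loc e1 h.1, loc e2 h.2.1, fun φ h1 h2 h3 => ?_⟩
  have i1 : ∫ y in Ω, fderiv ℝ φ y a • f y = ∫ y in Ω, fderiv ℝ φ y a • g y :=
    integral_congr_ae (e1.mono fun y hy => by simp only [hy])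
  have i2 : ∫ y in Ω, φ y • f' y = ∫ y in Ω, φ y • g' y :=
    integral_congr_ae (e2.mono fun y hy => by simp only [hy])
  rw [← i1, ← i2, h.2.2 φ h1 h2 h3]

/-- The difference of the two derivatives integrates to zero against every smooth test function, so
the fundamental lemma of the calculus of variations applies. -/
theorem HasWeakDeriv.ae_unique [CompleteSpace V] (hΩ : IsOpen Ω) {a : Plane} {f g f' g' : Plane → V}
    (hf : HasWeakDeriv Ω a f f') (hg : HasWeakDeriv Ω a g g') (h : ∀ᵐ y, y ∈ Ω → f y = g y) :
    ∀ᵐ y, y ∈ Ω → f' y = g' y := by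
  have hf2 := hasWeakDeriv_iff.1 (hf.congr_ae hΩ.measurableSet h (Eventually.of_forall fun _ _ => rfl))
  rw [hasWeakDeriv_iff] at hg
  have := hΩ.ae_eq_zero_of_integral_contDiff_smul_eq_zero (μ := volume) (f := fun y => f' y - g' y)
    (hf2.2.1.sub hg.2.1) fun φ h1 h2 h3 => by
      have h1' : ContDiff ℝ 1 φ := h1.of_le (by exact_mod_cast le_top)
      simp only [smul_sub]
      rw [integral_sub (integrable_smul_of_tsupport_subset hf2.2.1 h1.continuous h2 h3)
        (integrable_smul_of_tsupport_subset hg.2.1 h1.continuous h2 h3),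
        ← neg_inj, neg_sub, sub_eq_neg_add, ← hf2.2.2 φ h1' h2 h3]
      rw [hg.2.2 φ h1' h2 h3]
      simp
  filter_upwards [this] with y hy h'
  exact sub_eq_zero.1 (hy h')

theorem HasWeakDeriv.const_smul_dir {f f' : Plane → V} {a : Plane} (t : ℝ)
    (h : HasWeakDeriv Ω a f f') : HasWeakDeriv Ω (t • a) f (fun y => t • f' y) := by
  rw [hasWeakDeriv_iff] at h ⊢
  refine ⟨h.1, h.2.1.smul t, fun φ h1 h2 h3 => ?_⟩
  simp only [map_smul, smul_assoc, smul_comm _ t, integral_smul]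
  rw [h.2.2 φ h1 h2 h3, smul_neg]

theorem HasWeakDeriv.add_dir {f f' g' : Plane → V} {a b : Plane}
    (h : HasWeakDeriv Ω a f f') (h' : HasWeakDeriv Ω b f g') :
    HasWeakDeriv Ω (a + b) f (fun y => f' y + g' y) := by
  rw [hasWeakDeriv_iff] at h h' ⊢
  refine ⟨h.1, h.2.1.add h'.2.1, fun φ h1 h2 h3 => ?_⟩
  simp only [map_add, add_smul, smul_add]
  rw [integral_add (integrable_fderiv_smul h.1 h1 h2 h3 a) (integrable_fderiv_smul h.1 h1 h2 h3 b),
    integral_add (integrable_smul_of_tsupport_subset h.2.1 h1.continuous h2 h3)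
      (integrable_smul_of_tsupport_subset h'.2.1 h1.continuous h2 h3),
    h.2.2 φ h1 h2 h3, h'.2.2 φ h1 h2 h3, neg_add]

theorem plane_eq_sum (a : Plane) : a = a 0 • stdVec 0 + a 1 • stdVec 1 := by
  ext i
  fin_cases i <;> simp [stdVec]

theorem HasWeakDeriv.of_stdVec {f : Plane → V} {f' : Fin 2 → Plane → V}
    (h : ∀ i, HasWeakDeriv Ω (stdVec i) f (f' i)) (a : Plane) :
    HasWeakDeriv Ω a f (fun y => ∑ i, a i • f' i y) := by
  have := ((h 0).const_smul_dir (a 0)).add_dir ((h 1).const_smul_dir (a 1))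
  rw [← plane_eq_sum] at this
  simpa [Fin.sum_univ_two] using this

/-- The product rule for weak derivatives, with an operator-valued coefficient of class `C¹`. -/
theorem HasWeakDeriv.clm_apply [FiniteDimensional ℝ V] [FiniteDimensional ℝ W] (hΩ : IsOpen Ω)
    {a : Plane} {f f' : Plane → V} (h : HasWeakDeriv Ω a f f') {T : Plane → V →L[ℝ] W}
    (hT : ContDiffOn ℝ 1 T Ω) :
    HasWeakDeriv Ω a (fun y => T y (f y)) (fun y => fderiv ℝ T y a (f y) + T y (f' y)) := by
  have : CompleteSpace V := FiniteDimensional.complete ℝ V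
  have : CompleteSpace W := FiniteDimensional.complete ℝ W
  -- In bases of V and W the operator is the sum of its scalar entries `t j k` times fixed rank-one
  -- maps `L j k`; this reduces the claim to the product rule with scalar coefficients.
  let b := Module.finBasis ℝ V
  let c := Module.finBasis ℝ W
  let t : Fin (Module.finrank ℝ V) → Fin (Module.finrank ℝ W) → (V →L[ℝ] W) →L[ℝ] ℝ := fun j k =>
    (LinearMap.toContinuousLinearMap (c.coord k)).comp (ContinuousLinearMap.apply ℝ W (b j))
  let L : Fin (Module.finrank ℝ V) → Fin (Module.finrank ℝ W) → V →L[ℝ] W := fun j k =>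
    (LinearMap.toContinuousLinearMap (b.coord j)).smulRight (c k)
  have ht : ∀ (S : V →L[ℝ] W) (v : V), S v = ∑ j, ∑ k, t j k S • L j k v := by
    intro S v
    conv_lhs => rw [← b.sum_repr v, map_sum]
    refine Finset.sum_congr rfl fun j _ => ?_
    rw [map_smul]
    conv_lhs => rw [← c.sum_repr (S (b j)), Finset.smul_sum]
    refine Finset.sum_congr rfl fun k _ => ?_
    simp [t, L, smul_smul, mul_comm]
  have key := HasWeakDeriv.sum (Ω := Ω) (a := a) Finset.univ (fun j _ => HasWeakDeriv.sum Finset.univ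
    (fun k _ => (h.clm_comp (L j k)).smul hΩ (θ := fun y => t j k (T y))
      ((t j k).contDiff.comp_contDiffOn hT)))
  refine key.congr_ae hΩ.measurableSet (Eventually.of_forall fun y _ => (ht _ _).symm)
    (Eventually.of_forall fun y hy => ?_)
  simp only [Finset.sum_add_distrib]
  rw [ht (T y), ht (fderiv ℝ T y a)]
  congr 1
  refine Finset.sum_congr rfl fun j _ => Finset.sum_congr rfl fun k _ => ?_
  have hd : DifferentiableAt ℝ T y :=
    (hT.contDiffAt (hΩ.mem_nhds hy)).differentiableAt one_ne_zero
  have : fderiv ℝ (fun y => t j k (T y)) y = (t j k).comp (fderiv ℝ T y) :=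
    ((t j k).hasFDerivAt.comp y hd.hasFDerivAt).fderiv
  rw [this]; rfl

end WeakDerivatives

end DiracSurface

end

/-! ### From weak to classical derivatives, up to the boundary of a half-plane. -/

noncomputable section

namespace DiracSurface

section ClassicalDerivatives

open Set Filter Topology ContinuousLinearMap Metric
open scoped Convolution

variable {V : Type*} [NormedAddCommGroup V] [NormedSpace ℝ V]

/-- A standard sequence of bump functions with supports shrinking to the origin. -/
def bumpSeq (n : ℕ) : ContDiffBump (0 : Plane) where
  rIn := 1 / (n + 2)
  rOut := 1 / (n + 1)
  rIn_pos := by positivity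
  rIn_lt_rOut := one_div_lt_one_div_of_lt (by positivity) (by linarith)

theorem tendsto_bumpSeq : Tendsto (fun n => (bumpSeq n).rOut) atTop (𝓝 0) :=
  tendsto_one_div_add_atTop_nhds_zero_nat

/-- A continuous function with continuous weak derivatives is differentiable. -/
theorem hasFDerivAt_of_hasWeakDeriv [CompleteSpace V] {Ω : Set Plane} (hΩ : IsOpen Ω)
    {f : Plane → V} {G : Plane → Plane →L[ℝ] V} (hf : ContinuousOn f Ω) (hG : ContinuousOn G Ω)
    (h : ∀ a, HasWeakDeriv Ω a f fun y => G y a) {y₀ : Plane} (hy₀ : y₀ ∈ Ω) :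
    HasFDerivAt f (G y₀) y₀ := by
  obtain ⟨r, hr, hrΩ⟩ := nhds_basis_closedBall.mem_iff.1 (hΩ.mem_nhds hy₀)
  set K := closedBall y₀ r with hK
  have hKc : IsCompact K := isCompact_closedBall y₀ r
  -- Cutting off to a closed ball makes the convolutions globally defined and changes nothing near
  -- y₀. The mollified functions then converge to f near y₀, their derivatives to G uniformly, and a
  -- limit theorem for derivatives applies.
  let F := K.indicator f
  let H := K.indicator G
  have hFi : Integrable F :=
    (integrable_indicator_iff isClosed_closedBall.measurableSet).2
      ((hf.mono hrΩ).integrableOn_compact hKc)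
  have hHi : Integrable H :=
    (integrable_indicator_iff isClosed_closedBall.measurableSet).2
      ((hG.mono hrΩ).integrableOn_compact hKc)
  have hFc : ∀ y ∈ ball y₀ r, Tendsto F (𝓝 y) (𝓝 (f y)) := fun y hy =>
    (hf.continuousAt (hΩ.mem_nhds (hrΩ (ball_subset_closedBall hy)))).tendsto.congr' (by
      filter_upwards [isOpen_ball.mem_nhds hy] with z hz
      exact (indicator_of_mem (ball_subset_closedBall hz) f).symm)
  have hHc : Tendsto H (𝓝 y₀) (𝓝 (G y₀)) :=
    (hG.continuousAt (hΩ.mem_nhds hy₀)).tendsto.congr' (by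
      filter_upwards [ball_mem_nhds y₀ hr] with z hz
      exact (indicator_of_mem (ball_subset_closedBall hz) G).symm)
  have hbs : ∀ n, HasCompactSupport ((bumpSeq n).normed volume) := fun n =>
    (bumpSeq n).hasCompactSupport_normed
  have hbd : ∀ n, ContDiff ℝ 1 ((bumpSeq n).normed (volume : Measure Plane)) := fun n =>
    (bumpSeq n).contDiff_normed
  refine hasFDerivAt_of_tendstoUniformlyOnFilter (l := atTop) (𝕜 := ℝ)
    (f := fun n => (bumpSeq n).normed volume ⋆[lsmul ℝ ℝ, volume] F)
    (f' := fun n => (bumpSeq n).normed volume ⋆[lsmul ℝ ℝ, volume] H) ?_ ?_ ?_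
  · rw [Metric.tendstoUniformlyOnFilter_iff]
    -- Uniformity near y₀ is read off from the joint limit n → ∞, y → y₀: the mollified derivative
    -- and G y both tend to G y₀.
    have t1 : Tendsto (fun i : ℕ × Plane =>
        ((bumpSeq i.1).normed volume ⋆[lsmul ℝ ℝ, volume] H) i.2) (atTop ×ˢ 𝓝 y₀) (𝓝 (G y₀)) :=
      ContDiffBump.convolution_tendsto_right (g := fun _ => H) (φ := fun i : ℕ × Plane => bumpSeq i.1)
        (tendsto_bumpSeq.comp tendsto_fst) (Eventually.of_forall fun _ => hHi.aestronglyMeasurable)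
        (hHc.comp tendsto_snd) tendsto_snd
    have t2 : Tendsto (fun i : ℕ × Plane => G i.2) (atTop ×ˢ 𝓝 y₀) (𝓝 (G y₀)) :=
      (hG.continuousAt (hΩ.mem_nhds hy₀)).tendsto.comp tendsto_snd
    have t3 := t2.dist t1
    rw [dist_self] at t3
    intro ε hε
    exact t3.eventually (gt_mem_nhds hε)
  · have e1 : ∀ᶠ i : ℕ × Plane in atTop ×ˢ 𝓝 y₀, (bumpSeq i.1).rOut < r / 2 :=
      (tendsto_bumpSeq.comp tendsto_fst).eventually (gt_mem_nhds (half_pos hr))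
    have e2 : ∀ᶠ i : ℕ × Plane in atTop ×ˢ 𝓝 y₀, i.2 ∈ ball y₀ (r / 2) :=
      tendsto_snd.eventually (ball_mem_nhds y₀ (half_pos hr))
    filter_upwards [e1, e2] with i h1 h2
    obtain ⟨n, y⟩ := i
    dsimp only at h1 h2 ⊢
    set φ := (bumpSeq n).normed (volume : Measure Plane) with hφ
    have hD := (hbs n).hasFDerivAt_convolution_left (lsmul ℝ ℝ) (μ := volume) (hbd n)
      hFi.locallyIntegrable y
    convert hD using 1
    ext a
    -- The reflected and translated bump is the test function. The two bounds by r/2 keep its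
    -- support in K, and testing the weak derivative against it says that the derivative of the
    -- convolution of f is the convolution of G.
    let ψ : Plane → ℝ := fun z => φ (y - z)
    have hψ : ContDiff ℝ 1 ψ := (hbd n).comp (contDiff_const.sub contDiff_id)
    have hψs : tsupport ψ ⊆ K := by
      refine closure_minimal (fun z hz => ?_) isClosed_closedBall
      have : y - z ∈ Function.support φ := hz
      rw [hφ, (bumpSeq n).support_normed_eq, mem_ball, dist_zero_right] at this
      rw [mem_ball] at h2
      rw [hK, mem_closedBall]
      have h3 : dist z y = ‖y - z‖ := by rw [dist_comm, dist_eq_norm]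
      linarith [dist_triangle z y y₀]
    have hψc : HasCompactSupport ψ := hKc.of_isClosed_subset (isClosed_tsupport ψ) hψs
    have hψd : ∀ z, fderiv ℝ ψ z a = - fderiv ℝ φ (y - z) a := fun z => by
      have : HasFDerivAt ψ ((fderiv ℝ φ (y - z)).comp (-ContinuousLinearMap.id ℝ Plane)) z :=
        ((hbd n).differentiable one_ne_zero (y - z)).hasFDerivAt.comp z
          ((hasFDerivAt_id z).const_sub y)
      rw [this.fderiv]; simp
    have key := (hasWeakDeriv_iff.1 (h a)).2.2 ψ hψ hψc (hψs.trans hrΩ)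
    have c1 := (((hbs n).fderiv ℝ).convolutionExists_left (precompL Plane (lsmul ℝ ℝ))
      ((hbd n).continuous_fderiv one_ne_zero) hFi.locallyIntegrable y)
    have c2 := (hbs n).convolutionExists_left (lsmul ℝ ℝ) (hbd n).continuous
      (g := H) hHi.locallyIntegrable y
    rw [convolution_def, convolution_def, ContinuousLinearMap.integral_apply c1,
      ContinuousLinearMap.integral_apply c2]
    rw [← integral_sub_left_eq_self _ volume y,
      ← integral_sub_left_eq_self (fun t => (precompL Plane (lsmul ℝ ℝ) (fderiv ℝ φ t) (F (y - t))) a)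
        volume y]
    rw [← neg_inj, ← integral_neg, ← integral_neg]
    calc ∫ z, -((lsmul ℝ ℝ (φ (y - z))) (H (y - (y - z)))) a = ∫ z, -(ψ z • G z a) := by
          congr 1; ext1 z
          have e : ((lsmul ℝ ℝ (φ (y - z))) (H (y - (y - z)))) a = ψ z • H (y - (y - z)) a := rfl
          rw [e, sub_sub_cancel]
          by_cases hz : z ∈ tsupport ψ
          · rw [show H z = G z from indicator_of_mem (hψs hz) G]
          · rw [image_eq_zero_of_notMem_tsupport hz, zero_smul, zero_smul]
      _ = ∫ z, fderiv ℝ ψ z a • f z := by rw [key, integral_neg]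
      _ = _ := by
          congr 1; ext1 z
          rw [sub_sub_cancel, precompL_apply, lsmul_apply, ← neg_smul, ← hψd]
          by_cases hz : z ∈ tsupport ψ
          · have : F z = f z := indicator_of_mem (hψs hz) f
            rw [this]
          · rw [fderiv_apply_eq_zero_of_notMem_tsupport hz]; simp
  · filter_upwards [ball_mem_nhds y₀ hr] with y hy
    have := ContDiffBump.convolution_tendsto_right (μ := (volume : Measure Plane)) (g := fun _ => F)
      (φ := bumpSeq) (k := fun _ => y) (x₀ := y) (z₀ := f y)
      tendsto_bumpSeq (Eventually.of_forall fun _ => hFi.aestronglyMeasurable)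
      ((hFc y hy).comp tendsto_snd) tendsto_const_nhds
    exact this

/-- The closed half-plane. -/
def halfPlane : Set Plane := {y | 0 ≤ y 0}

/-- The sets that are relatively open in the closed half-plane. -/
def IsHalfOpen (S : Set Plane) : Prop := ∃ O : Set Plane, IsOpen O ∧ S = O ∩ halfPlane

theorem convex_halfPlane : Convex ℝ halfPlane := by
  intro x hx y hy a b ha hb _
  have hx' : 0 ≤ x 0 := hx
  have hy' : 0 ≤ y 0 := hy
  show 0 ≤ (a • x + b • y) 0
  simp only [PiLp.add_apply, PiLp.smul_apply, smul_eq_mul]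
  positivity

theorem isOpen_openHalfPlane : IsOpen {y : Plane | 0 < y 0} :=
  isOpen_lt continuous_const (EuclideanSpace.proj (𝕜 := ℝ) (0 : Fin 2)).continuous

theorem isClosed_halfPlane : IsClosed halfPlane :=
  isClosed_le continuous_const (EuclideanSpace.proj (𝕜 := ℝ) (0 : Fin 2)).continuous

theorem openHalfPlane_subset : {y : Plane | 0 < y 0} ⊆ halfPlane :=
  fun y (hy : 0 < y 0) => show 0 ≤ y 0 from hy.le

theorem add_smul_mem_openHalfPlane {z : Plane} (hz : z ∈ halfPlane) {t : ℝ} (ht : 0 < t) :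
    0 < (z + t • stdVec 0) 0 := by
  have : 0 ≤ z 0 := hz
  simp only [stdVec, PiLp.add_apply, PiLp.smul_apply, smul_eq_mul, EuclideanSpace.single, PiLp.single_apply,
    if_true, mul_one]
  linarith

theorem mem_closure_inter_openHalfPlane {O : Set Plane} (hO : IsOpen O) {z : Plane}
    (hz : z ∈ O ∩ halfPlane) : z ∈ closure (O ∩ {y | 0 < y 0}) := by
  have hc : Tendsto (fun t : ℝ => z + t • stdVec 0) (𝓝[>] 0) (𝓝 z) := by
    have : Continuous fun t : ℝ => z + t • stdVec 0 := by fun_prop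
    have := this.tendsto 0
    rw [zero_smul, add_zero] at this
    exact this.mono_left nhdsWithin_le_nhds
  refine mem_closure_of_tendsto hc ?_
  filter_upwards [self_mem_nhdsWithin, hc (hO.mem_nhds hz.1)] with t h1 h2
  exact ⟨h2, add_smul_mem_openHalfPlane hz.2 h1⟩

theorem IsHalfOpen.inter_openHalfPlane_subset {S : Set Plane} {O : Set Plane} (hO : IsOpen O)
    (hS : S = O ∩ halfPlane) : O ∩ {y | 0 < y 0} ⊆ interior S :=
  interior_maximal (by rw [hS]; exact fun y hy => ⟨hy.1, openHalfPlane_subset hy.2⟩)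
    (hO.inter isOpen_openHalfPlane)

theorem IsHalfOpen.uniqueDiffOn {S : Set Plane} (hS : IsHalfOpen S) : UniqueDiffOn ℝ S := by
  obtain ⟨O, hO, rfl⟩ := hS
  rw [inter_comm]
  refine UniqueDiffOn.inter (uniqueDiffOn_convex convex_halfPlane ⟨stdVec 0, ?_⟩) hO
  have : ({y : Plane | 0 < y 0} : Set Plane) ⊆ interior halfPlane :=
    interior_maximal openHalfPlane_subset isOpen_openHalfPlane
  exact this (by simp [stdVec])

/-- A derivative in the interior that extends continuously is a derivative up to the boundary. -/
theorem IsHalfOpen.hasFDerivWithinAt {S : Set Plane} (hS : IsHalfOpen S) {f : Plane → V}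
    {G : Plane → Plane →L[ℝ] V} (hf : ContinuousOn f S) (hG : ContinuousOn G S)
    (h : ∀ y ∈ interior S, HasFDerivAt f (G y) y) {y : Plane} (hy : y ∈ S) :
    HasFDerivWithinAt f (G y) S y := by
  obtain ⟨O, hO, rfl⟩ := hS
  obtain ⟨r, hr, hrO⟩ := nhds_basis_closedBall.mem_iff.1 (hO.mem_nhds hy.1)
  -- The theorem extending a derivative to the closure requires a convex open set; a half-ball has
  -- this property, and its closure stays inside the given set.
  set s : Set Plane := ball y r ∩ {z | 0 < z 0} with hs
  have hsi : s ⊆ interior (O ∩ halfPlane) := fun z hz =>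
    IsHalfOpen.inter_openHalfPlane_subset hO rfl ⟨hrO (ball_subset_closedBall hz.1), hz.2⟩
  have hcl : closure s ⊆ O ∩ halfPlane := by
    refine (closure_minimal ?_ (isClosed_closedBall.inter isClosed_halfPlane)).trans
      (inter_subset_inter_left halfPlane hrO)
    exact inter_subset_inter ball_subset_closedBall openHalfPlane_subset
  have hconv : Convex ℝ s := (convex_ball y r).inter (by
    intro x hx z hz a b ha hb hab
    have hx' : 0 < x 0 := hx
    have hz' : 0 < z 0 := hz
    show 0 < (a • x + b • z) 0
    simp only [PiLp.add_apply, PiLp.smul_apply, smul_eq_mul]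
    rcases ha.eq_or_lt with rfl | ha'
    · have : b = 1 := by linarith
      subst this; linarith
    · nlinarith [mul_pos ha' hx', mul_nonneg hb hz'.le])
  have key := hasFDerivWithinAt_closure_of_tendsto_fderiv (f := f) (s := s) (x := y) (f' := G y)
    (fun z hz => (h z (hsi hz)).differentiableAt.differentiableWithinAt) hconv
    (isOpen_ball.inter isOpen_openHalfPlane)
    (fun z hz => (hf z (hcl hz)).mono (fun w hw => hcl (subset_closure hw)))
    (by
      have : Tendsto G (𝓝[s] y) (𝓝 (G y)) :=
        ((hG y hy).mono (fun w hw => hcl (subset_closure hw)))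
      refine this.congr' ?_
      filter_upwards [self_mem_nhdsWithin] with z hz
      exact (h z (hsi hz)).fderiv.symm)
  -- Near y the given set lies in the closure of the half-ball, since boundary points are limits
  -- along the inner normal.
  refine key.mono_of_mem_nhdsWithin ?_
  have : ball y r ∩ (O ∩ halfPlane) ∈ 𝓝[O ∩ halfPlane] y :=
    inter_mem (mem_nhdsWithin_of_mem_nhds (ball_mem_nhds y hr)) self_mem_nhdsWithin
  exact mem_of_superset this fun z hz => mem_closure_inter_openHalfPlane isOpen_ball ⟨hz.1, hz.2.2⟩

/-- A function that is continuous up to the boundary and whose weak derivatives have continuous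
extensions is continuously differentiable up to the boundary. -/
theorem IsHalfOpen.hasFDerivWithinAt_of_hasWeakDeriv [CompleteSpace V] {S : Set Plane}
    (hS : IsHalfOpen S) {f : Plane → V} {f' : Fin 2 → Plane → V} (hf : ContinuousOn f S)
    (hf' : ∀ i, ContinuousOn (f' i) S)
    (h : ∀ i, HasWeakDeriv (interior S) (stdVec i) f (f' i)) {y : Plane} (hy : y ∈ S) :
    HasFDerivWithinAt f
      (∑ i, (EuclideanSpace.proj i : Plane →L[ℝ] ℝ).smulRight (f' i y)) S y := by
  have hG : ContinuousOn
      (fun y => ∑ i, (EuclideanSpace.proj i : Plane →L[ℝ] ℝ).smulRight (f' i y)) S :=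
    continuousOn_finsetSum _ fun i _ =>
      (ContinuousLinearMap.smulRightL ℝ Plane V (EuclideanSpace.proj i)).continuous.comp_continuousOn
        (hf' i)
  refine hS.hasFDerivWithinAt (G := fun y => ∑ i,
    (EuclideanSpace.proj i : Plane →L[ℝ] ℝ).smulRight (f' i y)) hf hG (fun z hz => ?_) hy
  refine hasFDerivAt_of_hasWeakDeriv isOpen_interior (G := fun y => ∑ i,
    (EuclideanSpace.proj i : Plane →L[ℝ] ℝ).smulRight (f' i y)) (hf.mono interior_subset)
    (hG.mono interior_subset) (fun a => ?_) hz
  simpa [sum_apply] using HasWeakDeriv.of_stdVec h a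

end ClassicalDerivatives

end DiracSurface

end

/-! ### Hölder classes up to the boundary: stability properties and gain of regularity. -/

noncomputable section

namespace DiracSurface

section HolderClasses

open Set Filter Topology Metric
open scoped NNReal

universe u v w

set_option linter.unusedSectionVars false

variable {V : Type u} [NormedAddCommGroup V] [NormedSpace ℝ V]
  {W : Type v} [NormedAddCommGroup W] [NormedSpace ℝ W]
  {X : Type w} [NormedAddCommGroup X] [NormedSpace ℝ X]
  {S : Set Plane} {α : ℝ≥0} {k : ℕ}

/-- The class of `C^k` functions whose `k`-th derivative is locally Hölder continuous with
exponent `α`. -/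
def HolderClass (k : ℕ) (α : ℝ≥0) (f : Plane → V) (S : Set Plane) : Prop :=
  ContDiffOn ℝ (k : ℕ∞) f S ∧
    ∀ K ⊆ S, IsCompact K → ∃ C : ℝ≥0, HolderOnWith C α (iteratedFDerivWithin ℝ k f S) K

theorem memHolderLoc_iff {ρ : ℝ} {f : Plane → V} :
    MemHolderLoc ρ f S ↔ HolderClass ⌊ρ⌋₊ (ρ - ⌊ρ⌋₊).toNNReal f S := Iff.rfl

theorem holderOnWith_isometryEquiv_comp {Y Z : Type*} [NormedAddCommGroup Y] [NormedSpace ℝ Y]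
    [NormedAddCommGroup Z] [NormedSpace ℝ Z] (e : Y ≃ₗᵢ[ℝ] Z) {C : ℝ≥0} {f : Plane → Y}
    {K : Set Plane} : HolderOnWith C α (e ∘ f) K ↔ HolderOnWith C α f K := by
  simp only [HolderOnWith, Function.comp_apply, e.edist_map]

theorem holderOnWith_congr {C : ℝ≥0} {f g : Plane → V} {K : Set Plane} (h : EqOn f g K) :
    HolderOnWith C α f K ↔ HolderOnWith C α g K :=
  forall₂_congr fun x hx => forall₂_congr fun y hy => by rw [h hx, h hy]

theorem HolderClass.congr {f g : Plane → V} (hf : HolderClass k α f S)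
    (h : EqOn g f S) : HolderClass k α g S := by
  refine ⟨hf.1.congr h, fun K hK hc => ?_⟩
  obtain ⟨C, hC⟩ := hf.2 K hK hc
  exact ⟨C, (holderOnWith_congr fun y hy => iteratedFDerivWithin_congr h (hK hy) k).2 hC⟩

theorem holderClass_zero {f : Plane → V} :
    HolderClass 0 α f S ↔ ContinuousOn f S ∧
      ∀ K ⊆ S, IsCompact K → ∃ C : ℝ≥0, HolderOnWith C α f K := by
  unfold HolderClass
  refine and_congr (by simp [contDiffOn_zero]) (forall₃_congr fun K _ _ => exists_congr fun C => ?_)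
  rw [iteratedFDerivWithin_zero_eq_comp, holderOnWith_isometryEquiv_comp]

/-- Currying is an isometry between the (k+1)-st derivative of f and the k-th derivative of the
first derivative. With `holderClass_zero` this turns the definition into a recursion on k in which
the target space varies, and the stability properties below follow it. -/
theorem holderClass_succ (hS : UniqueDiffOn ℝ S) {f : Plane → V} :
    HolderClass (k + 1) α f S ↔ DifferentiableOn ℝ f S ∧
      HolderClass k α (fderivWithin ℝ f S) S := by
  unfold HolderClass
  have h1 : ContDiffOn ℝ ((k + 1 : ℕ) : ℕ∞) f S ↔ DifferentiableOn ℝ f S ∧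
      ContDiffOn ℝ (k : ℕ∞) (fderivWithin ℝ f S) S := by
    have := contDiffOn_succ_iff_fderivWithin (𝕜 := ℝ) (n := ((k : ℕ∞) : ℕ∞ω)) (f := f) hS
    push_cast at this ⊢
    rw [this]
    simp
  rw [h1, and_assoc]
  refine and_congr_right fun _ => and_congr_right fun _ =>
    forall₃_congr fun K hK _ => exists_congr fun C => ?_
  rw [← holderOnWith_isometryEquiv_comp (continuousMultilinearCurryRightEquiv' ℝ k Plane V).symm
    (f := iteratedFDerivWithin ℝ k (fderivWithin ℝ f S) S)]
  exact holderOnWith_congr fun y hy => iteratedFDerivWithin_succ_eq_comp_right hS (hK hy)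

theorem holderOnWith_of_dist_le {f : Plane → V} {K : Set Plane} {C : ℝ≥0}
    (h : ∀ x ∈ K, ∀ y ∈ K, dist (f x) (f y) ≤ C * dist x y ^ (α : ℝ)) : HolderOnWith C α f K := by
  intro x hx y hy
  rw [edist_nndist, edist_nndist, ← ENNReal.coe_rpow_of_nonneg _ (NNReal.coe_nonneg α),
    ← ENNReal.coe_mul, ENNReal.coe_le_coe, ← NNReal.coe_le_coe]
  push_cast
  exact h x hx y hy

/-- Local Hölder bounds on a compact set give a global one. -/
theorem exists_holderOnWith_of_local {f : Plane → V} {K : Set Plane} (hK : IsCompact K)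
    (hf : ContinuousOn f K) (hα : α ≤ 1)
    (h : ∀ y ∈ K, ∃ C : ℝ≥0, ∃ t ∈ 𝓝[K] y, LipschitzOnWith C f t) :
    ∃ C : ℝ≥0, HolderOnWith C α f K := by
  have hb : ∀ z ∈ K ×ˢ K, ∃ t ∈ 𝓝[K ×ˢ K] z, ∃ C : ℝ, ∀ w ∈ t,
      dist (f w.1) (f w.2) ≤ C * dist w.1 w.2 ^ (α : ℝ) := by
    rintro ⟨x, y⟩ ⟨hx, hy⟩
    dsimp only at hx hy
    -- The estimate is proved locally on K × K. At a diagonal point it follows from the Lipschitz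
    -- bound; elsewhere the Hölder quotient is continuous, hence locally bounded. Compactness of K ×
    -- K then gives one constant.
    by_cases hxy : x = y
    · subst hxy
      obtain ⟨C, t, ht, hC⟩ := h x hx
      -- Radius 1/2 keeps any two points at distance d ≤ 1, where d ≤ d ^ α because α ≤ 1.
      have ht' : t ∩ ball x (1 / 2) ∈ 𝓝[K] x :=
        inter_mem ht (mem_nhdsWithin_of_mem_nhds (ball_mem_nhds x (by norm_num)))
      refine ⟨(t ∩ ball x (1 / 2)) ×ˢ (t ∩ ball x (1 / 2)), ?_, C, ?_⟩
      · rw [nhdsWithin_prod_eq]; exact prod_mem_prod ht' ht'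
      · rintro ⟨p, q⟩ ⟨⟨hp, hp'⟩, ⟨hq, hq'⟩⟩
        refine (hC.dist_le_mul p hp q hq).trans (mul_le_mul_of_nonneg_left ?_ C.2)
        have hd : dist p q ≤ 1 := by
          rw [mem_ball] at hp' hq'
          dsimp only at hp' hq'
          linarith [dist_triangle_right p q x]
        calc dist p q = dist p q ^ (1 : ℝ) := (Real.rpow_one _).symm
          _ ≤ dist p q ^ (α : ℝ) := by
            rcases (dist_nonneg (x := p) (y := q)).eq_or_lt with h0 | h0
            · rw [← h0, Real.zero_rpow one_ne_zero]; positivity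
            · exact Real.rpow_le_rpow_of_exponent_ge h0 hd (by exact_mod_cast hα)
    · have hpos : 0 < dist x y := dist_pos.2 hxy
      have hq : Tendsto (fun w : Plane × Plane => dist (f w.1) (f w.2) / dist w.1 w.2 ^ (α : ℝ))
          (𝓝[K ×ˢ K] (x, y)) (𝓝 (dist (f x) (f y) / dist x y ^ (α : ℝ))) := by
        rw [nhdsWithin_prod_eq]
        refine Tendsto.div (((hf x hx).tendsto.comp tendsto_fst).dist
          ((hf y hy).tendsto.comp tendsto_snd)) ?_ (by positivity)
        have : Tendsto (fun w : Plane × Plane => dist w.1 w.2) (𝓝[K] x ×ˢ 𝓝[K] y) (𝓝 (dist x y)) :=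
          ((tendsto_id.mono_left nhdsWithin_le_nhds).comp tendsto_fst).dist
            ((tendsto_id.mono_left nhdsWithin_le_nhds).comp tendsto_snd)
        exact this.rpow_const (Or.inl hpos.ne')
      have hd : ∀ᶠ w : Plane × Plane in 𝓝[K ×ˢ K] (x, y), 0 < dist w.1 w.2 :=
        (continuous_dist.continuousAt.eventually (lt_mem_nhds hpos)).filter_mono
          nhdsWithin_le_nhds
      refine ⟨_, (hq.eventually (gt_mem_nhds (lt_add_one _))).and hd,
        dist (f x) (f y) / dist x y ^ (α : ℝ) + 1, ?_⟩
      rintro w ⟨h1, h2⟩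
      have : 0 < dist w.1 w.2 ^ (α : ℝ) := by positivity
      exact (div_le_iff₀ this).1 h1.le
  have := (hK.prod hK).induction_on (p := fun t : Set (Plane × Plane) => ∃ C : ℝ, ∀ w ∈ t,
      dist (f w.1) (f w.2) ≤ C * dist w.1 w.2 ^ (α : ℝ)) ⟨0, by simp⟩
    (fun s t hst ⟨C, hC⟩ => ⟨C, fun w hw => hC w (hst hw)⟩)
    (fun s t ⟨C, hC⟩ ⟨C', hC'⟩ => ⟨max C C', ?_⟩) hb
  · obtain ⟨C, hC⟩ := this
    refine ⟨C.toNNReal, holderOnWith_of_dist_le fun x hx y hy => ?_⟩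
    have h1 := hC (x, y) ⟨hx, hy⟩
    have h2 : dist (f x) (f y) ≤ C.toNNReal * dist x y ^ (α : ℝ) :=
      h1.trans (mul_le_mul_of_nonneg_right (Real.le_coe_toNNReal C) (by positivity))
    exact h2
  · rintro w (hw | hw)
    · exact (hC w hw).trans (mul_le_mul_of_nonneg_right (le_max_left _ _) (by positivity))
    · exact (hC' w hw).trans (mul_le_mul_of_nonneg_right (le_max_right _ _) (by positivity))

/-- Half-balls are convex, so a C¹ function is locally Lipschitz up to the boundary, and local
bounds globalise on compact sets. -/
theorem IsHalfOpen.holderClass_zero_of_contDiffOn (hS : IsHalfOpen S) (hα : α ≤ 1) {f : Plane → V}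
    (hf : ContDiffOn ℝ 1 f S) : HolderClass 0 α f S := by
  refine holderClass_zero.2 ⟨hf.continuousOn, fun K hK hc =>
    exists_holderOnWith_of_local hc (hf.continuousOn.mono hK) hα fun y hy => ?_⟩
  obtain ⟨O, hO, rfl⟩ := hS
  obtain ⟨r, hr, hrO⟩ := nhds_basis_ball.mem_iff.1 (hO.mem_nhds (hK hy).1)
  have hsub : ball y r ∩ halfPlane ⊆ O ∩ halfPlane := inter_subset_inter_left _ hrO
  obtain ⟨C, t, ht, hC⟩ := ((hf y (hK hy)).mono hsub).exists_lipschitzOnWith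
    ((convex_ball y r).inter convex_halfPlane)
  refine ⟨C, t, ?_, hC⟩
  rw [nhdsWithin_inter_of_mem (mem_nhdsWithin_of_mem_nhds (ball_mem_nhds y hr))] at ht
  exact nhdsWithin_mono y (fun z hz => (hK hz).2) ht

theorem IsHalfOpen.holderClass_of_contDiffOn (hS : IsHalfOpen S) (hα : α ≤ 1) (k : ℕ)
    {f : Plane → V} (hf : ContDiffOn ℝ (k + 1 : ℕ) f S) : HolderClass k α f S := by
  induction k generalizing V with
  | zero => exact hS.holderClass_zero_of_contDiffOn hα (by simpa using hf)
  | succ k ih =>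
    have := (contDiffOn_succ_iff_fderivWithin (𝕜 := ℝ) (n := ((k + 1 : ℕ) : ℕ∞ω)) (f := f)
      hS.uniqueDiffOn).1 (by exact_mod_cast hf)
    exact (holderClass_succ hS.uniqueDiffOn).2 ⟨this.1, ih this.2.2⟩

theorem IsHalfOpen.holderClass_of_smooth (hS : IsHalfOpen S) (hα : α ≤ 1)
    {f : Plane → V} (hf : ContDiffOn ℝ ∞ f S) : HolderClass k α f S :=
  hS.holderClass_of_contDiffOn hα k (hf.of_le (by exact_mod_cast le_top))

theorem HolderClass.of_succ (hS : IsHalfOpen S) (hα : α ≤ 1) {f : Plane → V}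
    (hf : HolderClass (k + 1) α f S) : HolderClass k α f S :=
  hS.holderClass_of_contDiffOn hα k (by exact_mod_cast hf.1)

theorem HolderClass.add (hS : IsHalfOpen S) {f g : Plane → V}
    (hf : HolderClass k α f S) (hg : HolderClass k α g S) :
    HolderClass k α (fun y => f y + g y) S := by
  induction k generalizing V with
  | zero =>
    rw [holderClass_zero] at hf hg ⊢
    refine ⟨hf.1.add hg.1, fun K hK hc => ?_⟩
    obtain ⟨C, hC⟩ := hf.2 K hK hc
    obtain ⟨C', hC'⟩ := hg.2 K hK hc
    refine ⟨C + C', fun x hx y hy => (edist_add_add_le _ _ _ _).trans ?_⟩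
    rw [ENNReal.coe_add, add_mul]
    exact add_le_add (hC x hx y hy) (hC' x hx y hy)
  | succ k ih =>
    have hu := hS.uniqueDiffOn
    rw [holderClass_succ hu] at hf hg ⊢
    exact ⟨hf.1.add hg.1, (ih hf.2 hg.2).congr fun y hy =>
      fderivWithin_fun_add (hu y hy) (hf.1 y hy) (hg.1 y hy)⟩

/-- Induction on k by the Leibniz rule: the derivative is a sum of two bilinear expressions, each
with one differentiated factor, and the other factor also lies in the lower class by
`HolderClass.of_succ`. -/
theorem HolderClass.bilin (hS : IsHalfOpen S) (hα : α ≤ 1) (B : V →L[ℝ] W →L[ℝ] X)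
    {f : Plane → V} {g : Plane → W} (hf : HolderClass k α f S) (hg : HolderClass k α g S) :
    HolderClass k α (fun y => B (f y) (g y)) S := by
  induction k generalizing V W X with
  | zero =>
    rw [holderClass_zero] at hf hg ⊢
    refine ⟨B.isBoundedBilinearMap.continuous.comp_continuousOn (hf.1.prodMk hg.1),
      fun K hK hc => ?_⟩
    obtain ⟨C, hC⟩ := hf.2 K hK hc
    obtain ⟨C', hC'⟩ := hg.2 K hK hc
    obtain ⟨M, hM⟩ := hc.exists_bound_of_continuousOn (hf.1.mono hK)
    obtain ⟨N, hN⟩ := hc.exists_bound_of_continuousOn (hg.1.mono hK)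
    -- The constant comes from B(f x, g x) − B(f y, g y) = B(f x − f y, g x) + B(f y, g x − g y),
    -- with M and N bounding f and g on K.
    refine ⟨‖B‖₊ * (C * N.toNNReal + M.toNNReal * C'), holderOnWith_of_dist_le fun x hx y hy => ?_⟩
    have h1 : dist (f x) (f y) ≤ C * dist x y ^ (α : ℝ) := hC.dist_le hx hy
    have h2 : dist (g x) (g y) ≤ C' * dist x y ^ (α : ℝ) := hC'.dist_le hx hy
    have h3 : dist (B (f x) (g x)) (B (f y) (g y)) ≤
        ‖B‖ * (C * N.toNNReal + M.toNNReal * C') * dist x y ^ (α : ℝ) := by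
      rw [dist_eq_norm] at h1 h2 ⊢
      have e : B (f x) (g x) - B (f y) (g y) = B (f x - f y) (g x) + B (f y) (g x - g y) := by
        simp
      rw [e]
      have n1 : ‖g x‖ ≤ N.toNNReal := (hN x hx).trans (Real.le_coe_toNNReal N)
      have n2 : ‖f y‖ ≤ M.toNNReal := (hM y hy).trans (Real.le_coe_toNNReal M)
      calc _ ≤ ‖B‖ * ‖f x - f y‖ * ‖g x‖ + ‖B‖ * ‖f y‖ * ‖g x - g y‖ :=
            norm_add_le_of_le (B.le_opNorm₂ _ _) (B.le_opNorm₂ _ _)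
        _ ≤ ‖B‖ * (C * dist x y ^ (α : ℝ)) * N.toNNReal
            + ‖B‖ * M.toNNReal * (C' * dist x y ^ (α : ℝ)) := by gcongr
        _ = _ := by ring
    push_cast
    exact h3
  | succ k ih =>
    have hu := hS.uniqueDiffOn
    have hf' := hf.of_succ hS hα
    have hg' := hg.of_succ hS hα
    rw [holderClass_succ hu] at hf hg ⊢
    refine ⟨fun y hy => (B.hasFDerivWithinAt_of_bilinear (hf.1 y hy).hasFDerivWithinAt
      (hg.1 y hy).hasFDerivWithinAt).differentiableWithinAt, ?_⟩
    refine ((ih (B.precompR Plane) hf' hg.2).add hS (ih (B.precompL Plane) hf.2 hg')).congr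
      fun y hy => ?_
    exact (B.hasFDerivWithinAt_of_bilinear (hf.1 y hy).hasFDerivWithinAt
      (hg.1 y hy).hasFDerivWithinAt).fderivWithin (hu y hy)

theorem frac_le_one (ρ : ℝ) : (ρ - ⌊ρ⌋₊).toNNReal ≤ 1 := by
  rw [Real.toNNReal_le_iff_le_coe]
  have := Nat.lt_floor_add_one ρ
  simp only [NNReal.coe_one]
  linarith

variable {ρ : ℝ}

theorem IsHalfOpen.memHolderLoc_of_smooth (hS : IsHalfOpen S) {f : Plane → V}
    (hf : ContDiffOn ℝ ∞ f S) (ρ : ℝ) : MemHolderLoc ρ f S :=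
  hS.holderClass_of_smooth (frac_le_one ρ) hf

theorem MemHolderLoc.congr {f g : Plane → V} (hf : MemHolderLoc ρ f S) (h : EqOn g f S) :
    MemHolderLoc ρ g S := HolderClass.congr hf h

theorem MemHolderLoc.add (hS : IsHalfOpen S) {f g : Plane → V} (hf : MemHolderLoc ρ f S)
    (hg : MemHolderLoc ρ g S) : MemHolderLoc ρ (fun y => f y + g y) S :=
  HolderClass.add hS hf hg

theorem MemHolderLoc.bilin (hS : IsHalfOpen S) (B : V →L[ℝ] W →L[ℝ] X)
    {f : Plane → V} {g : Plane → W} (hf : MemHolderLoc ρ f S) (hg : MemHolderLoc ρ g S) :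
    MemHolderLoc ρ (fun y => B (f y) (g y)) S :=
  HolderClass.bilin hS (frac_le_one ρ) B hf hg

theorem IsHalfOpen.memHolderLoc_const (hS : IsHalfOpen S) (v : V) :
    MemHolderLoc ρ (fun _ => v) S :=
  hS.memHolderLoc_of_smooth contDiffOn_const ρ

theorem MemHolderLoc.clm_apply (hS : IsHalfOpen S) {T : Plane → V →L[ℝ] W} {f : Plane → V}
    (hT : MemHolderLoc ρ T S) (hf : MemHolderLoc ρ f S) : MemHolderLoc ρ (fun y => T y (f y)) S :=
  MemHolderLoc.bilin hS (ContinuousLinearMap.id ℝ (V →L[ℝ] W)) hT hf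

theorem MemHolderLoc.clm_comp (hS : IsHalfOpen S) (L : V →L[ℝ] W) {f : Plane → V}
    (hf : MemHolderLoc ρ f S) : MemHolderLoc ρ (fun y => L (f y)) S :=
  MemHolderLoc.clm_apply hS (hS.memHolderLoc_const L) hf

theorem MemHolderLoc.smul (hS : IsHalfOpen S) {θ : Plane → ℝ} {f : Plane → V}
    (hθ : MemHolderLoc ρ θ S) (hf : MemHolderLoc ρ f S) : MemHolderLoc ρ (fun y => θ y • f y) S :=
  MemHolderLoc.bilin hS (ContinuousLinearMap.lsmul ℝ ℝ) hθ hf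

theorem MemHolderLoc.sub (hS : IsHalfOpen S) {f g : Plane → V} (hf : MemHolderLoc ρ f S)
    (hg : MemHolderLoc ρ g S) : MemHolderLoc ρ (fun y => f y - g y) S :=
  (hf.add hS (hg.clm_comp hS (-ContinuousLinearMap.id ℝ V))).congr fun y _ => by
    simp [sub_eq_add_neg]

theorem MemHolderLoc.sum (hS : IsHalfOpen S) {ι : Type*} (s : Finset ι) {f : ι → Plane → V}
    (hf : ∀ i ∈ s, MemHolderLoc ρ (f i) S) : MemHolderLoc ρ (fun y => ∑ i ∈ s, f i y) S := by
  classical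
  induction s using Finset.induction_on with
  | empty => simpa using hS.memHolderLoc_const (0 : V)
  | insert i s hi ih =>
    simp only [Finset.sum_insert hi]
    exact (hf i (Finset.mem_insert_self i s)).add hS
      (ih fun j hj => hf j (Finset.mem_insert_of_mem hj))

theorem MemHolderLoc.continuousOn {f : Plane → V} (hf : MemHolderLoc ρ f S) : ContinuousOn f S :=
  hf.1.continuousOn

theorem MemHolderLoc.contDiffOn_one (hρ : 0 ≤ ρ) {f : Plane → V} (hf : MemHolderLoc (ρ + 1) f S) :
    ContDiffOn ℝ 1 f S := by
  refine hf.1.of_le ?_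
  rw [Nat.floor_add_one hρ]
  exact_mod_cast Nat.le_add_left 1 _

/-- For ρ ≥ 0, passing from ρ to ρ + 1 raises the integer part by one and leaves the Hölder exponent
unchanged, so the recursion `holderClass_succ` applies. -/
theorem memHolderLoc_succ_of_hasFDerivWithinAt (hS : IsHalfOpen S) (hρ : 0 ≤ ρ) {f : Plane → V}
    {G : Plane → Plane →L[ℝ] V} (h : ∀ y ∈ S, HasFDerivWithinAt f (G y) S y)
    (hG : MemHolderLoc ρ G S) : MemHolderLoc (ρ + 1) f S := by
  have hu := hS.uniqueDiffOn
  have e : ρ + 1 - ((⌊ρ⌋₊ + 1 : ℕ) : ℝ) = ρ - ⌊ρ⌋₊ := by push_cast; ring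
  rw [memHolderLoc_iff, Nat.floor_add_one hρ, e, holderClass_succ hu]
  exact ⟨fun y hy => (h y hy).differentiableWithinAt,
    HolderClass.congr hG fun y hy => (h y hy).fderivWithin (hu y hy)⟩

/-- Regularity gain: a function whose weak first derivatives are of class `C^ρ` up to the boundary is
of class `C^{ρ+1}` up to the boundary. -/
theorem IsHalfOpen.memHolderLoc_succ_of_hasWeakDeriv [CompleteSpace V] (hS : IsHalfOpen S)
    (hρ : 0 ≤ ρ) {f : Plane → V} {f' : Fin 2 → Plane → V} (hf : ContinuousOn f S)
    (hf' : ∀ i, MemHolderLoc ρ (f' i) S)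
    (h : ∀ i, HasWeakDeriv (interior S) (stdVec i) f (f' i)) : MemHolderLoc (ρ + 1) f S := by
  refine memHolderLoc_succ_of_hasFDerivWithinAt hS hρ (fun y hy =>
    hS.hasFDerivWithinAt_of_hasWeakDeriv hf (fun i => (hf' i).continuousOn) h hy) ?_
  exact MemHolderLoc.sum hS _ fun i _ => (hf' i).clm_comp hS
    (ContinuousLinearMap.smulRightL ℝ Plane V (EuclideanSpace.proj i))

end HolderClasses

end DiracSurface

end

/-! ### The chain rule for weak derivatives under plane diffeomorphisms. -/

noncomputable section

namespace DiracSurface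

section ChangeOfVariables

open Set Filter Topology

variable {V : Type*} [NormedAddCommGroup V] [NormedSpace ℝ V]

theorem det_eq_of_plane (L : Plane →L[ℝ] Plane) :
    L.det = (L (stdVec 0)) 0 * (L (stdVec 1)) 1 - (L (stdVec 1)) 0 * (L (stdVec 0)) 1 := by
  have : L.det = LinearMap.det (L : Plane →ₗ[ℝ] Plane) := rfl
  rw [this, ← LinearMap.det_toMatrix (EuclideanSpace.basisFun (Fin 2) ℝ).toBasis,
    Matrix.det_fin_two]
  simp [LinearMap.toMatrix_apply, stdVec]

theorem plane_ext {a b : Plane} (h0 : a 0 = b 0) (h1 : a 1 = b 1) : a = b := by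
  ext i; fin_cases i
  · exact h0
  · exact h1

/-- A pair of mutually inverse `C²` maps between open subsets of the plane. -/
structure PlaneDiffeo (U U' : Set Plane) where
  /-- the map -/
  map : Plane → Plane
  /-- the inverse map -/
  inv : Plane → Plane
  isOpen_source : IsOpen U
  isOpen_target : IsOpen U'
  map_contDiffOn : ContDiffOn ℝ 2 map U
  inv_contDiffOn : ContDiffOn ℝ 2 inv U'
  mapsTo : MapsTo map U U'
  inv_mapsTo : MapsTo inv U' U
  left_inv : ∀ y ∈ U, inv (map y) = y
  right_inv : ∀ z ∈ U', map (inv z) = z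

namespace PlaneDiffeo

variable {U U' : Set Plane} (Φ : PlaneDiffeo U U')

/-- The inverse diffeomorphism. -/
def symm : PlaneDiffeo U' U where
  map := Φ.inv
  inv := Φ.map
  isOpen_source := Φ.isOpen_target
  isOpen_target := Φ.isOpen_source
  map_contDiffOn := Φ.inv_contDiffOn
  inv_contDiffOn := Φ.map_contDiffOn
  mapsTo := Φ.inv_mapsTo
  inv_mapsTo := Φ.mapsTo
  left_inv := Φ.right_inv
  right_inv := Φ.left_inv

theorem hasFDerivAt {y : Plane} (hy : y ∈ U) : HasFDerivAt Φ.map (fderiv ℝ Φ.map y) y :=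
  ((Φ.map_contDiffOn.contDiffAt (Φ.isOpen_source.mem_nhds hy)).differentiableAt
    two_ne_zero).hasFDerivAt

theorem fderiv_inv_fderiv {y : Plane} (hy : y ∈ U) (a : Plane) :
    fderiv ℝ Φ.inv (Φ.map y) (fderiv ℝ Φ.map y a) = a := by
  have h1 := (Φ.symm.hasFDerivAt (Φ.mapsTo hy)).comp y (Φ.hasFDerivAt hy)
  have h2 : HasFDerivAt (Φ.symm.map ∘ Φ.map) (ContinuousLinearMap.id ℝ Plane) y :=
    (hasFDerivAt_id y).congr_of_eventuallyEq (by
      filter_upwards [Φ.isOpen_source.mem_nhds hy] with z hz using Φ.left_inv z hz)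
  exact congrArg (fun L : Plane →L[ℝ] Plane => L a) (h1.unique h2)

theorem fderiv_fderiv_inv {z : Plane} (hz : z ∈ U') (a : Plane) :
    fderiv ℝ Φ.map (Φ.inv z) (fderiv ℝ Φ.inv z a) = a :=
  Φ.symm.fderiv_inv_fderiv hz a

theorem det_fderiv_ne_zero {y : Plane} (hy : y ∈ U) : (fderiv ℝ Φ.map y).det ≠ 0 := by
  have h : (fderiv ℝ Φ.inv (Φ.map y)).comp (fderiv ℝ Φ.map y) = ContinuousLinearMap.id ℝ Plane :=
    ContinuousLinearMap.ext (Φ.fderiv_inv_fderiv hy)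
  intro h0
  have h2 : LinearMap.det ((fderiv ℝ Φ.inv (Φ.map y) : Plane →ₗ[ℝ] Plane) ∘ₗ
      (fderiv ℝ Φ.map y : Plane →ₗ[ℝ] Plane)) = 1 := by
    have := congrArg (fun L : Plane →L[ℝ] Plane => LinearMap.det (L : Plane →ₗ[ℝ] Plane)) h
    simpa using this
  rw [LinearMap.det_comp] at h2
  have h3 : LinearMap.det (fderiv ℝ Φ.map y : Plane →ₗ[ℝ] Plane) = 0 := h0
  rw [h3, mul_zero] at h2
  exact zero_ne_one h2

theorem injOn : InjOn Φ.map U := fun y hy z hz h => by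
  rw [← Φ.left_inv y hy, h, Φ.left_inv z hz]

theorem image_eq : Φ.map '' U = U' :=
  Subset.antisymm (image_subset_iff.2 Φ.mapsTo) fun z hz =>
    ⟨Φ.inv z, Φ.inv_mapsTo hz, Φ.right_inv z hz⟩

theorem continuousOn_fderiv : ContinuousOn (fderiv ℝ Φ.map) U :=
  Φ.map_contDiffOn.continuousOn_fderiv_of_isOpen Φ.isOpen_source one_le_two

theorem continuousOn_det : ContinuousOn (fun y => (fderiv ℝ Φ.map y).det) U :=
  ContinuousLinearMap.continuous_det.comp_continuousOn Φ.continuousOn_fderiv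

/-- Change of variables on a compact set, after which the Jacobian factor, continuous and
nonvanishing there, is divided out. -/
theorem locallyIntegrableOn_comp {g : Plane → V} (hg : LocallyIntegrableOn g U') :
    LocallyIntegrableOn (fun y => g (Φ.map y)) U := by
  rw [locallyIntegrableOn_iff Φ.isOpen_source.isLocallyClosed]
  intro K hK hc
  have hc' : IsCompact (Φ.map '' K) := hc.image_of_continuousOn (Φ.map_contDiffOn.continuousOn.mono hK)
  have h1 := hg.integrableOn_compact_subset ((image_mono hK).trans Φ.image_eq.subset) hc'
  rw [integrableOn_image_iff_integrableOn_abs_det_fderiv_smul volume hc.measurableSet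
    (fun y hy => (Φ.hasFDerivAt (hK hy)).hasFDerivWithinAt) (Φ.injOn.mono hK)] at h1
  have h2 : ContinuousOn (fun y => |(fderiv ℝ Φ.map y).det|⁻¹) K :=
    ((Φ.continuousOn_det.mono hK).abs).inv₀ fun y hy =>
      abs_ne_zero.2 (Φ.det_fderiv_ne_zero (hK hy))
  refine (h1.continuousOn_smul h2 hc).congr_fun (fun y hy => ?_) hc.measurableSet
  dsimp only
  rw [smul_smul, inv_mul_cancel₀ (abs_ne_zero.2 (Φ.det_fderiv_ne_zero (hK hy))), one_smul]

/-- The sign of the Jacobian determinant. -/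
def sgn (y : Plane) : ℝ := if 0 < (fderiv ℝ Φ.map y).det then 1 else -1

theorem abs_det (y : Plane) :
    |(fderiv ℝ Φ.map y).det| = Φ.sgn y * (fderiv ℝ Φ.map y).det := by
  unfold sgn
  split_ifs with h
  · rw [abs_of_pos h, one_mul]
  · rw [abs_of_nonpos (not_lt.1 h), neg_one_mul]

/-- The open set U need not be connected, so the sign is only locally constant; this suffices to
differentiate it as a constant. -/
theorem sgn_eventuallyEq {y : Plane} (hy : y ∈ U) : ∀ᶠ z in 𝓝 y, Φ.sgn z = Φ.sgn y := by
  have hc := Φ.continuousOn_det.continuousAt (Φ.isOpen_source.mem_nhds hy)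
  unfold sgn
  rcases (Φ.det_fderiv_ne_zero hy).lt_or_gt with h | h
  · filter_upwards [hc.eventually (gt_mem_nhds h)] with z hz
    rw [if_neg (not_lt.2 h.le), if_neg (not_lt.2 (le_of_lt hz))]
  · filter_upwards [hc.eventually (lt_mem_nhds h)] with z hz
    rw [if_pos h, if_pos hz]

/-- The columns of the cofactor matrix, contracted with `a`. -/
def cof (a : Plane) (i : Fin 2) (y : Plane) : ℝ :=
  if i = 0 then a 0 * (fderiv ℝ Φ.map y (stdVec 1)) 1 - a 1 * (fderiv ℝ Φ.map y (stdVec 1)) 0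
  else a 1 * (fderiv ℝ Φ.map y (stdVec 0)) 0 - a 0 * (fderiv ℝ Φ.map y (stdVec 0)) 1

/-- Cramer's rule: the numbers `cof a i` are the entries of the adjugate of the Jacobian matrix
applied to a. -/
theorem fderiv_cof (a y : Plane) :
    Φ.cof a 0 y • fderiv ℝ Φ.map y (stdVec 0) + Φ.cof a 1 y • fderiv ℝ Φ.map y (stdVec 1) =
      (fderiv ℝ Φ.map y).det • a := by
  rw [det_eq_of_plane]
  apply plane_ext <;> simp [cof] <;> ring

/-- The derivative of an entry of the Jacobian matrix. -/
theorem hasFDerivAt_entry {y : Plane} (hy : y ∈ U) (i j : Fin 2) :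
    HasFDerivAt (fun z => (fderiv ℝ Φ.map z (stdVec j)) i)
      (((EuclideanSpace.proj i : Plane →L[ℝ] ℝ).comp
        (ContinuousLinearMap.apply ℝ Plane (stdVec j))).comp (fderiv ℝ (fderiv ℝ Φ.map) y)) y := by
  have h1 : ContDiffOn ℝ 1 (fderiv ℝ Φ.map) U :=
    Φ.map_contDiffOn.fderiv_of_isOpen Φ.isOpen_source (by norm_num)
  have h2 := ((h1.contDiffAt (Φ.isOpen_source.mem_nhds hy)).differentiableAt one_ne_zero).hasFDerivAt
  exact ((EuclideanSpace.proj i : Plane →L[ℝ] ℝ).comp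
        (ContinuousLinearMap.apply ℝ Plane (stdVec j))).hasFDerivAt.comp y h2

theorem contDiffOn_entry (i j : Fin 2) :
    ContDiffOn ℝ 1 (fun z => (fderiv ℝ Φ.map z (stdVec j)) i) U :=
  ((EuclideanSpace.proj i : Plane →L[ℝ] ℝ).comp
    (ContinuousLinearMap.apply ℝ Plane (stdVec j))).contDiff.comp_contDiffOn
      (Φ.map_contDiffOn.fderiv_of_isOpen Φ.isOpen_source (by norm_num))

theorem contDiffOn_cof (a : Plane) (i : Fin 2) : ContDiffOn ℝ 1 (Φ.cof a i) U := by
  unfold cof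
  split_ifs
  · exact (contDiffOn_const.mul (Φ.contDiffOn_entry _ _)).sub
      (contDiffOn_const.mul (Φ.contDiffOn_entry _ _))
  · exact (contDiffOn_const.mul (Φ.contDiffOn_entry _ _)).sub
      (contDiffOn_const.mul (Φ.contDiffOn_entry _ _))

/-- The Piola identity: the columns of the cofactor matrix are divergence free. -/
theorem div_cof {y : Plane} (hy : y ∈ U) (a : Plane) :
    fderiv ℝ (Φ.cof a 0) y (stdVec 0) + fderiv ℝ (Φ.cof a 1) y (stdVec 1) = 0 := by
  -- Class C² enters here: the second derivative is symmetric, and the mixed partial derivatives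
  -- cancel.
  have hs : IsSymmSndFDerivAt ℝ Φ.map y :=
    (Φ.map_contDiffOn.contDiffAt (Φ.isOpen_source.mem_nhds hy)).isSymmSndFDerivAt (by simp)
  have e0 : HasFDerivAt (Φ.cof a 0) _ y :=
    ((Φ.hasFDerivAt_entry hy 1 1).const_mul (a 0)).sub ((Φ.hasFDerivAt_entry hy 0 1).const_mul (a 1))
  have e1 : HasFDerivAt (Φ.cof a 1) _ y :=
    ((Φ.hasFDerivAt_entry hy 0 0).const_mul (a 1)).sub ((Φ.hasFDerivAt_entry hy 1 0).const_mul (a 0))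
  rw [e0.fderiv, e1.fderiv]
  simp [hs.eq (stdVec 0) (stdVec 1)]

theorem contDiffOn_sgn_mul_cof (a : Plane) (i : Fin 2) :
    ContDiffOn ℝ 1 (fun y => Φ.sgn y * Φ.cof a i y) U := by
  intro y hy
  have h1 := (Φ.contDiffOn_cof a i).contDiffAt (Φ.isOpen_source.mem_nhds hy)
  refine ((contDiffAt_const (c := Φ.sgn y)).mul h1 |>.congr_of_eventuallyEq ?_).contDiffWithinAt
  filter_upwards [Φ.sgn_eventuallyEq hy] with z hz
  rw [hz]

theorem fderiv_sgn_mul_cof {y : Plane} (hy : y ∈ U) (a : Plane) (i : Fin 2) :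
    fderiv ℝ (fun y => Φ.sgn y * Φ.cof a i y) y = Φ.sgn y • fderiv ℝ (Φ.cof a i) y := by
  have h1 := (Φ.contDiffOn_cof a i).contDiffAt (Φ.isOpen_source.mem_nhds hy)
  have : (fun y => Φ.sgn y * Φ.cof a i y) =ᶠ[𝓝 y] fun z => Φ.sgn y * Φ.cof a i z := by
    filter_upwards [Φ.sgn_eventuallyEq hy] with z hz
    rw [hz]
  rw [this.fderiv_eq, fderiv_const_mul (h1.differentiableAt one_ne_zero)]

theorem integral_comp (h : Plane → V) :
    ∫ y in U, h y = ∫ z in U', |(fderiv ℝ Φ.inv z).det| • h (Φ.inv z) := by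
  have e : ∫ y in U, h y = ∫ y in Φ.symm.map '' U', h y := by rw [Φ.symm.image_eq]
  rw [e]
  exact integral_image_eq_integral_abs_det_fderiv_smul volume Φ.isOpen_target.measurableSet
    (fun z hz => (Φ.symm.hasFDerivAt hz).hasFDerivWithinAt) Φ.symm.injOn h

/-- The push-forward of a test function, extended by zero. -/
def push (φ : Plane → ℝ) : Plane → ℝ := U'.indicator fun z => φ (Φ.inv z)

theorem support_push_subset (φ : Plane → ℝ) :
    Function.support (Φ.push φ) ⊆ Φ.map '' (tsupport φ ∩ U) := by
  intro z hz
  by_cases hz' : z ∈ U'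
  · refine ⟨Φ.inv z, ⟨?_, Φ.inv_mapsTo hz'⟩, Φ.right_inv z hz'⟩
    by_contra h
    exact hz (by rw [push, indicator_of_mem hz', image_eq_zero_of_notMem_tsupport h])
  · exact absurd (indicator_of_notMem hz' _) hz

theorem isCompact_image_tsupport {φ : Plane → ℝ} (hc : HasCompactSupport φ) (hs : tsupport φ ⊆ U) :
    IsCompact (Φ.map '' (tsupport φ ∩ U)) := by
  rw [inter_eq_left.2 hs]
  exact IsCompact.image_of_continuousOn hc (Φ.map_contDiffOn.continuousOn.mono hs)

theorem tsupport_push_subset_image {φ : Plane → ℝ} (hc : HasCompactSupport φ) (hs : tsupport φ ⊆ U) :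
    tsupport (Φ.push φ) ⊆ Φ.map '' (tsupport φ ∩ U) :=
  closure_minimal (Φ.support_push_subset φ) (Φ.isCompact_image_tsupport hc hs).isClosed

theorem tsupport_push_subset {φ : Plane → ℝ} (hc : HasCompactSupport φ) (hs : tsupport φ ⊆ U) :
    tsupport (Φ.push φ) ⊆ U' :=
  (Φ.tsupport_push_subset_image hc hs).trans
    ((image_mono inter_subset_right).trans Φ.image_eq.subset)

theorem hasCompactSupport_push {φ : Plane → ℝ} (hc : HasCompactSupport φ) (hs : tsupport φ ⊆ U) :
    HasCompactSupport (Φ.push φ) :=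
  (Φ.isCompact_image_tsupport hc hs).of_isClosed_subset (isClosed_tsupport _)
    (Φ.tsupport_push_subset_image hc hs)

theorem push_eventuallyEq (φ : Plane → ℝ) {z : Plane} (hz : z ∈ U') :
    Φ.push φ =ᶠ[𝓝 z] fun w => φ (Φ.inv w) := by
  filter_upwards [Φ.isOpen_target.mem_nhds hz] with w hw
  exact indicator_of_mem hw _

theorem contDiff_push {φ : Plane → ℝ} (hφ : ContDiff ℝ 1 φ) (hc : HasCompactSupport φ)
    (hs : tsupport φ ⊆ U) : ContDiff ℝ 1 (Φ.push φ) := by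
  rw [contDiff_iff_contDiffAt]
  intro z
  by_cases hz : z ∈ U'
  · refine ContDiffAt.congr_of_eventuallyEq ?_ (Φ.push_eventuallyEq φ hz)
    exact hφ.contDiffAt.comp z ((Φ.inv_contDiffOn.contDiffAt
      (Φ.isOpen_target.mem_nhds hz)).of_le one_le_two)
  · have : z ∉ tsupport (Φ.push φ) := fun h => hz (Φ.tsupport_push_subset hc hs h)
    refine (contDiffAt_const (c := (0 : ℝ))).congr_of_eventuallyEq ?_
    filter_upwards [(isClosed_tsupport _).isOpen_compl.mem_nhds this] with w hw
    exact image_eq_zero_of_notMem_tsupport hw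

theorem fderiv_push {φ : Plane → ℝ} (hφ : ContDiff ℝ 1 φ) {z : Plane} (hz : z ∈ U') (a : Plane) :
    fderiv ℝ (Φ.push φ) z a = fderiv ℝ φ (Φ.inv z) (fderiv ℝ Φ.inv z a) := by
  rw [(Φ.push_eventuallyEq φ hz).fderiv_eq]
  have := (hφ.differentiable one_ne_zero (Φ.inv z)).hasFDerivAt.comp z (Φ.symm.hasFDerivAt hz)
  rw [show (fun w => φ (Φ.inv w)) = φ ∘ Φ.inv from rfl, this.fderiv]
  rfl

end PlaneDiffeo

/-- The chain rule for weak derivatives under a diffeomorphism. -/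
theorem HasWeakDeriv.comp_diffeo {U U' : Set Plane} (Φ : PlaneDiffeo U U') {f : Plane → V}
    {f' : Fin 2 → Plane → V} (hf : ∀ i, HasWeakDeriv U' (stdVec i) f (f' i)) (a : Plane) :
    HasWeakDeriv U a (fun y => f (Φ.map y))
      (fun y => ∑ i, (fderiv ℝ Φ.map y a) i • f' i (Φ.map y)) := by
  have hU := Φ.isOpen_source
  have hU' := Φ.isOpen_target
  have hc : ∀ i : Fin 2, ContinuousOn (fun y => (fderiv ℝ Φ.map y a) i) U := fun i =>
    (EuclideanSpace.proj (𝕜 := ℝ) i).continuous.comp_continuousOn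
      (Φ.continuousOn_fderiv.clm_apply continuousOn_const)
  refine ⟨Φ.locallyIntegrableOn_comp (hf 0).1, ?_, fun φ h1 h2 h3 => ?_⟩
  · simp only [Fin.sum_univ_two]
    exact (LocallyIntegrableOn.smul_continuousOn hU (Φ.locallyIntegrableOn_comp (hf 0).2.1)
      (hc 0)).add (LocallyIntegrableOn.smul_continuousOn hU
        (Φ.locallyIntegrableOn_comp (hf 1).2.1) (hc 1))
  · let Ψ := Φ.symm
    -- With Ψ the inverse map, θ is the vector field (φ ∘ Ψ) |det DΨ| (DΨ)⁻¹ a. By Cramer's rule and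
    -- the Piola identity its divergence is |det DΨ| (∂_a φ) ∘ Ψ, with no derivative of the
    -- Jacobian. This is the integrand that the change of variables produces, so each component of θ
    -- may be used as a test function for f.
    let θ : Fin 2 → Plane → ℝ := fun i z => Φ.push φ z * (Ψ.sgn z * Ψ.cof a i z)
    have hps := Φ.tsupport_push_subset h2 h3
    have hpd := Φ.contDiff_push h1 h2 h3
    have hθd : ∀ i, ContDiff ℝ 1 (θ i) := fun i =>
      contDiff_mul_of_tsupport_subset hU' hpd hps (Ψ.contDiffOn_sgn_mul_cof a i)
    have hθc : ∀ i, HasCompactSupport (θ i) := fun i => (Φ.hasCompactSupport_push h2 h3).mul_right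
    have hθs : ∀ i, tsupport (θ i) ⊆ U' := fun i => (tsupport_mul_subset_left).trans hps
    have key : ∀ i, ∫ z in U', fderiv ℝ (θ i) z (stdVec i) • f z = -∫ z in U', θ i z • f' i z :=
      fun i => (hf i).2.2 (θ i) (hθd i) (hθc i) (hθs i)
    have hθ' : ∀ z ∈ U', ∀ i, fderiv ℝ (θ i) z (stdVec i) = Φ.push φ z *
        (Ψ.sgn z * fderiv ℝ (Ψ.cof a i) z (stdVec i)) +
        (Ψ.sgn z * Ψ.cof a i z) * fderiv ℝ (Φ.push φ) z (stdVec i) := by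
      intro z hz i
      rw [fderiv_fun_mul (hpd.differentiable one_ne_zero z)
        (((Ψ.contDiffOn_sgn_mul_cof a i).contDiffAt (hU'.mem_nhds hz)).differentiableAt
          one_ne_zero), Ψ.fderiv_sgn_mul_cof hz]
      simp
    have hsum : ∀ z ∈ U', fderiv ℝ (θ 0) z (stdVec 0) + fderiv ℝ (θ 1) z (stdVec 1) =
        |(fderiv ℝ Φ.inv z).det| * fderiv ℝ φ (Φ.inv z) a := by
      intro z hz
      have d0 := Ψ.div_cof hz a
      have d1 := congrArg (fderiv ℝ φ (Φ.inv z)) (Ψ.fderiv_cof a z)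
      have d2 : |(fderiv ℝ Φ.inv z).det| = Ψ.sgn z * (fderiv ℝ Φ.inv z).det := Ψ.abs_det z
      simp only [map_add, map_smul, smul_eq_mul] at d1
      rw [hθ' z hz, hθ' z hz, Φ.fderiv_push h1 hz, Φ.fderiv_push h1 hz, d2]
      have d3 : (fderiv ℝ Φ.inv z).det = (fderiv ℝ Ψ.map z).det := rfl
      have d4 : ∀ b, fderiv ℝ Φ.inv z b = fderiv ℝ Ψ.map z b := fun _ => rfl
      rw [d3, d4, d4]
      linear_combination (Φ.push φ z * Ψ.sgn z) * d0 + Ψ.sgn z * d1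
    have hint : ∀ i, IntegrableOn (fun z => fderiv ℝ (θ i) z (stdVec i) • f z) U' := fun i =>
      (integrable_fderiv_smul (hf 0).1 (hθd i) (hθc i) (hθs i) _).integrableOn
    have hint' : ∀ i, IntegrableOn (fun z => θ i z • f' i z) U' := fun i =>
      (integrable_smul_of_tsupport_subset (hf i).2.1 (hθd i).continuous (hθc i)
        (hθs i)).integrableOn
    calc ∫ y in U, fderiv ℝ φ y a • f (Φ.map y)
        = ∫ z in U', |(fderiv ℝ Φ.inv z).det| • (fderiv ℝ φ (Φ.inv z) a • f (Φ.map (Φ.inv z))) :=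
          Φ.integral_comp _
      _ = ∫ z in U', (fderiv ℝ (θ 0) z (stdVec 0) • f z + fderiv ℝ (θ 1) z (stdVec 1) • f z) := by
          refine setIntegral_congr_fun hU'.measurableSet fun z hz => ?_
          rw [← add_smul, hsum z hz, Φ.right_inv z hz, mul_smul]
      _ = -∫ z in U', (θ 0 z • f' 0 z + θ 1 z • f' 1 z) := by
          rw [integral_add (hint 0) (hint 1), integral_add (hint' 0) (hint' 1), key, key, neg_add]
      _ = -∫ z in U', |(fderiv ℝ Φ.inv z).det| • (φ (Φ.inv z) • ∑ i,
            (fderiv ℝ Φ.map (Φ.inv z) a) i • f' i (Φ.map (Φ.inv z))) := by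
          congr 1
          refine setIntegral_congr_fun hU'.measurableSet fun z hz => ?_
          have d1 := congrArg (fderiv ℝ Φ.map (Φ.inv z)) (Ψ.fderiv_cof a z)
          have d2 : |(fderiv ℝ Φ.inv z).det| = Ψ.sgn z * (fderiv ℝ Φ.inv z).det := Ψ.abs_det z
          simp only [map_add, map_smul] at d1
          have d3 : ∀ b, fderiv ℝ Φ.map (Φ.inv z) (fderiv ℝ Ψ.map z b) = b :=
            Φ.fderiv_fderiv_inv hz
          rw [d3, d3, show fderiv ℝ Ψ.map z = fderiv ℝ Φ.inv z from rfl] at d1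
          -- Applying DΦ, the inverse of DΨ, to Cramer's identity expresses the cofactors by the
          -- derivative of Φ, as required in the chain rule.
          have c : ∀ i, (fderiv ℝ Φ.inv z).det * (fderiv ℝ Φ.map (Φ.inv z) a) i = Ψ.cof a i z := by
            intro i
            have := congrArg (fun v : Plane => v i) d1
            fin_cases i
            · simpa [stdVec] using this.symm
            · simpa [stdVec] using this.symm
          have hp : Φ.push φ z = φ (Φ.inv z) := indicator_of_mem hz _
          simp only [θ, Fin.sum_univ_two, Φ.right_inv z hz, hp, d2, ← c, smul_add, smul_smul]
          congr 2 <;> ring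
      _ = -∫ y in U, φ y • ∑ i, (fderiv ℝ Φ.map y a) i • f' i (Φ.map y) := by
          rw [Φ.integral_comp fun y => φ y • ∑ i, (fderiv ℝ Φ.map y a) i • f' i (Φ.map y)]

end ChangeOfVariables

end DiracSurface

end

/-! ### Local L² and H¹ functions on relatively open sets of the half-plane. -/

noncomputable section

namespace DiracSurface

section SobolevOne

open Set Filter Topology

set_option linter.unusedSectionVars false

variable {V W : Type*} [NormedAddCommGroup V] [NormedSpace ℝ V] [NormedAddCommGroup W]
  [NormedSpace ℝ W] {S : Set Plane}

/-- The integer part of 1 is 1 and the fractional part is 0, so the Gagliardo condition is void and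
only one weak derivative remains. -/
theorem memSobolevLoc_one_iff {f : Plane → V} : MemSobolevLoc 1 2 f S ↔ MemLpLoc 2 f S ∧
    ∀ i : Fin 2, ∃ f' : Plane → V, HasWeakDeriv (interior S) (stdVec i) f f' ∧ MemLpLoc 2 f' S := by
  unfold MemSobolevLoc
  rw [Nat.floor_one]
  simp [MemSobolevAux]

theorem MemLpLoc.congr_ae {f g : Plane → V} (hf : MemLpLoc 2 f S)
    (h : ∀ᵐ y, y ∈ S → f y = g y) : MemLpLoc 2 g S := fun K hK hc =>
  (memLp_congr_ae ((ae_restrict_iff' hc.measurableSet).2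
    (h.mono fun _ hy hk => hy (hK hk)))).1 (hf K hK hc)

theorem MemLpLoc.add {f g : Plane → V} (hf : MemLpLoc 2 f S) (hg : MemLpLoc 2 g S) :
    MemLpLoc 2 (fun y => f y + g y) S := fun K hK hc => (hf K hK hc).add (hg K hK hc)

theorem MemLpLoc.const_smul {𝕜 : Type*} [NormedField 𝕜] [NormedSpace 𝕜 V] {f : Plane → V}
    (hf : MemLpLoc 2 f S) (c : 𝕜) : MemLpLoc 2 (fun y => c • f y) S := fun K hK hc =>
  (hf K hK hc).const_smul c

theorem MemLpLoc.sum {ι : Type*} (s : Finset ι) {f : ι → Plane → V}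
    (hf : ∀ i ∈ s, MemLpLoc 2 (f i) S) : MemLpLoc 2 (fun y => ∑ i ∈ s, f i y) S := fun K hK hc =>
  memLp_finsetSum s fun i hi => hf i hi K hK hc

theorem MemLpLoc.clm_apply {f : Plane → V} (hf : MemLpLoc 2 f S)
    {T : Plane → V →L[ℝ] W} (hT : ContinuousOn T S) : MemLpLoc 2 (fun y => T y (f y)) S := by
  intro K hK hc
  obtain ⟨C, hC⟩ := hc.exists_bound_of_continuousOn (hT.mono hK)
  have h1 := hf K hK hc
  have hTm : AEStronglyMeasurable T (volume.restrict K) :=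
    (hT.mono hK).aestronglyMeasurable_of_isCompact hc hc.measurableSet
  refine h1.of_le_mul (c := C) ?_ ?_
  · exact isBoundedBilinearMap_apply.continuous.comp_aestronglyMeasurable (hTm.prodMk h1.1)
  · refine (ae_restrict_iff' hc.measurableSet).2 (Eventually.of_forall fun y hy => ?_)
    exact (T y).le_of_opNorm_le (hC y hy) _

theorem MemLpLoc.locallyIntegrableOn {f : Plane → V} (hf : MemLpLoc 2 f S) {Ω : Set Plane}
    (hΩ : IsOpen Ω) (hS : Ω ⊆ S) : LocallyIntegrableOn f Ω := by
  rw [locallyIntegrableOn_iff hΩ.isLocallyClosed]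
  intro K hK hc
  have : IsFiniteMeasure (volume.restrict K) := ⟨by
    rw [Measure.restrict_apply_univ]; exact hc.measure_lt_top⟩
  exact (hf K (hK.trans hS) hc).integrable (by simp)

/-- The set exceeds its interior only on the line y 0 = 0, which is null. Thus identities of weak
derivatives, which live in the interior, hold almost everywhere up to the boundary. -/
theorem IsHalfOpen.ae_interior (hS : IsHalfOpen S) {P : Plane → Prop}
    (h : ∀ᵐ y, y ∈ interior S → P y) : ∀ᵐ y, y ∈ S → P y := by
  obtain ⟨O, hO, rfl⟩ := hS
  have hb : volume {y : Plane | y 0 = 0} = 0 := by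
    let L : Plane →ₗ[ℝ] ℝ := (EuclideanSpace.proj (𝕜 := ℝ) (0 : Fin 2) : Plane →L[ℝ] ℝ)
    have : {y : Plane | y 0 = 0} = (LinearMap.ker L : Set Plane) := by
      ext y; simp [L]
    rw [this]
    refine Measure.addHaar_submodule _ _ fun h => ?_
    have : stdVec 0 ∈ LinearMap.ker L := h ▸ Submodule.mem_top
    simp [L, stdVec] at this
  filter_upwards [h, compl_mem_ae_iff.2 hb] with y h1 h2 h3
  refine h1 (IsHalfOpen.inter_openHalfPlane_subset hO rfl ⟨h3.1, ?_⟩)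
  exact lt_of_le_of_ne h3.2 (Ne.symm h2)

theorem MemLpLoc.of_interior {f g : Plane → V} (hS : IsHalfOpen S) (hf : MemLpLoc 2 f S)
    (h : ∀ᵐ y, y ∈ interior S → f y = g y) : MemLpLoc 2 g S :=
  hf.congr_ae (hS.ae_interior h)

theorem MemSobolevLoc.add {f g : Plane → V} (hf : MemSobolevLoc 1 2 f S)
    (hg : MemSobolevLoc 1 2 g S) : MemSobolevLoc 1 2 (fun y => f y + g y) S := by
  rw [memSobolevLoc_one_iff] at hf hg ⊢
  refine ⟨hf.1.add hg.1, fun i => ?_⟩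
  obtain ⟨f', h1, h2⟩ := hf.2 i
  obtain ⟨g', h3, h4⟩ := hg.2 i
  exact ⟨_, h1.add h3, h2.add h4⟩

theorem MemSobolevLoc.congr {f g : Plane → V} (hf : MemSobolevLoc 1 2 f S)
    (h : ∀ y ∈ S, f y = g y) : MemSobolevLoc 1 2 g S := by
  rw [memSobolevLoc_one_iff] at hf ⊢
  refine ⟨hf.1.congr_ae (Eventually.of_forall h), fun i => ?_⟩
  obtain ⟨f', h1, h2⟩ := hf.2 i
  exact ⟨f', h1.congr_ae isOpen_interior.measurableSet
    (Eventually.of_forall fun y hy => h y (interior_subset hy)) (Eventually.of_forall fun _ _ => rfl),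
    h2⟩

theorem MemSobolevLoc.clm_apply [FiniteDimensional ℝ V] [FiniteDimensional ℝ W]
    (hS : IsHalfOpen S) {f : Plane → V} (hf : MemSobolevLoc 1 2 f S) {T : Plane → V →L[ℝ] W}
    (hT : ContDiffOn ℝ 1 T S) : MemSobolevLoc 1 2 (fun y => T y (f y)) S := by
  rw [memSobolevLoc_one_iff] at hf ⊢
  refine ⟨hf.1.clm_apply hT.continuousOn, fun i => ?_⟩
  obtain ⟨f', h1, h2⟩ := hf.2 i
  -- The L² bounds are needed on compact sets that reach the boundary, where the one-sided
  -- derivative is continuous; in the interior it is the usual one.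
  have hT' : ContinuousOn (fun y => fderivWithin ℝ T S y (stdVec i)) S :=
    (hT.continuousOn_fderivWithin hS.uniqueDiffOn le_rfl).clm_apply continuousOn_const
  refine ⟨fun y => fderivWithin ℝ T S y (stdVec i) (f y) + T y (f' y), ?_,
    (hf.1.clm_apply hT').add (h2.clm_apply hT.continuousOn)⟩
  refine (h1.clm_apply isOpen_interior (hT.mono interior_subset)).congr_ae
    isOpen_interior.measurableSet (Eventually.of_forall fun _ _ => rfl)
    (Eventually.of_forall fun y hy => ?_)
  rw [fderivWithin_of_mem_nhds (mem_interior_iff_mem_nhds.1 hy)]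

end SobolevOne

end DiracSurface

end

/-! ### Fibrewise algebra: the chirality operator, the splitting and the Clifford contraction. -/

noncomputable section

namespace DiracSurface

section FibreAlgebra

set_option linter.unusedSectionVars false

variable {M : Type*} [TopologicalSpace M] [ChartedSpace (EuclideanHalfSpace 2) M]
  [IsManifold (𝓡∂ 2) ∞ M]
  {F : Type*} [NormedAddCommGroup F] [NormedSpace ℂ F]
  {E : M → Type*} [∀ x, AddCommGroup (E x)] [∀ x, Module ℂ (E x)]
  [∀ x, TopologicalSpace (E x)] [∀ x, IsTopologicalAddGroup (E x)] [∀ x, ContinuousSMul ℂ (E x)]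
  [TopologicalSpace (TotalSpace F E)] [FiberBundle F E] [VectorBundle ℂ F E]
  {g : SurfaceMetric M} {c : ComplexStructure M} (D : DiracBundle F E g)

/-- J is an isometry with J² = −1, so g(v, Jv) = g(Jv, −v) equals its own negative. -/
theorem metric_J_self (hg : IsConformal g c) (x : M) (v : TangentSpace (𝓡∂ 2) x) :
    g.inner x v (c.J x v) = 0 := by
  have h := hg x v (c.J x v)
  rw [c.sq, map_neg, g.symm] at h
  linarith

theorem metric_J_self' (hg : IsConformal g c) (x : M) (v : TangentSpace (𝓡∂ 2) x) :
    g.inner x (c.J x v) v = 0 := by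
  rw [g.symm, metric_J_self hg]

theorem finrank_tangentSpace (x : M) : Module.finrank ℝ (TangentSpace (𝓡∂ 2) x) = 2 :=
  (finrank_euclideanSpace_fin : Module.finrank ℝ Plane = 2)

/-- The expansion of a tangent vector in the orthogonal basis `v, Jv`. -/
theorem tangent_expansion (hg : IsConformal g c) (x : M) {v : TangentSpace (𝓡∂ 2) x} (hv : v ≠ 0)
    (w : TangentSpace (𝓡∂ 2) x) :
    w = (g.inner x v w / g.inner x v v) • v + (g.inner x (c.J x v) w / g.inner x v v) • c.J x v := by
  have hp := g.pos x v hv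
  have hli : LinearIndependent ℝ ![v, c.J x v] := by
    rw [LinearIndependent.pair_iff]
    intro a b hab
    have h1 := congrArg (g.inner x v) hab
    have h2 := congrArg (g.inner x (c.J x v)) hab
    simp only [map_add, map_smul, map_zero, metric_J_self hg, metric_J_self' hg, hg x v v,
      smul_eq_mul, mul_zero, add_zero, zero_add] at h1 h2
    exact ⟨(mul_eq_zero.1 h1).resolve_right hp.ne', (mul_eq_zero.1 h2).resolve_right hp.ne'⟩
  have hs := hli.span_eq_top_of_card_eq_finrank (by rw [finrank_tangentSpace]; rfl)
  have hw : w ∈ Submodule.span ℝ (Set.range ![v, c.J x v]) := hs ▸ Submodule.mem_top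
  rw [Matrix.range_cons, Matrix.range_cons, Matrix.range_empty, Set.union_empty,
    Set.singleton_union, Submodule.mem_span_pair] at hw
  obtain ⟨a, b, rfl⟩ := hw
  simp only [map_add, map_smul, metric_J_self hg, metric_J_self' hg, hg x v v,
      smul_eq_mul, mul_zero, add_zero, zero_add]
  rw [mul_div_cancel_right₀ _ hp.ne', mul_div_cancel_right₀ _ hp.ne']

namespace DiracBundle

/-- Clifford multiplication by a tangent vector. -/
def cl (x : M) (v : TangentSpace (𝓡∂ 2) x) : E x →L[ℂ] E x := D.γ x (g.inner x v)

theorem cl_add (x : M) (v w : TangentSpace (𝓡∂ 2) x) : D.cl x (v + w) = D.cl x v + D.cl x w := by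
  simp only [cl, map_add]

theorem cl_smul (x : M) (a : ℝ) (v : TangentSpace (𝓡∂ 2) x) : D.cl x (a • v) = a • D.cl x v := by
  simp only [cl, map_smul]

theorem cl_smul_apply (x : M) (a : ℝ) (v : TangentSpace (𝓡∂ 2) x) (s : E x) :
    D.cl x (a • v) s = (a : ℂ) • D.cl x v s := by
  rw [cl_smul]
  show a • D.cl x v s = _
  rw [← Complex.coe_smul]

theorem cl_neg (x : M) (v : TangentSpace (𝓡∂ 2) x) : D.cl x (-v) = -D.cl x v := by
  simp only [cl, map_neg]

theorem cl_zero (x : M) : D.cl x 0 = 0 := by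
  simp only [cl, map_zero]

theorem cl_cl_add (x : M) (v w : TangentSpace (𝓡∂ 2) x) (s : E x) :
    D.cl x v (D.cl x w s) + D.cl x w (D.cl x v s) = ((-2 * g.inner x v w : ℝ) : ℂ) • s :=
  D.clifford x v w s

theorem cl_cl_self (x : M) (v : TangentSpace (𝓡∂ 2) x) (s : E x) :
    D.cl x v (D.cl x v s) = -((g.inner x v v : ℂ) • s) := by
  have h := D.cl_cl_add x v v s
  rw [← two_smul ℂ] at h
  have h2 : (2 : ℂ) • D.cl x v (D.cl x v s) = (2 : ℂ) • -((g.inner x v v : ℂ) • s) := by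
    rw [h, smul_neg, smul_smul, ← neg_smul]; push_cast; ring_nf
  exact smul_right_injective _ (two_ne_zero) h2

theorem cl_J_cl (hg : IsConformal g c) (x : M) (v : TangentSpace (𝓡∂ 2) x) (s : E x) :
    D.cl x (c.J x v) (D.cl x v s) = -D.cl x v (D.cl x (c.J x v) s) := by
  have h := D.cl_cl_add x v (c.J x v) s
  rw [metric_J_self hg, mul_zero, Complex.ofReal_zero, zero_smul] at h
  exact eq_neg_of_add_eq_zero_right h

theorem tangentBasis_zero_ne_zero (x : M) : tangentBasis x 0 ≠ 0 := by
  intro h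
  have h1 : stdVec 0 = 0 := h
  have := congrArg (fun v : Plane => v 0) h1
  simp [stdVec] at this

variable (c) in
/-- The chirality operator `i γ(v) γ(Jv) / |v|²`, for any `v ≠ 0`. -/
def chir (x : M) : E x →L[ℂ] E x :=
  (Complex.I / (g.inner x (tangentBasis x 0) (tangentBasis x 0) : ℂ)) •
    (D.cl x (tangentBasis x 0)).comp (D.cl x (c.J x (tangentBasis x 0)))

theorem metric_ne_zero (x : M) {v : TangentSpace (𝓡∂ 2) x} (hv : v ≠ 0) :
    (g.inner x v v : ℂ) ≠ 0 := by
  exact_mod_cast (g.pos x v hv).ne'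

theorem cl_injective (x : M) {v : TangentSpace (𝓡∂ 2) x} (hv : v ≠ 0) {s t : E x}
    (h : D.cl x v s = D.cl x v t) : s = t := by
  have h2 := congrArg (D.cl x v) h
  rw [cl_cl_self, cl_cl_self, neg_inj] at h2
  exact smul_right_injective _ (metric_ne_zero x hv) h2

/-- `γ(Jv) = i γ(v) Γ` for the chirality operator `Γ`. -/
theorem cl_J (hg : IsConformal g c) (x : M) (v : TangentSpace (𝓡∂ 2) x) (s : E x) :
    D.cl x (c.J x v) s = Complex.I • D.cl x v (D.chir c x s) := by
  set b := tangentBasis x 0 with hb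
  have hb0 : b ≠ 0 := tangentBasis_zero_ne_zero x
  have hp := metric_ne_zero (g := g) x hb0
  -- For v = b the identity unwinds the definition of Γ, and `key2` is the case v = Jb. Both sides
  -- are real linear in v, and b, Jb span.
  have key : D.cl x (c.J x b) s = Complex.I • D.cl x b (D.chir c x s) := by
    simp only [chir, ← hb, smul_apply, ContinuousLinearMap.comp_apply, map_smul, cl_cl_self,
      smul_neg, smul_smul]
    rw [show (Complex.I * (Complex.I / (g.inner x b b : ℂ) * (g.inner x b b : ℂ))) = -1 by
      rw [div_mul_cancel₀ _ hp, Complex.I_mul_I], neg_smul, one_smul, neg_neg]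
  have key2 : D.cl x b s = -(Complex.I • D.cl x (c.J x b) (D.chir c x s)) := by
    simp only [chir, ← hb, smul_apply, ContinuousLinearMap.comp_apply, map_smul,
      D.cl_J_cl hg, cl_cl_self, hg x b b,
      smul_smul, neg_neg, map_neg]
    rw [show (Complex.I * (Complex.I / (g.inner x b b : ℂ) * (g.inner x b b : ℂ))) = -1 by
      rw [div_mul_cancel₀ _ hp, Complex.I_mul_I], neg_smul, one_smul, neg_neg]
  conv_lhs => rw [tangent_expansion hg x hb0 v]
  conv_rhs => rw [tangent_expansion hg x hb0 v]
  simp only [map_add, map_smul, c.sq, cl_add, add_apply, cl_smul_apply, cl_neg, neg_apply,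
    key, key2, smul_add, smul_neg, neg_neg, smul_comm Complex.I]

/-- The definition of Γ uses `tangentBasis x 0`, which depends on the preferred chart at x and in
general does not vary continuously with x. Independence of v allows Γ to be computed with a
coordinate field of one fixed chart. -/
theorem chir_eq (hg : IsConformal g c) (x : M) {v : TangentSpace (𝓡∂ 2) x} (hv : v ≠ 0) (s : E x) :
    D.chir c x s = (Complex.I / (g.inner x v v : ℂ)) • D.cl x v (D.cl x (c.J x v) s) := by
  rw [D.cl_J hg, map_smul, cl_cl_self, smul_neg, smul_neg, smul_smul, smul_smul, ← neg_smul,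
    show -(Complex.I / (g.inner x v v : ℂ) * Complex.I * (g.inner x v v : ℂ)) = 1 by
      rw [mul_right_comm, div_mul_cancel₀ _ (metric_ne_zero x hv), Complex.I_mul_I, neg_neg],
    one_smul]

/-- Two applications of γ(Jv) = iγ(v)Γ give γ(J²v) = −γ(v)Γ², while J² = −1; then γ(v) is cancelled.
-/
theorem chir_chir (hg : IsConformal g c) (x : M) (s : E x) : D.chir c x (D.chir c x s) = s := by
  have hb0 := tangentBasis_zero_ne_zero x
  have h := D.cl_J hg x (c.J x (tangentBasis x 0)) s
  rw [c.sq, D.cl_J hg, smul_smul, Complex.I_mul_I, cl_neg, neg_smul, one_smul, neg_apply,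
    neg_inj] at h
  exact (D.cl_injective x hb0 h).symm

/-- This is γ(Jv)γ(v) = −γ(v)γ(Jv) rewritten with γ(Jv) = iγ(v)Γ. It implies that γ(v) interchanges
the two eigenspaces of Γ. -/
theorem chir_cl (hg : IsConformal g c) (x : M) (v : TangentSpace (𝓡∂ 2) x) (s : E x) :
    D.chir c x (D.cl x v s) = -D.cl x v (D.chir c x s) := by
  by_cases hv : v = 0
  · subst hv; simp [cl_zero]
  refine D.cl_injective x hv ?_
  have h1 := D.cl_J hg x v (D.cl x v s)
  rw [D.cl_J_cl hg, D.cl_J hg, map_smul, ← smul_neg] at h1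
  rw [map_neg]
  exact (smul_right_injective _ Complex.I_ne_zero h1).symm

theorem herm_cl (x : M) (v : TangentSpace (𝓡∂ 2) x) (s t : E x) :
    D.herm x (D.cl x v s) t = -D.herm x s (D.cl x v t) := D.γ_skew x _ s t

/-- The adjoint of iγ(v)γ(Jv) is −iγ(Jv)γ(v), as both factors are skew, and the factors anticommute.
-/
theorem herm_chir (hg : IsConformal g c) (x : M) (s t : E x) :
    D.herm x (D.chir c x s) t = D.herm x s (D.chir c x t) := by
  have hb0 := tangentBasis_zero_ne_zero x
  rw [D.chir_eq hg x hb0, D.chir_eq hg x hb0]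
  simp only [map_smulₛₗ, smul_apply, herm_cl, map_neg, neg_neg, D.cl_J_cl hg,
    smul_eq_mul, map_div₀, Complex.conj_I, Complex.conj_ofReal, RingHom.id_apply]
  ring

variable (c) in
/-- The projections to the eigenspaces of the chirality operator. -/
def projPlus (x : M) : E x →L[ℂ] E x := (1 / 2 : ℂ) • (ContinuousLinearMap.id ℂ (E x) + D.chir c x)

variable (c) in
/-- The projection to the negative eigenspace of the chirality operator. -/
def projMinus (x : M) : E x →L[ℂ] E x := (1 / 2 : ℂ) • (ContinuousLinearMap.id ℂ (E x) - D.chir c x)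

theorem projPlus_apply (x : M) (s : E x) :
    D.projPlus c x s = (1 / 2 : ℂ) • (s + D.chir c x s) := rfl

theorem projMinus_apply (x : M) (s : E x) :
    D.projMinus c x s = (1 / 2 : ℂ) • (s - D.chir c x s) := rfl

theorem projPlus_add_projMinus (x : M) (s : E x) :
    D.projPlus c x s + D.projMinus c x s = s := by
  rw [projPlus_apply, projMinus_apply]; module

theorem chir_projPlus (hg : IsConformal g c) (x : M) (s : E x) :
    D.chir c x (D.projPlus c x s) = D.projPlus c x s := by
  rw [projPlus_apply, map_smul, map_add, D.chir_chir hg, add_comm]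

theorem chir_projMinus (hg : IsConformal g c) (x : M) (s : E x) :
    D.chir c x (D.projMinus c x s) = -D.projMinus c x s := by
  rw [projMinus_apply, map_smul, map_sub, D.chir_chir hg]; module

theorem projPlus_of_chir {x : M} {s : E x} (h : D.chir c x s = s) : D.projPlus c x s = s := by
  rw [projPlus_apply, h]; module

theorem projMinus_of_chir {x : M} {s : E x} (h : D.chir c x s = s) : D.projMinus c x s = 0 := by
  rw [projMinus_apply, h, sub_self, smul_zero]

theorem projPlus_of_chir_neg {x : M} {s : E x} (h : D.chir c x s = -s) :
    D.projPlus c x s = 0 := by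
  rw [projPlus_apply, h]; module

theorem projMinus_of_chir_neg {x : M} {s : E x} (h : D.chir c x s = -s) :
    D.projMinus c x s = s := by
  rw [projMinus_apply, h]; module

theorem herm_projPlus (hg : IsConformal g c) (x : M) (s t : E x) :
    D.herm x (D.projPlus c x s) t = D.herm x s (D.projPlus c x t) := by
  simp only [projPlus_apply, map_smulₛₗ, map_add, smul_apply, add_apply, D.herm_chir hg,
    smul_eq_mul, map_div₀, map_one, map_ofNat]

/-- `γ(Jv) = iγ(v)` on the positive eigenspace. -/
theorem cl_J_of_chir (hg : IsConformal g c) {x : M} {s : E x} (h : D.chir c x s = s)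
    (v : TangentSpace (𝓡∂ 2) x) : D.cl x (c.J x v) s = Complex.I • D.cl x v s := by
  rw [D.cl_J hg, h]

/-- `γ(Jv) = -iγ(v)` on the negative eigenspace. -/
theorem cl_J_of_chir_neg (hg : IsConformal g c) {x : M} {s : E x} (h : D.chir c x s = -s)
    (v : TangentSpace (𝓡∂ 2) x) : D.cl x (c.J x v) s = -(Complex.I • D.cl x v s) := by
  rw [D.cl_J hg, h, map_neg, smul_neg]

variable (c) in
/-- The subbundle `E₀`, the positive eigenbundle of the chirality operator. -/
def posBundle (x : M) : Submodule ℂ (E x) :=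
  LinearMap.ker ((D.chir c x : E x →ₗ[ℂ] E x) - LinearMap.id)

theorem mem_posBundle {x : M} {s : E x} : s ∈ D.posBundle c x ↔ D.chir c x s = s := by
  simp [posBundle, sub_eq_zero]

/-- The form `v ↦ -γ(v) s / √2`. -/
def toForm (x : M) (s : E x) : TangentSpace (𝓡∂ 2) x →L[ℝ] E x :=
  letI : T2Space (TangentSpace (𝓡∂ 2) x) := inferInstanceAs (T2Space Plane)
  letI : FiniteDimensional ℝ (TangentSpace (𝓡∂ 2) x) :=
    inferInstanceAs (FiniteDimensional ℝ Plane)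
  LinearMap.toContinuousLinearMap
    { toFun := fun v => -((1 / Real.sqrt 2 : ℝ) : ℂ) • D.cl x v s
      map_add' := fun v w => by rw [cl_add, add_apply, smul_add]
      map_smul' := fun a v => by
        rw [cl_smul_apply, RingHom.id_apply, smul_comm, ← Complex.coe_smul] }

theorem toForm_apply (x : M) (s : E x) (v : TangentSpace (𝓡∂ 2) x) :
    D.toForm x s v = -((1 / Real.sqrt 2 : ℝ) : ℂ) • D.cl x v s := rfl

/-- γ(v) maps E₋ to E₊, and the rule γ(Jv) = −iγ(v) on E₋ is exactly the condition for type (0,1).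
-/
theorem toForm_mem (hg : IsConformal g c) {x : M} {s : E x} (h : D.chir c x s = -s) :
    D.toForm x s ∈ ZeroOneForms c (D.posBundle c) x := by
  intro v
  constructor
  · rw [toForm_apply]
    refine Submodule.smul_mem _ _ (D.mem_posBundle.2 ?_)
    rw [D.chir_cl hg, h, map_neg, neg_neg]
  · rw [toForm_apply, toForm_apply, D.cl_J_of_chir_neg hg h, smul_neg, smul_comm]

/-- The spinor `√2 γ(v) α(v) / |v|²`. -/
def ofForm (x : M) (v : TangentSpace (𝓡∂ 2) x) (α : TangentSpace (𝓡∂ 2) x →L[ℝ] E x) : E x :=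
  ((Real.sqrt 2 : ℂ) / (g.inner x v v : ℂ)) • D.cl x v (α v)

theorem sqrt_two_mul_inv : (Real.sqrt 2 : ℂ) * ((1 / Real.sqrt 2 : ℝ) : ℂ) = 1 := by
  rw [← Complex.ofReal_mul, mul_one_div_cancel (by positivity), Complex.ofReal_one]

theorem sqrt_two_mul_self : (Real.sqrt 2 : ℂ) * (Real.sqrt 2 : ℂ) = 2 := by
  rw [← Complex.ofReal_mul, Real.mul_self_sqrt (by norm_num)]; norm_num

theorem ofForm_toForm {x : M} {v : TangentSpace (𝓡∂ 2) x} (hv : v ≠ 0) (s : E x) :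
    D.ofForm x v (D.toForm x s) = s := by
  have h1 : (Real.sqrt 2 : ℂ) / (g.inner x v v : ℂ) * (((1 / Real.sqrt 2 : ℝ) : ℂ) *
      (g.inner x v v : ℂ)) = 1 := by
    rw [div_mul_eq_mul_div, ← mul_assoc, sqrt_two_mul_inv, one_mul,
      div_self (metric_ne_zero x hv)]
  rw [ofForm, toForm_apply, map_smul, cl_cl_self]
  match_scalars
  push_cast at h1
  linear_combination h1

theorem chir_ofForm (hg : IsConformal g c) {x : M} (v : TangentSpace (𝓡∂ 2) x)
    {α : TangentSpace (𝓡∂ 2) x →L[ℝ] E x} (hα : α ∈ ZeroOneForms c (D.posBundle c) x) :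
    D.chir c x (D.ofForm x v α) = -D.ofForm x v α := by
  rw [ofForm, map_smul, D.chir_cl hg, D.mem_posBundle.1 (hα v).1, smul_neg]

/-- Both forms are of type (0,1), hence determined by their value at one nonzero vector v: the value
at Jv follows and v, Jv span. -/
theorem toForm_ofForm (hg : IsConformal g c) {x : M} {v : TangentSpace (𝓡∂ 2) x} (hv : v ≠ 0)
    {α : TangentSpace (𝓡∂ 2) x →L[ℝ] E x} (hα : α ∈ ZeroOneForms c (D.posBundle c) x) :
    D.toForm x (D.ofForm x v α) = α := by
  have e1 : D.toForm x (D.ofForm x v α) v = α v := by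
    have h1 : (Real.sqrt 2 : ℂ) / (g.inner x v v : ℂ) * (((1 / Real.sqrt 2 : ℝ) : ℂ) *
        (g.inner x v v : ℂ)) = 1 := by
      rw [div_mul_eq_mul_div, ← mul_assoc, sqrt_two_mul_inv, one_mul,
        div_self (metric_ne_zero x hv)]
    rw [ofForm, toForm_apply, map_smul, cl_cl_self]
    match_scalars
    push_cast at h1
    linear_combination h1
  have e2 := (D.toForm_mem hg (D.chir_ofForm hg v hα) v).2
  ext w
  rw [tangent_expansion hg x hv w, map_add, map_add, map_smul, map_smul, map_smul, map_smul, e2,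
    (hα v).2, e1]

variable (c) in
/-- The isomorphism `E → E₀ ⊕ E₀ ⊗ (T^{0,1}M)*`. -/
def splitting (hg : IsConformal g c) (x : M) :
    E x ≃ₗ[ℂ] (D.posBundle c x × ZeroOneForms c (D.posBundle c) x) where
  toFun s := (⟨D.projPlus c x s, D.mem_posBundle.2 (D.chir_projPlus hg x s)⟩,
    ⟨D.toForm x (D.projMinus c x s), D.toForm_mem hg (D.chir_projMinus hg x s)⟩)
  invFun p := (p.1 : E x) + D.ofForm x (tangentBasis x 0) p.2
  map_add' s t := by
    refine Prod.ext (Subtype.ext (map_add _ _ _)) (Subtype.ext ?_)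
    ext v
    show D.toForm x (D.projMinus c x (s + t)) v =
      D.toForm x (D.projMinus c x s) v + D.toForm x (D.projMinus c x t) v
    simp only [toForm_apply, map_add, smul_add]
  map_smul' a s := by
    refine Prod.ext (Subtype.ext (map_smul _ _ _)) (Subtype.ext ?_)
    ext v
    show D.toForm x (D.projMinus c x (a • s)) v = a • D.toForm x (D.projMinus c x s) v
    simp only [toForm_apply, map_smul, smul_comm a]
  left_inv s := by
    show D.projPlus c x s + D.ofForm x _ (D.toForm x (D.projMinus c x s)) = s
    rw [D.ofForm_toForm (tangentBasis_zero_ne_zero x), projPlus_add_projMinus]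
  right_inv p := by
    obtain ⟨⟨s, hs⟩, ⟨α, hα⟩⟩ := p
    have h1 := D.mem_posBundle.1 hs
    have h2 := D.chir_ofForm hg (tangentBasis x 0) hα
    refine Prod.ext (Subtype.ext ?_) (Subtype.ext ?_)
    · show D.projPlus c x (s + D.ofForm x _ α) = s
      rw [map_add, D.projPlus_of_chir h1, D.projPlus_of_chir_neg h2, add_zero]
    · show D.toForm x (D.projMinus c x (s + D.ofForm x _ α)) = α
      rw [map_add, D.projMinus_of_chir h1, D.projMinus_of_chir_neg h2, zero_add,
        D.toForm_ofForm hg (tangentBasis_zero_ne_zero x) hα]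

theorem splitting_fst (hg : IsConformal g c) (x : M) (s : E x) :
    ((D.splitting c hg x s).1 : E x) = D.projPlus c x s := rfl

theorem splitting_snd (hg : IsConformal g c) (x : M) (s : E x) :
    ((D.splitting c hg x s).2 : TangentSpace (𝓡∂ 2) x →L[ℝ] E x) =
      D.toForm x (D.projMinus c x s) := rfl

/-! ### The contraction `T*M ⊗ E → E` -/

/-- The contraction is a trace, so any frame with its dual coframe computes it. It is used below
with the frame v, Jv and with coordinate frames. -/
theorem contract_eq_of_dual (w : FormField E) (x : M) (b : Fin 2 → TangentSpace (𝓡∂ 2) x)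
    (b' : Fin 2 → TangentSpace (𝓡∂ 2) x →L[ℝ] ℝ) (h : ∀ v, v = ∑ i, b' i v • b i) :
    D.contract w x = ∑ i, D.γ x (b' i) (w x (b i)) := by
  have hb' : ∀ i, b' i = ∑ j, b' i (tangentBasis x j) • cotangentBasis x j := by
    intro i
    ext v
    have hv : v = ∑ j, cotangentBasis x j v • tangentBasis x j := by
      have := plane_eq_sum v
      rw [Fin.sum_univ_two]
      exact this
    conv_lhs => rw [hv, map_sum]
    rw [sum_apply]
    refine Finset.sum_congr rfl fun j _ => ?_
    rw [map_smul, smul_apply, smul_eq_mul, smul_eq_mul, mul_comm]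
  unfold contract
  calc ∑ j, D.γ x (cotangentBasis x j) (w x (tangentBasis x j))
      = ∑ j, ∑ i, b' i (tangentBasis x j) • D.γ x (cotangentBasis x j) (w x (b i)) := by
        refine Finset.sum_congr rfl fun j _ => ?_
        conv_lhs => rw [h (tangentBasis x j), map_sum, map_sum]
        refine Finset.sum_congr rfl fun i _ => ?_
        rw [map_smul, ← Complex.coe_smul, map_smul, Complex.coe_smul]
    _ = ∑ i, D.γ x (b' i) (w x (b i)) := by
        rw [Finset.sum_comm]
        refine Finset.sum_congr rfl fun i _ => ?_
        conv_rhs => rw [hb' i, map_sum, sum_apply]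
        refine Finset.sum_congr rfl fun j _ => ?_
        rw [map_smul]; rfl

theorem contract_eq (hg : IsConformal g c) (w : FormField E) {x : M} {v : TangentSpace (𝓡∂ 2) x}
    (hv : v ≠ 0) : D.contract w x = (1 / (g.inner x v v : ℂ)) •
      (D.cl x v (w x v) + D.cl x (c.J x v) (w x (c.J x v))) := by
  rw [D.contract_eq_of_dual w x ![v, c.J x v] ![(1 / g.inner x v v) • g.inner x v,
    (1 / g.inner x v v) • g.inner x (c.J x v)]]
  · rw [Fin.sum_univ_two, smul_add]
    simp only [Matrix.cons_val_zero, Matrix.cons_val_one, map_smul, cl]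
    congr 1
    · show (1 / g.inner x v v) • D.γ x (g.inner x v) (w x v) = _
      rw [← Complex.coe_smul]; push_cast; rfl
    · show (1 / g.inner x v v) • D.γ x (g.inner x (c.J x v)) (w x (c.J x v)) = _
      rw [← Complex.coe_smul]; push_cast; rfl
  · intro u
    rw [Fin.sum_univ_two]
    conv_lhs => rw [tangent_expansion hg x hv u]
    simp [div_eq_inv_mul]

/-- The composition of an `E`-valued form with an endomorphism field. -/
def compForm (T : ∀ x, E x →L[ℂ] E x) (w : FormField E) : FormField E := fun x =>
  ((T x).restrictScalars ℝ).comp (w x)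

theorem compForm_apply (T : ∀ x, E x →L[ℂ] E x) (w : FormField E) (x : M)
    (v : TangentSpace (𝓡∂ 2) x) : compForm T w x v = T x (w x v) := rfl

/-- Γ anticommutes with both Clifford factors. In the form of the next lemmas: contraction exchanges
the chirality of the values of the form. -/
theorem chir_contract (hg : IsConformal g c) (w : FormField E) (x : M) :
    D.chir c x (D.contract w x) = -D.contract (compForm (D.chir c) w) x := by
  have hb := tangentBasis_zero_ne_zero x
  rw [D.contract_eq hg w hb, D.contract_eq hg _ hb, map_smul, map_add, D.chir_cl hg, D.chir_cl hg,
    ← smul_neg, neg_add]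
  rfl

theorem contract_eq_add (hg : IsConformal g c) (w : FormField E) (x : M) :
    D.contract (compForm (D.projPlus c) w) x =
      (1 / 2 : ℂ) • (D.contract w x + D.contract (compForm (D.chir c) w) x) ∧
    D.contract (compForm (D.projMinus c) w) x =
      (1 / 2 : ℂ) • (D.contract w x - D.contract (compForm (D.chir c) w) x) := by
  have hb := tangentBasis_zero_ne_zero x
  constructor <;> rw [D.contract_eq hg w hb, D.contract_eq hg _ hb, D.contract_eq hg _ hb] <;>
    simp only [compForm_apply, projPlus_apply, projMinus_apply, map_smul, map_add, map_sub] <;>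
    module

theorem projPlus_contract (hg : IsConformal g c) (w : FormField E) (x : M) :
    D.projPlus c x (D.contract w x) = D.contract (compForm (D.projMinus c) w) x := by
  rw [(D.contract_eq_add hg w x).2, projPlus_apply, D.chir_contract hg, sub_eq_add_neg]

theorem projMinus_contract (hg : IsConformal g c) (w : FormField E) (x : M) :
    D.projMinus c x (D.contract w x) = D.contract (compForm (D.projPlus c) w) x := by
  rw [(D.contract_eq_add hg w x).1, projMinus_apply, D.chir_contract hg, sub_neg_eq_add]

theorem zeroOnePart_apply (w : FormField E) (x : M) (v : TangentSpace (𝓡∂ 2) x) :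
    zeroOnePart c w x v = (1 / 2 : ℂ) • (w x v + Complex.I • w x (c.J x v)) := rfl

/-- Clifford multiplication intertwines the Dirac operator with `√2 ∂̄`. -/
theorem toForm_contract (hg : IsConformal g c) {w : FormField E} {x : M}
    (hw : ∀ v, D.chir c x (w x v) = w x v) :
    D.toForm x (D.contract w x) = (Real.sqrt 2 : ℂ) • zeroOnePart c w x := by
  ext v
  by_cases hv : v = 0
  · subst hv; simp
  rw [smul_apply, zeroOnePart_apply, toForm_apply, D.contract_eq hg w hv, map_smul, map_add,
    cl_cl_self, D.cl_J_of_chir hg (hw _), map_smul, cl_cl_self]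
  -- The contraction yields w(v) + i w(Jv), twice the (0,1)-part, with the factor 1/√2 of `toForm`;
  -- writing 1/√2 = √2 · (1/2) leaves √2.
  have h2 : ((1 / Real.sqrt 2 : ℝ) : ℂ) = (Real.sqrt 2 : ℂ) * (1 / 2) := by
    have := sqrt_two_mul_self
    have h0 : (Real.sqrt 2 : ℂ) ≠ 0 := by
      exact_mod_cast (by positivity : Real.sqrt 2 ≠ 0)
    push_cast
    field_simp
    rw [sq, this]
  rw [h2]
  have hp := metric_ne_zero (g := g) x hv
  rw [smul_neg, smul_comm Complex.I, ← neg_add, ← smul_add, smul_neg, smul_smul (1 / _),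
    one_div_mul_cancel hp, one_smul, neg_smul, smul_neg, neg_neg, smul_smul]

/-- The fibrewise adjoint of `toForm_contract`: skewness moves γ onto s, and γ(Jb)s = −iγ(b)s on E₋
assembles the (0,1)-part. Together with self-adjointness of D it identifies D on E₋ with √2 times
the adjoint of ∂̄. -/
theorem formInner_zeroOnePart (hg : IsConformal g c) (w : FormField E) {x : M} {s : E x}
    (hs : D.chir c x s = -s) :
    D.herm x (D.contract w x) s =
      (Real.sqrt 2 : ℂ) * D.formInner c x (zeroOnePart c w x) (D.toForm x s) := by
  set b := tangentBasis x 0 with hb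
  have hb0 : b ≠ 0 := tangentBasis_zero_ne_zero x
  have hp := metric_ne_zero (g := g) x hb0
  rw [D.contract_eq hg w hb0]
  unfold formInner
  simp only [← hb, zeroOnePart_apply, toForm_apply, c.sq, D.cl_J_of_chir_neg hg hs, map_smulₛₗ,
    map_add, map_neg, add_apply, smul_apply, neg_apply, herm_cl, smul_eq_mul,
    Complex.conj_I, RingHom.id_apply, map_div₀, Complex.conj_ofReal, map_one, smul_neg, neg_smul]
  have h2 := sqrt_two_mul_inv
  field_simp
  rw [h2, map_ofNat]
  linear_combination (-D.herm x (w x b) (D.cl x b s)) * Complex.I_mul_I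

end DiracBundle
end FibreAlgebra

end DiracSurface

end

/-! ### Families of operators, restriction of Hölder classes, and charts of a surface with boundary.
-/

noncomputable section

namespace DiracSurface

section OperatorValued

variable {F W : Type*} [NormedAddCommGroup F] [NormedSpace ℝ F] [FiniteDimensional ℝ F]
  [NormedAddCommGroup W] [NormedSpace ℝ W] {S S' : Set Plane} {ρ : ℝ}

/-- The continuous linear map that agrees with `G` on a fixed basis. -/
def opOf (G : F → W) : F →L[ℝ] W :=
  ∑ j, (LinearMap.toContinuousLinearMap ((Module.finBasis ℝ F).coord j)).smulRight
    (G (Module.finBasis ℝ F j))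

theorem opOf_apply {G : F → W} (hG : IsLinearMap ℝ G) (f : F) : opOf G f = G f := by
  have h : G f = hG.mk' G (∑ j, (Module.finBasis ℝ F).repr f j • Module.finBasis ℝ F j) := by
    rw [Module.Basis.sum_repr]; rfl
  rw [h, map_sum]
  simp [opOf]

theorem opOf_clm (T : F →L[ℝ] W) : opOf (fun f => T f) = T := by
  ext f
  exact opOf_apply (T : F →ₗ[ℝ] W).isLinear f

/-- The regularity assumptions concern fixed vectors f; since F is finite-dimensional, finitely many
of them control the operator. The operator `opOf` makes sense for any map, so linearity of `G y` is
needed only at the points where it is evaluated. -/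
theorem MemHolderLoc.opOf (hS : IsHalfOpen S) {G : Plane → F → W}
    (hG : ∀ f, MemHolderLoc ρ (fun y => G y f) S) : MemHolderLoc ρ (fun y => opOf (G y)) S := by
  refine MemHolderLoc.sum hS _ fun j _ => ?_
  exact (hG _).clm_comp hS (ContinuousLinearMap.smulRightL ℝ F W
    (LinearMap.toContinuousLinearMap ((Module.finBasis ℝ F).coord j)))

theorem contDiffOn_opOf {k : WithTop ℕ∞} {G : Plane → F → W}
    (hG : ∀ f, ContDiffOn ℝ k (fun y => G y f) S) : ContDiffOn ℝ k (fun y => opOf (G y)) S := by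
  refine ContDiffOn.sum fun j _ => ?_
  exact (ContinuousLinearMap.smulRightL ℝ F W
    (LinearMap.toContinuousLinearMap ((Module.finBasis ℝ F).coord j))).contDiff.comp_contDiffOn
      (hG _)

theorem MemHolderLoc.of_apply (hS : IsHalfOpen S) {T : Plane → F →L[ℝ] W}
    (h : ∀ f, MemHolderLoc ρ (fun y => T y f) S) : MemHolderLoc ρ T S :=
  (MemHolderLoc.opOf hS h).congr fun y _ => (opOf_clm (T y)).symm

theorem contDiffOn_of_apply {k : WithTop ℕ∞} {T : Plane → F →L[ℝ] W}
    (h : ∀ f, ContDiffOn ℝ k (fun y => T y f) S) : ContDiffOn ℝ k T S :=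
  (contDiffOn_opOf h).congr fun y _ => (opOf_clm (T y)).symm

end OperatorValued

section HolderMono

variable {W : Type*} [NormedAddCommGroup W] [NormedSpace ℝ W] {S S' : Set Plane} {ρ : ℝ}

theorem IsHalfOpen.eventuallyEq (hS : IsHalfOpen S) {y : Plane} (hy : y ∈ S) :
    S =ᶠ[nhds y] halfPlane := by
  obtain ⟨O, hO, rfl⟩ := hS
  filter_upwards [hO.mem_nhds hy.1] with z hz
  exact propext ⟨fun h => h.2, fun h => ⟨hz, h⟩⟩

/-- Near each of their points both sets coincide with the half-plane, so the iterated derivatives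
within them agree. -/
theorem IsHalfOpen.mono (hS : IsHalfOpen S) (hS' : IsHalfOpen S') (h : S' ⊆ S) {f : Plane → W}
    (hf : MemHolderLoc ρ f S) : MemHolderLoc ρ f S' := by
  refine ⟨hf.1.mono h, fun K hK hc => ?_⟩
  obtain ⟨C, hC⟩ := hf.2 K (hK.trans h) hc
  refine ⟨C, fun y hy z hz => ?_⟩
  have key : ∀ y ∈ K, iteratedFDerivWithin ℝ ⌊ρ⌋₊ f S' y = iteratedFDerivWithin ℝ ⌊ρ⌋₊ f S y :=
    fun y hy => iteratedFDerivWithin_congr_set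
      ((hS'.eventuallyEq (hK hy)).trans (hS.eventuallyEq (h (hK hy))).symm) _
  rw [key y hy, key z hz]
  exact hC y hy z hz

theorem IsHalfOpen.inter_isOpen (hS : IsHalfOpen S) {O : Set Plane} (hO : IsOpen O) :
    IsHalfOpen (S ∩ O) := by
  obtain ⟨O', hO', rfl⟩ := hS
  exact ⟨O' ∩ O, hO'.inter hO, by ext; simp only [Set.mem_inter_iff]; tauto⟩

theorem IsHalfOpen.inter_preimage {X : Type*} [TopologicalSpace X] (hS : IsHalfOpen S)
    {f : Plane → X} (hf : ContinuousOn f S) {U : Set X} (hU : IsOpen U) :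
    IsHalfOpen (S ∩ f ⁻¹' U) := by
  obtain ⟨O, hO, h⟩ := continuousOn_iff'.1 hf U hU
  rw [Set.inter_comm, h, Set.inter_comm]
  exact hS.inter_isOpen hO

end HolderMono

section Charts

set_option linter.unusedSectionVars false

variable {M : Type*} [TopologicalSpace M] [ChartedSpace (EuclideanHalfSpace 2) M]
  [IsManifold (𝓡∂ 2) ∞ M]

theorem isHalfOpen_target (x₀ : M) : IsHalfOpen (extChartAt (𝓡∂ 2) x₀).target := by
  refine ⟨(𝓡∂ 2).symm ⁻¹' (chartAt (EuclideanHalfSpace 2) x₀).target,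
    (chartAt (EuclideanHalfSpace 2) x₀).open_target.preimage (𝓡∂ 2).continuous_symm, ?_⟩
  rw [extChartAt_target, range_modelWithCornersEuclideanHalfSpace]
  rfl

theorem symm_mem_source {x₀ : M} {y : Plane} (hy : y ∈ (extChartAt (𝓡∂ 2) x₀).target) :
    (extChartAt (𝓡∂ 2) x₀).symm y ∈ (chartAt (EuclideanHalfSpace 2) x₀).source := by
  rw [← extChartAt_source (𝓡∂ 2)]
  exact (extChartAt (𝓡∂ 2) x₀).map_target hy

theorem tangentCoord_coordVec {x₀ x : M} (hx : x ∈ (chartAt (EuclideanHalfSpace 2) x₀).source)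
    (a : Plane) : tangentCoord x₀ x (coordVec x₀ a x) = a :=
  (trivializationAt Plane (TangentSpace (𝓡∂ 2)) x₀).continuousLinearMapAt_symmL (R := ℝ)
    (by rwa [TangentBundle.trivializationAt_baseSet]) a

theorem coordVec_tangentCoord {x₀ x : M} (hx : x ∈ (chartAt (EuclideanHalfSpace 2) x₀).source)
    (v : TangentSpace (𝓡∂ 2) x) : coordVec x₀ (tangentCoord x₀ x v) x = v :=
  (trivializationAt Plane (TangentSpace (𝓡∂ 2)) x₀).symmL_continuousLinearMapAt (R := ℝ)
    (by rwa [TangentBundle.trivializationAt_baseSet]) v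

theorem coordVec_add (x₀ : M) (a b : Plane) (x : M) :
    coordVec x₀ (a + b) x = coordVec x₀ a x + coordVec x₀ b x := map_add _ _ _

theorem coordVec_smul (x₀ : M) (t : ℝ) (a : Plane) (x : M) :
    coordVec x₀ (t • a) x = t • coordVec x₀ a x := map_smul _ _ _

theorem coordVec_ne_zero {x₀ x : M} (hx : x ∈ (chartAt (EuclideanHalfSpace 2) x₀).source)
    {a : Plane} (ha : a ≠ 0) : coordVec x₀ a x ≠ 0 := by
  intro h
  apply ha
  rw [← tangentCoord_coordVec hx a, h, map_zero]

theorem stdVec_zero_ne_zero : stdVec 0 ≠ 0 := by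
  intro h
  have := congrArg (fun v : Plane => v 0) h
  simp [stdVec] at this

theorem mfderiv_extChartAt {x₀ x : M} (hx : x ∈ (chartAt (EuclideanHalfSpace 2) x₀).source) :
    mfderiv (𝓡∂ 2) 𝓘(ℝ, Plane) (extChartAt (𝓡∂ 2) x₀) x = tangentCoord x₀ x :=
  (TangentBundle.continuousLinearMapAt_trivializationAt hx).symm

/-- Invariance of the boundary: a point that is interior in one chart is interior in every chart. It
makes coordinate changes map interior points to interior points. -/
theorem mem_interior_target_of_mem {x₀ x₁ x : M}
    (h₀ : x ∈ (chartAt (EuclideanHalfSpace 2) x₀).source)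
    (h₁ : x ∈ (chartAt (EuclideanHalfSpace 2) x₁).source)
    (h : extChartAt (𝓡∂ 2) x₀ x ∈ interior (extChartAt (𝓡∂ 2) x₀).target) :
    extChartAt (𝓡∂ 2) x₁ x ∈ interior (extChartAt (𝓡∂ 2) x₁).target :=
  ModelWithCorners.mem_interior_range_of_mem_interior_range_of_mem_atlas (n := ∞) (by simp)
    (chart_mem_atlas _ x₀) (chart_mem_atlas _ x₁) h₀ h₁ h

end Charts

end DiracSurface

end

/-! ### Metric coefficients, Christoffel symbols and the area density. -/

noncomputable section

namespace DiracSurface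

section MetricCoefficients

set_option linter.unusedSectionVars false

variable {M : Type*} [TopologicalSpace M] [ChartedSpace (EuclideanHalfSpace 2) M]
  [IsManifold (𝓡∂ 2) ∞ M] (g : SurfaceMetric M) (c : ComplexStructure M)

theorem contMDiffOn_coordVec (x₀ : M) (a : Plane) :
    ContMDiffOn (𝓡∂ 2) ((𝓡∂ 2).prod 𝓘(ℝ, Plane)) ∞
      (fun x => TotalSpace.mk' Plane x (coordVec x₀ a x))
      (chartAt (EuclideanHalfSpace 2) x₀).source := by
  have hb : (trivializationAt Plane (TangentSpace (𝓡∂ 2)) x₀).baseSet =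
    (chartAt (EuclideanHalfSpace 2) x₀).source := TangentBundle.trivializationAt_baseSet x₀
  rw [← hb, Trivialization.contMDiffOn_section_baseSet_iff]
  refine contMDiffOn_const (c := a) |>.congr fun x hx => ?_
  rw [coordVec, Trivialization.symmL_apply _ hx]
  exact congrArg Prod.snd (Trivialization.apply_mk_symm _ hx a)

/-- The value of the metric on two coordinate vector fields is smooth in the chart. -/
theorem contDiffOn_metric (x₀ : M) (a b : Plane) :
    ContDiffOn ℝ ∞ (fun y => g.inner ((extChartAt (𝓡∂ 2) x₀).symm y)
      (coordVec x₀ a _) (coordVec x₀ b _)) (extChartAt (𝓡∂ 2) x₀).target := by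
  have h1 : ContMDiffOn (𝓡∂ 2) ((𝓡∂ 2).prod 𝓘(ℝ)) ∞
      (fun m => TotalSpace.mk' ℝ (E := Bundle.Trivial M ℝ) m
        (g.inner m (coordVec x₀ a m) (coordVec x₀ b m)))
      (chartAt (EuclideanHalfSpace 2) x₀).source :=
    ContMDiffOn.clm_bundle_apply₂ (F₁ := Plane) (F₂ := Plane) g.contMDiff.contMDiffOn
      (contMDiffOn_coordVec x₀ a) (contMDiffOn_coordVec x₀ b)
  have h2 : ContMDiffOn (𝓡∂ 2) 𝓘(ℝ) ∞
      (fun m => g.inner m (coordVec x₀ a m) (coordVec x₀ b m))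
      (chartAt (EuclideanHalfSpace 2) x₀).source := by
    intro m hm
    have := h1 m hm
    simp only [contMDiffWithinAt_totalSpace] at this
    exact this.2
  exact contMDiffOn_iff_contDiffOn.1 (h2.comp (contMDiffOn_extChartAt_symm x₀)
    fun y hy => symm_mem_source hy)

theorem contDiffOn_metricMatrix (x₀ : M) (i j : Fin 2) :
    ContDiffOn ℝ ∞ (fun y => metricMatrix g x₀ y i j) (extChartAt (𝓡∂ 2) x₀).target :=
  contDiffOn_metric g x₀ _ _

theorem metricMatrix_symm (x₀ : M) (y : Plane) (i j : Fin 2) :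
    metricMatrix g x₀ y i j = metricMatrix g x₀ y j i := g.symm _ _ _

theorem det_metricMatrix (x₀ : M) (y : Plane) : (metricMatrix g x₀ y).det =
    metricMatrix g x₀ y 0 0 * metricMatrix g x₀ y 1 1 -
      metricMatrix g x₀ y 0 1 * metricMatrix g x₀ y 0 1 := by
  rw [Matrix.det_fin_two, metricMatrix_symm g x₀ y 1 0]

theorem metricMatrix_zero_zero_pos {x₀ : M} {y : Plane} (hy : y ∈ (extChartAt (𝓡∂ 2) x₀).target) :
    0 < metricMatrix g x₀ y 0 0 :=
  g.pos _ _ (coordVec_ne_zero (symm_mem_source hy) stdVec_zero_ne_zero)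

theorem det_metricMatrix_pos {x₀ : M} {y : Plane} (hy : y ∈ (extChartAt (𝓡∂ 2) x₀).target) :
    0 < (metricMatrix g x₀ y).det := by
  rw [det_metricMatrix]
  set x := (extChartAt (𝓡∂ 2) x₀).symm y with hx
  have h0 := metricMatrix_zero_zero_pos g hy
  -- The Gram–Schmidt vector g₀₀e₁ − g₀₁e₀ has squared length g₀₀ · det g, and g₀₀ > 0.
  have hne : metricMatrix g x₀ y 0 0 • stdVec 1 - metricMatrix g x₀ y 0 1 • stdVec 0 ≠ 0 := by
    intro h
    have := congrArg (fun v : Plane => v 1) h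
    simp [stdVec] at this
    exact h0.ne' this
  have hp := g.pos x _ (coordVec_ne_zero (symm_mem_source hy) hne)
  rw [sub_eq_add_neg, ← neg_smul, coordVec_add, coordVec_smul, coordVec_smul] at hp
  simp only [map_add, map_smul, add_apply, smul_apply, smul_eq_mul] at hp
  have e00 : g.inner x (coordVec x₀ (stdVec 0) x) (coordVec x₀ (stdVec 0) x) =
    metricMatrix g x₀ y 0 0 := rfl
  have e01 : g.inner x (coordVec x₀ (stdVec 0) x) (coordVec x₀ (stdVec 1) x) =
    metricMatrix g x₀ y 0 1 := rfl
  have e10 : g.inner x (coordVec x₀ (stdVec 1) x) (coordVec x₀ (stdVec 0) x) =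
    metricMatrix g x₀ y 0 1 := metricMatrix_symm g x₀ y 1 0
  have e11 : g.inner x (coordVec x₀ (stdVec 1) x) (coordVec x₀ (stdVec 1) x) =
    metricMatrix g x₀ y 1 1 := rfl
  rw [e00, e01, e10, e11] at hp
  have : 0 < metricMatrix g x₀ y 0 0 * (metricMatrix g x₀ y 0 0 * metricMatrix g x₀ y 1 1 -
      metricMatrix g x₀ y 0 1 * metricMatrix g x₀ y 0 1) := by
    convert hp using 1
    ring
  exact (mul_pos_iff_of_pos_left h0).1 this

theorem contDiffOn_det (x₀ : M) :
    ContDiffOn ℝ ∞ (fun y => (metricMatrix g x₀ y).det) (extChartAt (𝓡∂ 2) x₀).target := by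
  simp only [Matrix.det_fin_two]
  exact ((contDiffOn_metricMatrix g x₀ 0 0).mul (contDiffOn_metricMatrix g x₀ 1 1)).sub
    ((contDiffOn_metricMatrix g x₀ 0 1).mul (contDiffOn_metricMatrix g x₀ 1 0))

theorem contDiffOn_areaDensity (x₀ : M) :
    ContDiffOn ℝ ∞ (areaDensity g x₀) (extChartAt (𝓡∂ 2) x₀).target :=
  (contDiffOn_det g x₀).sqrt fun _ hy => (det_metricMatrix_pos g hy).ne'

theorem areaDensity_pos {x₀ : M} {y : Plane} (hy : y ∈ (extChartAt (𝓡∂ 2) x₀).target) :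
    0 < areaDensity g x₀ y := Real.sqrt_pos.2 (det_metricMatrix_pos g hy)

theorem inv_metricMatrix {x₀ : M} {y : Plane} : (metricMatrix g x₀ y)⁻¹ =
    (metricMatrix g x₀ y).det⁻¹ • !![metricMatrix g x₀ y 1 1, -metricMatrix g x₀ y 0 1;
      -metricMatrix g x₀ y 1 0, metricMatrix g x₀ y 0 0] := by
  rw [Matrix.inv_def, Ring.inverse_eq_inv', Matrix.adjugate_fin_two]

theorem contDiffOn_inv_metricMatrix (x₀ : M) (i j : Fin 2) :
    ContDiffOn ℝ ∞ (fun y => (metricMatrix g x₀ y)⁻¹ i j) (extChartAt (𝓡∂ 2) x₀).target := by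
  have hd := (contDiffOn_det g x₀).inv fun _ hy => (det_metricMatrix_pos g hy).ne'
  simp only [inv_metricMatrix, Matrix.smul_apply, smul_eq_mul]
  refine hd.mul ?_
  fin_cases i <;> fin_cases j
  exacts [contDiffOn_metricMatrix g x₀ 1 1, (contDiffOn_metricMatrix g x₀ 0 1).neg,
    (contDiffOn_metricMatrix g x₀ 1 0).neg, contDiffOn_metricMatrix g x₀ 0 0]

theorem contDiffOn_metricDeriv (x₀ : M) (k i j : Fin 2) :
    ContDiffOn ℝ ∞ (metricDeriv g x₀ k i j) (extChartAt (𝓡∂ 2) x₀).target :=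
  ((contDiffOn_metricMatrix g x₀ i j).fderivWithin (m := ∞) (isHalfOpen_target x₀).uniqueDiffOn
    le_rfl).clm_apply contDiffOn_const

theorem contDiffOn_christoffel (x₀ : M) (k i j : Fin 2) :
    ContDiffOn ℝ ∞ (christoffel g x₀ k i j) (extChartAt (𝓡∂ 2) x₀).target :=
  contDiffOn_const.mul (ContDiffOn.sum fun l _ => (contDiffOn_inv_metricMatrix g x₀ k l).mul
    (((contDiffOn_metricDeriv g x₀ i j l).add (contDiffOn_metricDeriv g x₀ j i l)).sub
      (contDiffOn_metricDeriv g x₀ l i j)))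

theorem metricDeriv_symm (x₀ : M) (k i j : Fin 2) (y : Plane) :
    metricDeriv g x₀ k i j y = metricDeriv g x₀ k j i y := by
  simp only [metricDeriv, metricMatrix_symm g x₀ _ i j]

theorem metricDeriv_of_interior {x₀ : M} {y : Plane}
    (hy : y ∈ interior (extChartAt (𝓡∂ 2) x₀).target) (k i j : Fin 2) :
    metricDeriv g x₀ k i j y = fderiv ℝ (fun z => metricMatrix g x₀ z i j) y (stdVec k) := by
  rw [metricDeriv, fderivWithin_of_mem_nhds (mem_interior_iff_mem_nhds.1 hy)]

/-- `∂_i √g = √g Γ^k_{ik}`. -/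
theorem fderiv_areaDensity {x₀ : M} {y : Plane}
    (hy : y ∈ interior (extChartAt (𝓡∂ 2) x₀).target) (i : Fin 2) :
    fderiv ℝ (areaDensity g x₀) y (stdVec i) =
      areaDensity g x₀ y * ∑ k, christoffel g x₀ k k i y := by
  have hy' := interior_subset hy
  have hn := mem_interior_iff_mem_nhds.1 hy
  have hd : ∀ i j, HasFDerivAt (fun z => metricMatrix g x₀ z i j)
      (fderiv ℝ (fun z => metricMatrix g x₀ z i j) y) y := fun i j =>
    (((contDiffOn_metricMatrix g x₀ i j).contDiffAt hn).differentiableAt (by simp)).hasFDerivAt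
  have hdet := ((hd 0 0).mul (hd 1 1)).sub ((hd 0 1).mul (hd 1 0))
  have hpos := det_metricMatrix_pos g hy'
  have e : areaDensity g x₀ = fun z => Real.sqrt (metricMatrix g x₀ z 0 0 * metricMatrix g x₀ z 1 1 -
      metricMatrix g x₀ z 0 1 * metricMatrix g x₀ z 1 0) := by
    funext z; rw [areaDensity, Matrix.det_fin_two]
  have hs := hdet.sqrt (by
    have := hpos.ne'
    rw [Matrix.det_fin_two] at this
    exact this)
  have hs' : HasFDerivAt (areaDensity g x₀) ((1 / (2 * areaDensity g x₀ y)) •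
      (metricMatrix g x₀ y 0 0 • fderiv ℝ (fun z => metricMatrix g x₀ z 1 1) y +
          metricMatrix g x₀ y 1 1 • fderiv ℝ (fun z => metricMatrix g x₀ z 0 0) y -
        (metricMatrix g x₀ y 0 1 • fderiv ℝ (fun z => metricMatrix g x₀ z 1 0) y +
          metricMatrix g x₀ y 1 0 • fderiv ℝ (fun z => metricMatrix g x₀ z 0 1) y))) y := by
    rw [e]
    exact hs
  have hA : areaDensity g x₀ y ^ 2 = (metricMatrix g x₀ y).det := Real.sq_sqrt hpos.le
  have hApos := areaDensity_pos g hy'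
  have key : fderiv ℝ (areaDensity g x₀) y (stdVec i) = (2 * areaDensity g x₀ y)⁻¹ *
      (metricMatrix g x₀ y 0 0 * metricDeriv g x₀ i 1 1 y + metricMatrix g x₀ y 1 1 * metricDeriv g x₀ i 0 0 y
      - 2 * (metricMatrix g x₀ y 0 1 * metricDeriv g x₀ i 0 1 y)) := by
    simp only [metricDeriv_of_interior g hy]
    rw [hs'.fderiv]
    have e10 : (fun z => metricMatrix g x₀ z 1 0) = fun z => metricMatrix g x₀ z 0 1 := by
      funext z; exact metricMatrix_symm g x₀ z 1 0
    simp only [smul_apply, sub_apply, add_apply, smul_eq_mul, e10]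
    rw [metricMatrix_symm g x₀ y 1 0]
    simp only [one_div]
    ring
  rw [key]
  -- In the trace Γ^k_{ki} the terms ∂_k g_{il} and ∂_l g_{ki} cancel against the symmetric inverse
  -- matrix, leaving half the trace of g⁻¹∂_i g; in dimension two this is ∂_i det g / (2 det g).
  have h2 : ∑ k, christoffel g x₀ k k i y = (1 / 2) * ((metricMatrix g x₀ y).det⁻¹ *
     (metricMatrix g x₀ y 0 0 * metricDeriv g x₀ i 1 1 y + metricMatrix g x₀ y 1 1 * metricDeriv g x₀ i 0 0 y
      - 2 * (metricMatrix g x₀ y 0 1 * metricDeriv g x₀ i 0 1 y))) := by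
    simp only [christoffel, Fin.sum_univ_two, inv_metricMatrix, Matrix.smul_apply, smul_eq_mul]
    simp only [Matrix.of_apply, Matrix.cons_val', Matrix.cons_val_zero, Matrix.cons_val_one,
      Matrix.cons_val_fin_one]
    rw [metricMatrix_symm g x₀ y 1 0]
    fin_cases i
    all_goals
      simp only [Fin.zero_eta, Fin.mk_one]
      rw [metricDeriv_symm g x₀ 0 1 0, metricDeriv_symm g x₀ 1 1 0]
      ring
  rw [h2, ← hA]
  field_simp

end MetricCoefficients

end DiracSurface

end

/-! ### Sections, endomorphisms and connections in charts and trivializations. -/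

noncomputable section

namespace DiracSurface

section BundleCoordinates

set_option linter.unusedSectionVars false

variable {M : Type*} [TopologicalSpace M] [ChartedSpace (EuclideanHalfSpace 2) M]
  [IsManifold (𝓡∂ 2) ∞ M]
  {F : Type*} [NormedAddCommGroup F] [NormedSpace ℂ F]
  {E : M → Type*} [∀ x, AddCommGroup (E x)] [∀ x, Module ℂ (E x)]
  [∀ x, TopologicalSpace (E x)] [∀ x, IsTopologicalAddGroup (E x)] [∀ x, ContinuousSMul ℂ (E x)]
  [TopologicalSpace (TotalSpace F E)] [FiberBundle F E] [VectorBundle ℂ F E]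

theorem isHalfOpen_locDom (x₀ : M) : IsHalfOpen (locDom F E x₀) :=
  (isHalfOpen_target x₀).inter_preimage (continuousOn_extChartAt_symm x₀)
    (trivializationAt F E x₀).open_baseSet

theorem locDom_subset (x₀ : M) : locDom F E x₀ ⊆ (extChartAt (𝓡∂ 2) x₀).target :=
  Set.inter_subset_left

theorem isHalfOpen_locDom_inter (x₀ : M) {U : Set M} (hU : IsOpen U) :
    IsHalfOpen (locDom F E x₀ ∩ (extChartAt (𝓡∂ 2) x₀).symm ⁻¹' U) :=
  (isHalfOpen_locDom x₀).inter_preimage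
    ((continuousOn_extChartAt_symm x₀).mono (locDom_subset x₀)) hU

theorem mem_locDom_of_mem {x₀ x : M} (hx : x ∈ (chartAt (EuclideanHalfSpace 2) x₀).source)
    (hx' : x ∈ (trivializationAt F E x₀).baseSet) : extChartAt (𝓡∂ 2) x₀ x ∈ locDom F E x₀ := by
  have hx1 : x ∈ (extChartAt (𝓡∂ 2) x₀).source := by rwa [extChartAt_source]
  refine ⟨(extChartAt (𝓡∂ 2) x₀).map_source hx1, ?_⟩
  rw [Set.mem_preimage, (extChartAt (𝓡∂ 2) x₀).left_inv hx1]
  exact hx'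

theorem mem_interior_locDom {x₀ : M} {y : Plane} (hy : y ∈ locDom F E x₀)
    (hy' : y ∈ interior (extChartAt (𝓡∂ 2) x₀).target) : y ∈ interior (locDom F E x₀) := by
  rw [mem_interior_iff_mem_nhds] at hy' ⊢
  refine Filter.inter_mem hy' ?_
  exact ((continuousOn_extChartAt_symm x₀).continuousAt hy').preimage_mem_nhds
    ((trivializationAt F E x₀).open_baseSet.mem_nhds hy.2)

theorem extChartAt_symm_eq {x₀ : M} {y : Plane} (hy : y ∈ locDom F E x₀) :
    extChartAt (𝓡∂ 2) x₀ ((extChartAt (𝓡∂ 2) x₀).symm y) = y :=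
  (extChartAt (𝓡∂ 2) x₀).right_inv hy.1

theorem locRep_constSec {x₀ : M} {y : Plane} (hy : y ∈ locDom F E x₀) (f : F) :
    locRep F x₀ (constSec F E x₀ f) y = f :=
  (trivializationAt F E x₀).continuousLinearMapAt_symmL (R := ℂ) hy.2 f

theorem constSec_locRep {x₀ : M} {y : Plane} (hy : y ∈ locDom F E x₀) (u : ∀ x, E x) :
    constSec F E x₀ (locRep F x₀ u y) ((extChartAt (𝓡∂ 2) x₀).symm y) = u _ :=
  (trivializationAt F E x₀).symmL_continuousLinearMapAt (R := ℂ) hy.2 _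

theorem locRep_congr {x₀ : M} {y : Plane} {u v : ∀ x, E x}
    (h : u ((extChartAt (𝓡∂ 2) x₀).symm y) = v _) : locRep F x₀ u y = locRep F x₀ v y := by
  rw [locRep, h, locRep]

theorem eq_of_locRep_eq {x₀ : M} {y : Plane} (hy : y ∈ locDom F E x₀) {u v : ∀ x, E x}
    (h : locRep F x₀ u y = locRep F x₀ v y) : u ((extChartAt (𝓡∂ 2) x₀).symm y) = v _ := by
  rw [← constSec_locRep hy u, h, constSec_locRep hy v]

theorem locRep_add (x₀ : M) (u v : ∀ x, E x) (y : Plane) :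
    locRep F x₀ (fun x => u x + v x) y = locRep F x₀ u y + locRep F x₀ v y := map_add _ _ _

theorem locRep_sub (x₀ : M) (u v : ∀ x, E x) (y : Plane) :
    locRep F x₀ (fun x => u x - v x) y = locRep F x₀ u y - locRep F x₀ v y := map_sub _ _ _

theorem locRep_smul (x₀ : M) (t : ℂ) (u : ∀ x, E x) (y : Plane) :
    locRep F x₀ (fun x => t • u x) y = t • locRep F x₀ u y := map_smul _ _ _

theorem locRep_real_smul (x₀ : M) (θ : M → ℝ) (u : ∀ x, E x) (y : Plane) :
    locRep F x₀ (fun x => θ x • u x) y =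
      θ ((extChartAt (𝓡∂ 2) x₀).symm y) • locRep F x₀ u y := by
  have : (fun x => θ x • u x) = fun x => (θ x : ℂ) • u x := by
    funext x; rw [Complex.coe_smul]
  rw [this, ← Complex.coe_smul]
  exact map_smul _ _ _

theorem locRep_extChartAt {x₀ x : M} (hx : x ∈ (chartAt (EuclideanHalfSpace 2) x₀).source)
    (u : ∀ x, E x) : locRep F x₀ u (extChartAt (𝓡∂ 2) x₀ x) =
      (trivializationAt F E x₀).continuousLinearMapAt ℂ x (u x) := by
  rw [locRep, (extChartAt (𝓡∂ 2) x₀).left_inv (by rwa [extChartAt_source])]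

/-- A bundle endomorphism in the chart and the trivialization at `x₀`. -/
def locMap (x₀ : M) (T : ∀ x, E x →L[ℂ] E x) (y : Plane) : F →L[ℝ] F :=
  (((trivializationAt F E x₀).continuousLinearMapAt ℂ ((extChartAt (𝓡∂ 2) x₀).symm y)).comp
    ((T _).comp ((trivializationAt F E x₀).symmL ℂ _))).restrictScalars ℝ

theorem locMap_apply (x₀ : M) (T : ∀ x, E x →L[ℂ] E x) (y : Plane) (f : F) :
    locMap x₀ T y f = locRep F x₀ (fun x => T x (constSec F E x₀ f x)) y := rfl

theorem locRep_map {x₀ : M} {y : Plane} (hy : y ∈ locDom F E x₀) (T : ∀ x, E x →L[ℂ] E x)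
    (u : ∀ x, E x) : locRep F x₀ (fun x => T x (u x)) y = locMap x₀ T y (locRep F x₀ u y) := by
  rw [locMap_apply]
  exact locRep_congr (by rw [constSec_locRep hy])

theorem locMap_smul (x₀ : M) (T : ∀ x, E x →L[ℂ] E x) (y : Plane) (t : ℂ) (f : F) :
    locMap x₀ T y (t • f) = t • locMap x₀ T y f := by
  simp only [locMap, ContinuousLinearMap.coe_restrictScalars', ContinuousLinearMap.comp_apply,
    map_smul]

theorem locMap_comp {x₀ : M} {y : Plane} (hy : y ∈ locDom F E x₀) (S T : ∀ x, E x →L[ℂ] E x)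
    (f : F) : locMap x₀ S y (locMap x₀ T y f) = locMap x₀ (fun x => (S x).comp (T x)) y f := by
  rw [locMap_apply x₀ T, ← locRep_map hy S]
  rfl

/-! ### Differentiability of sections -/

variable [FiniteDimensional ℂ F] [VectorBundle ℝ F E] [ContMDiffVectorBundle ∞ F E (𝓡∂ 2)]

theorem secDiffAt_iff {x₀ x : M} (hx : x ∈ (chartAt (EuclideanHalfSpace 2) x₀).source)
    (hx' : x ∈ (trivializationAt F E x₀).baseSet) (u : ∀ x, E x) :
    SecDiffAt F u x ↔ MDifferentiableAt (𝓡∂ 2) 𝓘(ℝ, F)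
      (fun z => locRep F x₀ u (extChartAt (𝓡∂ 2) x₀ z)) x := by
  have : ContMDiffVectorBundle 1 F E (𝓡∂ 2) := ContMDiffVectorBundle.of_le (n := ∞) (by simp)
  rw [SecDiffAt, Trivialization.mdifferentiableAt_section_iff (𝓡∂ 2) (trivializationAt F E x₀) u hx']
  refine Filter.EventuallyEq.mdifferentiableAt_iff ?_
  filter_upwards [(chartAt (EuclideanHalfSpace 2) x₀).open_source.mem_nhds hx,
    (trivializationAt F E x₀).open_baseSet.mem_nhds hx'] with z hz hz'
  rw [locRep_extChartAt hz]
  exact (Trivialization.continuousLinearMapAt_apply_of_mem ℂ (trivializationAt F E x₀) hz' (u z)).symm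

theorem mdifferentiableAt_comp_extChartAt {W : Type*} [NormedAddCommGroup W] [NormedSpace ℝ W]
    {x₀ x : M} (hx : x ∈ (chartAt (EuclideanHalfSpace 2) x₀).source) {f : Plane → W}
    (hf : DifferentiableAt ℝ f (extChartAt (𝓡∂ 2) x₀ x)) :
    MDifferentiableAt (𝓡∂ 2) 𝓘(ℝ, W) (fun z => f (extChartAt (𝓡∂ 2) x₀ z)) x :=
  hf.mdifferentiableAt.comp x (mdifferentiableAt_extChartAt hx)

theorem mfderiv_comp_extChartAt {W : Type*} [NormedAddCommGroup W] [NormedSpace ℝ W]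
    {x₀ x : M} (hx : x ∈ (chartAt (EuclideanHalfSpace 2) x₀).source) {f : Plane → W}
    (hf : DifferentiableAt ℝ f (extChartAt (𝓡∂ 2) x₀ x)) (a : Plane) :
    (mfderiv (𝓡∂ 2) 𝓘(ℝ, W) (fun z => f (extChartAt (𝓡∂ 2) x₀ z)) x (coordVec x₀ a x) : W) =
      fderiv ℝ f (extChartAt (𝓡∂ 2) x₀ x) a := by
  have h := mfderiv_comp_apply x hf.mdifferentiableAt (mdifferentiableAt_extChartAt hx)
    (coordVec x₀ a x)
  rw [mfderiv_extChartAt hx, mfderiv_eq_fderiv] at h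
  exact h.trans (congrArg (fderiv ℝ f (extChartAt (𝓡∂ 2) x₀ x)) (tangentCoord_coordVec hx a))

theorem secDiffAt_of_differentiableAt {x₀ : M} {y : Plane} (hy : y ∈ locDom F E x₀) {u : ∀ x, E x}
    (h : DifferentiableAt ℝ (locRep F x₀ u) y) :
    SecDiffAt F u ((extChartAt (𝓡∂ 2) x₀).symm y) := by
  rw [secDiffAt_iff (symm_mem_source hy.1) hy.2]
  refine mdifferentiableAt_comp_extChartAt (symm_mem_source hy.1) ?_
  rwa [extChartAt_symm_eq hy]

theorem secDiffAt_constSec {x₀ x : M} (hx : x ∈ (chartAt (EuclideanHalfSpace 2) x₀).source)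
    (hx' : x ∈ (trivializationAt F E x₀).baseSet) (f : F) : SecDiffAt F (constSec F E x₀ f) x := by
  rw [secDiffAt_iff hx hx']
  refine (mdifferentiableAt_const (c := f)).congr_of_eventuallyEq ?_
  filter_upwards [(chartAt (EuclideanHalfSpace 2) x₀).open_source.mem_nhds hx,
    (trivializationAt F E x₀).open_baseSet.mem_nhds hx'] with z hz hz'
  exact locRep_constSec (mem_locDom_of_mem hz hz') f

theorem eventually_nhds_symm {x₀ : M} {y : Plane} (hy : y ∈ locDom F E x₀) {P : M → Prop}
    (h : ∀ᶠ z in nhds y, z ∈ locDom F E x₀ → P ((extChartAt (𝓡∂ 2) x₀).symm z)) :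
    ∀ᶠ x in nhds ((extChartAt (𝓡∂ 2) x₀).symm y), P x := by
  have hx := symm_mem_source hy.1
  have hc : ContinuousAt (extChartAt (𝓡∂ 2) x₀) ((extChartAt (𝓡∂ 2) x₀).symm y) :=
    continuousAt_extChartAt' (by rwa [extChartAt_source])
  rw [← extChartAt_symm_eq hy] at h
  filter_upwards [hc.eventually h,
    (chartAt (EuclideanHalfSpace 2) x₀).open_source.mem_nhds hx,
    (trivializationAt F E x₀).open_baseSet.mem_nhds hy.2] with z hz h1 h2
  have := hz (mem_locDom_of_mem h1 h2)
  rwa [(extChartAt (𝓡∂ 2) x₀).left_inv (by rwa [extChartAt_source])] at this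

/-! ### Connections in coordinates -/

theorem isLinearMap_connForm (conn : CovariantDerivative (𝓡∂ 2) F E) {x₀ : M} {y : Plane}
    (hy : y ∈ locDom F E x₀) (a : Plane) : IsLinearMap ℝ (connForm conn x₀ a y) := by
  have hd := secDiffAt_constSec (E := E) (symm_mem_source hy.1) hy.2
  constructor
  · intro f f'
    have h := conn.isCovariantDerivativeOnUniv.add (hd f) (hd f')
    have e : constSec F E x₀ (f + f') = constSec F E x₀ f + constSec F E x₀ f' := by
      funext x; exact map_add _ _ _
    simp only [connForm, component, locRep, e]
    erw [h]
    rw [add_apply, map_add]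
  · intro t f
    have h := conn.isCovariantDerivativeOnUniv.smul_const t (hd f)
    have e : constSec F E x₀ (t • f) = t • constSec F E x₀ f := by
      funext x
      have h1 := ((trivializationAt F E x₀).symmL ℂ x).map_smul (t : ℂ) f
      rw [Complex.coe_smul, Complex.coe_smul] at h1
      exact h1
    simp only [connForm, component, locRep, e]
    erw [h]
    rw [smul_apply, ← Complex.coe_smul, map_smul, Complex.coe_smul]

/-- The connection form as a linear map. -/
def connOp (conn : CovariantDerivative (𝓡∂ 2) F E) (x₀ : M) (a : Plane) (y : Plane) : F →L[ℝ] F :=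
  opOf (connForm conn x₀ a y)

theorem connOp_apply (conn : CovariantDerivative (𝓡∂ 2) F E) {x₀ : M} {y : Plane}
    (hy : y ∈ locDom F E x₀) (a : Plane) (f : F) :
    connOp conn x₀ a y f = connForm conn x₀ a y f :=
  opOf_apply (isLinearMap_connForm conn hy a) f

theorem conn_sum (conn : CovariantDerivative (𝓡∂ 2) F E) {ι : Type*} (t : Finset ι)
    {s : ι → ∀ x, E x} {x : M} (h : ∀ i ∈ t, SecDiffAt F (s i) x) :
    SecDiffAt F (fun x => ∑ i ∈ t, s i x) x ∧
    conn (fun x => ∑ i ∈ t, s i x) x = ∑ i ∈ t, conn (s i) x := by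
  have : ContMDiffVectorBundle 1 F E (𝓡∂ 2) := ContMDiffVectorBundle.of_le (n := ∞) (by simp)
  classical
  induction t using Finset.induction_on with
  | empty =>
    simp only [Finset.sum_empty]
    exact ⟨mdifferentiableAt_zeroSection .., congrFun conn.zero x⟩
  | insert i t hi ih =>
    obtain ⟨h1, h2⟩ := ih fun j hj => h j (Finset.mem_insert_of_mem hj)
    have h3 := h i (Finset.mem_insert_self i t)
    have e : (fun x => ∑ j ∈ insert i t, s j x) = s i + fun x => ∑ j ∈ t, s j x := by
      funext x; rw [Finset.sum_insert hi]; rfl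
    rw [e, Finset.sum_insert hi, ← h2]
    exact ⟨mdifferentiableAt_add_section h3 h1, conn.isCovariantDerivativeOnUniv.add h3 h1⟩

/-- `∇_a s = ∂_a s + A(a) s` in a chart and a trivialization. -/
theorem locRep_conn (conn : CovariantDerivative (𝓡∂ 2) F E) {x₀ : M} {y : Plane}
    (hy : y ∈ locDom F E x₀) {s : ∀ x, E x}
    (hs : DifferentiableAt ℝ (locRep F x₀ s) y) (a : Plane) :
    locRep F x₀ (component x₀ a (conn s)) y =
      fderiv ℝ (locRep F x₀ s) y a + connOp conn x₀ a y (locRep F x₀ s y) := by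
  have hm : ContMDiffVectorBundle 1 F E (𝓡∂ 2) := ContMDiffVectorBundle.of_le (n := ∞) (by simp)
  have hx := symm_mem_source hy.1
  have hyy := extChartAt_symm_eq hy
  set x := (extChartAt (𝓡∂ 2) x₀).symm y with hxdef
  set b := Module.finBasis ℝ F
  let L : _ → F →L[ℝ] ℝ := fun j => LinearMap.toContinuousLinearMap (b.coord j)
  let θ : _ → M → ℝ := fun j z => L j (locRep F x₀ s (extChartAt (𝓡∂ 2) x₀ z))
  -- Near x the section is the sum of the σ j, real functions times sections constant in the
  -- trivialization. The connection is local, so the Leibniz rule applies termwise.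
  let σ : _ → ∀ x, E x := fun j => θ j • constSec F E x₀ (b j)
  have hLd : ∀ j, DifferentiableAt ℝ (fun z => L j (locRep F x₀ s z)) (extChartAt (𝓡∂ 2) x₀ x) := by
    intro j
    rw [hyy]
    exact (L j).differentiableAt.comp y hs
  have hθ : ∀ j, MDifferentiableAt (𝓡∂ 2) 𝓘(ℝ) (θ j) x := fun j =>
    mdifferentiableAt_comp_extChartAt hx (hLd j)
  have hc := fun j => secDiffAt_constSec (E := E) hx hy.2 (b j)
  have hσ : ∀ j, SecDiffAt F (σ j) x := fun j => (hθ j).smul_section (hc j)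
  have hleib := fun j => conn.isCovariantDerivativeOnUniv.leibniz (hc j) (hθ j)
  obtain ⟨hsd, hsum⟩ := conn_sum conn Finset.univ (s := σ) (x := x) fun j _ => hσ j
  have hev : ∀ᶠ z in nhds x, s z = ∑ j, σ j z := by
    filter_upwards [(chartAt (EuclideanHalfSpace 2) x₀).open_source.mem_nhds hx,
      (trivializationAt F E x₀).open_baseSet.mem_nhds hy.2] with z hz hz'
    have h1 := constSec_locRep (mem_locDom_of_mem (E := E) hz hz') s
    rw [(extChartAt (𝓡∂ 2) x₀).left_inv (by rwa [extChartAt_source]),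
      ← b.sum_repr (locRep F x₀ s (extChartAt (𝓡∂ 2) x₀ z))] at h1
    rw [← h1, constSec, map_sum]
    refine Finset.sum_congr rfl fun j _ => ?_
    rw [← Complex.coe_smul, map_smul, Complex.coe_smul]
    rfl
  have hcg : conn s x = ∑ j, conn (σ j) x := by
    rw [← hsum]
    exact conn.isCovariantDerivativeOnUniv.congr_of_eventuallyEq
      (secDiffAt_of_differentiableAt hy hs) hsd Filter.univ_mem hev
  have h1 : locRep F x₀ (component x₀ a (conn s)) y =
      ∑ j, (L j (locRep F x₀ s y) • connForm conn x₀ a y (b j) +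
        L j (fderiv ℝ (locRep F x₀ s) y a) • b j) := by
    simp only [locRep, component]
    rw [← hxdef, hcg, sum_apply, map_sum]
    refine Finset.sum_congr rfl fun j _ => ?_
    have h2 := congrArg (fun T => T (coordVec x₀ a x)) (hleib j)
    have h3 : (mvfderiv (𝓡∂ 2) (θ j) x) (coordVec x₀ a x) = L j (fderiv ℝ (locRep F x₀ s) y a) := by
      have h4 := mfderiv_comp_extChartAt hx (hLd j) a
      rw [hyy] at h4
      have h5 : fderiv ℝ (fun z => L j (locRep F x₀ s z)) y a = L j (fderiv ℝ (locRep F x₀ s) y a) := by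
        exact congrArg (fun T => T a) ((L j).hasFDerivAt.comp y hs.hasFDerivAt).fderiv
      rw [h5] at h4
      exact h4
    have h6 : θ j x = L j (locRep F x₀ s y) := by simp only [θ, hyy]
    have h7 : (conn (σ j) x) (coordVec x₀ a x) =
        L j (locRep F x₀ s y) • conn (constSec F E x₀ (b j)) x (coordVec x₀ a x) +
        L j (fderiv ℝ (locRep F x₀ s) y a) • constSec F E x₀ (b j) x := by
      rw [← h3, ← h6]
      exact h2
    rw [h7, map_add, ← Complex.coe_smul, ← Complex.coe_smul, map_smul, map_smul]
    have h8 := locRep_constSec hy (b j)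
    rw [locRep] at h8
    rw [← hxdef] at h8
    rw [h8, Complex.coe_smul, Complex.coe_smul]
    rfl
  rw [h1, Finset.sum_add_distrib, add_comm]
  congr 1
  · exact b.sum_repr _
  · simp [connOp, opOf, L, b]

end BundleCoordinates

end DiracSurface

end

/-! ### Changes of chart and of trivialization. -/

noncomputable section

namespace DiracSurface

section ChartChanges

set_option linter.unusedSectionVars false

variable {M : Type*} [TopologicalSpace M] [ChartedSpace (EuclideanHalfSpace 2) M]
  [IsManifold (𝓡∂ 2) ∞ M]
  {F : Type*} [NormedAddCommGroup F] [NormedSpace ℂ F]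
  {E : M → Type*} [∀ x, AddCommGroup (E x)] [∀ x, Module ℂ (E x)]
  [∀ x, TopologicalSpace (E x)] [∀ x, IsTopologicalAddGroup (E x)] [∀ x, ContinuousSMul ℂ (E x)]
  [TopologicalSpace (TotalSpace F E)] [FiberBundle F E] [VectorBundle ℂ F E]
  [FiniteDimensional ℂ F] [VectorBundle ℝ F E] [ContMDiffVectorBundle ∞ F E (𝓡∂ 2)]

variable (F E) in
/-- The open set on which both the chart and the trivialization at `x₁` are defined. -/
def bundleDom (x₁ : M) : Set M :=
  (chartAt (EuclideanHalfSpace 2) x₁).source ∩ (trivializationAt F E x₁).baseSet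

theorem isOpen_bundleDom (x₁ : M) : IsOpen (bundleDom F E x₁) :=
  (chartAt (EuclideanHalfSpace 2) x₁).open_source.inter (trivializationAt F E x₁).open_baseSet

theorem mem_bundleDom (x₁ : M) : x₁ ∈ bundleDom F E x₁ :=
  ⟨mem_chart_source _ x₁, FiberBundle.mem_baseSet_trivializationAt F E x₁⟩

theorem symm_mem_bundleDom {x₀ : M} {y : Plane} (hy : y ∈ locDom F E x₀) :
    (extChartAt (𝓡∂ 2) x₀).symm y ∈ bundleDom F E x₀ := ⟨symm_mem_source hy.1, hy.2⟩

theorem extChartAt_mem_locDom {x₀ x : M} (hx : x ∈ bundleDom F E x₀) :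
    extChartAt (𝓡∂ 2) x₀ x ∈ locDom F E x₀ := mem_locDom_of_mem hx.1 hx.2

theorem extChartAt_left_inv {x₀ x : M} (hx : x ∈ bundleDom F E x₀) :
    (extChartAt (𝓡∂ 2) x₀).symm (extChartAt (𝓡∂ 2) x₀ x) = x :=
  (extChartAt (𝓡∂ 2) x₀).left_inv (by rw [extChartAt_source]; exact hx.1)

variable (F E) in
/-- The interior points in the chart at `x₀` that are in the domain of the chart at `x₁`. -/
def overlap (x₀ x₁ : M) : Set Plane :=
  interior (locDom F E x₀) ∩ (extChartAt (𝓡∂ 2) x₀).symm ⁻¹' bundleDom F E x₁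

/-- The coordinate change. -/
def chartChange (x₀ x₁ : M) (y : Plane) : Plane :=
  extChartAt (𝓡∂ 2) x₁ ((extChartAt (𝓡∂ 2) x₀).symm y)

theorem isOpen_overlap (x₀ x₁ : M) : IsOpen (overlap F E x₀ x₁) := by
  refine ContinuousOn.isOpen_inter_preimage ?_ isOpen_interior (isOpen_bundleDom x₁)
  exact (continuousOn_extChartAt_symm x₀).mono (interior_subset.trans (locDom_subset x₀))

theorem contDiffOn_chartChange (x₀ x₁ : M) : ContDiffOn ℝ ∞ (chartChange x₀ x₁)
    (locDom F E x₀ ∩ (extChartAt (𝓡∂ 2) x₀).symm ⁻¹' bundleDom F E x₁) := by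
  refine (contDiffOn_ext_coord_change (I := 𝓡∂ 2) (n := ∞) x₁ x₀).mono fun y hy => ?_
  rw [PartialEquiv.trans_source, PartialEquiv.symm_source]
  refine ⟨hy.1.1, ?_⟩
  rw [Set.mem_preimage, extChartAt_source]
  exact hy.2.1

theorem chartChange_mem {x₀ x₁ : M} {y : Plane} (hy : y ∈ locDom F E x₀)
    (hy' : (extChartAt (𝓡∂ 2) x₀).symm y ∈ bundleDom F E x₁) :
    chartChange x₀ x₁ y ∈ locDom F E x₁ ∧
      (extChartAt (𝓡∂ 2) x₁).symm (chartChange x₀ x₁ y) = (extChartAt (𝓡∂ 2) x₀).symm y ∧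
      chartChange x₁ x₀ (chartChange x₀ x₁ y) = y := by
  have h := extChartAt_left_inv hy'
  refine ⟨extChartAt_mem_locDom hy', h, ?_⟩
  rw [chartChange, chartChange, h, extChartAt_symm_eq hy]

theorem chartChange_mem_overlap {x₀ x₁ : M} {y : Plane} (hy : y ∈ overlap F E x₀ x₁) :
    chartChange x₀ x₁ y ∈ overlap F E x₁ x₀ := by
  have h0 := interior_subset hy.1
  obtain ⟨h1, h2, -⟩ := chartChange_mem h0 hy.2
  refine ⟨mem_interior_locDom h1 ?_, ?_⟩
  · refine mem_interior_target_of_mem (symm_mem_source h0.1) hy.2.1 ?_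
    rw [extChartAt_symm_eq h0]
    exact interior_mono (locDom_subset x₀) hy.1
  · rw [Set.mem_preimage, h2]
    exact symm_mem_bundleDom h0

variable (F E) in
/-- The coordinate change as a diffeomorphism. -/
def chartDiffeo (x₀ x₁ : M) : PlaneDiffeo (overlap F E x₀ x₁) (overlap F E x₁ x₀) where
  map := chartChange x₀ x₁
  inv := chartChange x₁ x₀
  isOpen_source := isOpen_overlap x₀ x₁
  isOpen_target := isOpen_overlap x₁ x₀
  map_contDiffOn := ((contDiffOn_chartChange (F := F) (E := E) x₀ x₁).mono fun _ hy =>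
    ⟨interior_subset hy.1, hy.2⟩).of_le ENat.LEInfty.out
  inv_contDiffOn := ((contDiffOn_chartChange (F := F) (E := E) x₁ x₀).mono fun _ hy =>
    ⟨interior_subset hy.1, hy.2⟩).of_le ENat.LEInfty.out
  mapsTo := fun _ hy => chartChange_mem_overlap hy
  inv_mapsTo := fun _ hy => chartChange_mem_overlap hy
  left_inv := fun _ hy => (chartChange_mem (interior_subset hy.1) hy.2).2.2
  right_inv := fun _ hy => (chartChange_mem (interior_subset hy.1) hy.2).2.2

/-- The Jacobian of the coordinate change is the change of coordinates of tangent vectors. This ties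
the plane chain rule to the components of forms on the surface. -/
theorem fderiv_chartChange {x₀ x₁ : M} {y : Plane} (hy : y ∈ overlap F E x₀ x₁) (a : Plane) :
    fderiv ℝ (chartChange x₀ x₁) y a = tangentCoord x₁ ((extChartAt (𝓡∂ 2) x₀).symm y)
      (coordVec x₀ a _) := by
  have h0 := interior_subset hy.1
  have hx := symm_mem_source h0.1
  have hyy := extChartAt_symm_eq h0
  set x := (extChartAt (𝓡∂ 2) x₀).symm y with hxdef
  have hd : DifferentiableAt ℝ (chartChange x₀ x₁) (extChartAt (𝓡∂ 2) x₀ x) := by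
    rw [hyy]
    exact ((chartDiffeo F E x₀ x₁).map_contDiffOn.contDiffAt
      ((isOpen_overlap x₀ x₁).mem_nhds hy)).differentiableAt (by simp)
  have h1 := mfderiv_comp_extChartAt hx hd a
  rw [hyy] at h1
  rw [← h1]
  have h2 : (fun z => chartChange x₀ x₁ (extChartAt (𝓡∂ 2) x₀ z)) =ᶠ[nhds x]
      extChartAt (𝓡∂ 2) x₁ := by
    filter_upwards [(chartAt (EuclideanHalfSpace 2) x₀).open_source.mem_nhds hx] with z hz
    rw [chartChange, (extChartAt (𝓡∂ 2) x₀).left_inv (by rwa [extChartAt_source])]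
  have h3 := mfderiv_extChartAt (x₀ := x₁) (x := x) hy.2.1
  have h4 := h2.mfderiv_eq (I := 𝓡∂ 2) (I' := 𝓘(ℝ, Plane))
  exact (congrArg (fun T : Plane →L[ℝ] Plane => T (coordVec x₀ a x)) h4).trans
    (congrArg (fun T : Plane →L[ℝ] Plane => T (coordVec x₀ a x)) h3)

/-- The change of trivialization, applied to a fixed vector, is smooth in the chart. -/
theorem contDiffOn_locRep_constSec (x₀ x₁ : M) (f : F) :
    ContDiffOn ℝ ∞ (locRep F x₀ (constSec F E x₁ f))
      (locDom F E x₀ ∩ (extChartAt (𝓡∂ 2) x₀).symm ⁻¹' bundleDom F E x₁) := by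
  have h := (contMDiffOn_coordChangeL (n := ∞) (𝕜 := ℝ) (IB := 𝓡∂ 2) (trivializationAt F E x₁)
    (trivializationAt F E x₀)).clm_apply (contMDiffOn_const (c := f))
  have h2 := h.comp ((contMDiffOn_extChartAt_symm (I := 𝓡∂ 2) (n := ∞) x₀).mono
    (s := (extChartAt (𝓡∂ 2) x₀).target)
    (t := locDom F E x₀ ∩ (extChartAt (𝓡∂ 2) x₀).symm ⁻¹' bundleDom F E x₁)
    (Set.inter_subset_left.trans (locDom_subset x₀))) fun y hy => ⟨hy.2.2, hy.1.2⟩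
  refine (contMDiffOn_iff_contDiffOn.1 h2).congr fun y hy => ?_
  rw [locRep, constSec, Trivialization.continuousLinearMapAt_apply_of_mem ℂ _ hy.1.2,
    Trivialization.symmL_apply _ hy.2.2]
  exact (Trivialization.coordChangeL_apply _ _ ⟨hy.2.2, hy.1.2⟩ f).symm

/-- The change of trivialization from `x₁` to `x₀` in the chart at `x₀`. -/
def gaugeOp (x₀ x₁ : M) (y : Plane) : F →L[ℝ] F :=
  (((trivializationAt F E x₀).continuousLinearMapAt ℂ ((extChartAt (𝓡∂ 2) x₀).symm y)).comp
    ((trivializationAt F E x₁).symmL ℂ _)).restrictScalars ℝ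

theorem gaugeOp_apply (x₀ x₁ : M) (y : Plane) (f : F) :
    gaugeOp (E := E) x₀ x₁ y f = locRep F x₀ (constSec F E x₁ f) y := rfl

theorem contDiffOn_gaugeOp (x₀ x₁ : M) : ContDiffOn ℝ ∞ (gaugeOp (F := F) (E := E) x₀ x₁)
    (locDom F E x₀ ∩ (extChartAt (𝓡∂ 2) x₀).symm ⁻¹' bundleDom F E x₁) :=
  contDiffOn_of_apply fun f => contDiffOn_locRep_constSec x₀ x₁ f

theorem gaugeOp_locRep {x₀ x₁ : M} {y : Plane} (hy : y ∈ locDom F E x₀)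
    (hy' : (extChartAt (𝓡∂ 2) x₀).symm y ∈ bundleDom F E x₁) (u : ∀ x, E x) :
    gaugeOp (E := E) x₀ x₁ y (locRep F x₁ u (chartChange x₀ x₁ y)) = locRep F x₀ u y := by
  obtain ⟨h1, h2, -⟩ := chartChange_mem hy hy'
  rw [gaugeOp_apply]
  refine locRep_congr ?_
  have := constSec_locRep h1 u
  rwa [h2] at this

theorem locRep_component_sum (x₁ : M) (w : FormField E) (z : Plane) (a : Plane) :
    ∑ i, a i • locRep F x₁ (component x₁ (stdVec i) w) z =
      locRep F x₁ (component x₁ a w) z := by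
  have h : component x₁ a w ((extChartAt (𝓡∂ 2) x₁).symm z) =
      ∑ i, a i • component x₁ (stdVec i) w ((extChartAt (𝓡∂ 2) x₁).symm z) := by
    simp only [component]
    conv_lhs => rw [plane_eq_sum a, coordVec_add, coordVec_smul, coordVec_smul, map_add, map_smul,
      map_smul]
    rw [Fin.sum_univ_two]
  have h2 : locRep F x₁ (component x₁ a w) z = (trivializationAt F E x₁).continuousLinearMapAt ℂ
      ((extChartAt (𝓡∂ 2) x₁).symm z) (component x₁ a w _) := rfl
  rw [h2, h, map_sum]
  refine Finset.sum_congr rfl fun i _ => ?_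
  rw [← Complex.coe_smul, ← Complex.coe_smul, map_smul]
  rfl

/-- Transformation law of an E-valued form under a change of both chart and trivialization; the left
side has the shape that the weak chain rule produces. -/
theorem gaugeOp_component {x₀ x₁ : M} {y : Plane} (hy : y ∈ overlap F E x₀ x₁) (w : FormField E)
    (a : Plane) :
    gaugeOp (E := E) x₀ x₁ y (∑ i, (fderiv ℝ (chartChange x₀ x₁) y a) i •
      locRep F x₁ (component x₁ (stdVec i) w) (chartChange x₀ x₁ y)) =
      locRep F x₀ (component x₀ a w) y := by
  have h0 := interior_subset hy.1
  rw [locRep_component_sum, gaugeOp_locRep h0 hy.2]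
  refine locRep_congr ?_
  rw [component, fderiv_chartChange hy, coordVec_tangentCoord hy.2.1, component]

/-- Weak covariant derivatives do not depend on the chart and the trivialization. -/
theorem hasWeakDeriv_overlap (conn : CovariantDerivative (𝓡∂ 2) F E) (x₀ x₁ : M) {u : ∀ x, E x}
    {w : FormField E}
    (h : ∀ i, HasWeakDeriv (interior (locDom F E x₁)) (stdVec i) (locRep F x₁ u)
      (fun y => locRep F x₁ (component x₁ (stdVec i) w) y -
        connForm conn x₁ (stdVec i) y (locRep F x₁ u y))) (a : Plane) :
    HasWeakDeriv (overlap F E x₀ x₁) a (locRep F x₀ u)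
      (fun y => locRep F x₀ (component x₀ a w) y - connForm conn x₀ a y (locRep F x₀ u y)) := by
  have hO := isOpen_overlap (F := F) (E := E) x₀ x₁
  have hG : ContDiffOn ℝ 1 (gaugeOp (F := F) (E := E) x₀ x₁) (overlap F E x₀ x₁) :=
    ((contDiffOn_gaugeOp x₀ x₁).mono fun y hy => ⟨interior_subset hy.1, hy.2⟩).of_le (by simp)
  have h1 := (HasWeakDeriv.comp_diffeo (chartDiffeo F E x₀ x₁) (fun i => (h i).mono
    (Set.inter_subset_left)) a).clm_apply hO hG
  refine h1.congr_ae hO.measurableSet (Filter.Eventually.of_forall fun y hy => ?_)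
    (Filter.Eventually.of_forall fun y hy => ?_)
  · exact gaugeOp_locRep (interior_subset hy.1) hy.2 u
  · have h0 := interior_subset hy.1
    set f := locRep F x₁ u (chartChange x₀ x₁ y) with hf
    have hf' : gaugeOp (E := E) x₀ x₁ y f = locRep F x₀ u y := gaugeOp_locRep h0 hy.2 u
    have hs : DifferentiableAt ℝ (gaugeOp (F := F) (E := E) x₀ x₁) y :=
      (hG.contDiffAt (hO.mem_nhds hy)).differentiableAt (by simp)
    have hs' : HasFDerivAt (locRep F x₀ (constSec F E x₁ f))
        ((fderiv ℝ (gaugeOp (F := F) (E := E) x₀ x₁) y).flip f) y := by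
      have := hs.hasFDerivAt.clm_apply (hasFDerivAt_const f y)
      rw [ContinuousLinearMap.comp_zero, zero_add] at this
      exact this
    -- With f frozen at the value of u in the trivialization at x₁, the derivative of the gauge
    -- transformation is obtained from the covariant derivative of a section constant there. This is
    -- the transformation law of the connection form.
    have h2 := locRep_conn conn h0 hs'.differentiableAt a
    rw [hs'.fderiv, connOp_apply conn h0, ← gaugeOp_apply, hf'] at h2
    have h3 := gaugeOp_component hy w a
    have h4 := gaugeOp_component hy (conn (constSec F E x₁ f)) a
    change fderiv ℝ (gaugeOp (F := F) (E := E) x₀ x₁) y a f + gaugeOp (E := E) x₀ x₁ y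
      (∑ i, (fderiv ℝ (chartChange x₀ x₁) y a) i •
        (locRep F x₁ (component x₁ (stdVec i) w) (chartChange x₀ x₁ y) -
          locRep F x₁ (component x₁ (stdVec i) (conn (constSec F E x₁ f))) (chartChange x₀ x₁ y))) = _
    simp only [smul_sub, Finset.sum_sub_distrib, map_sub]
    rw [h3, h4, h2, ContinuousLinearMap.flip_apply]
    abel

end ChartChanges

end DiracSurface

end

/-! ### Global weak covariant derivatives: uniqueness and existence. -/

noncomputable section

namespace DiracSurface

section WeakCovariantDerivative

set_option linter.unusedSectionVars false

variable {M : Type*} [TopologicalSpace M] [SecondCountableTopology M]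
  [ChartedSpace (EuclideanHalfSpace 2) M]
  [IsManifold (𝓡∂ 2) ∞ M]
  {F : Type*} [NormedAddCommGroup F] [NormedSpace ℂ F]
  {E : M → Type*} [∀ x, AddCommGroup (E x)] [∀ x, Module ℂ (E x)]
  [∀ x, TopologicalSpace (E x)] [∀ x, IsTopologicalAddGroup (E x)] [∀ x, ContinuousSMul ℂ (E x)]
  [TopologicalSpace (TotalSpace F E)] [FiberBundle F E] [VectorBundle ℂ F E]
  [FiniteDimensional ℂ F] [VectorBundle ℝ F E] [ContMDiffVectorBundle ∞ F E (𝓡∂ 2)]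

variable (F E) in
-- Second countability reduces the atlas to countably many local domains, so that exceptional null
-- sets can be united; κ selects for each point a domain containing it.
theorem exists_countable_cover : ∃ S : Set M, S.Countable ∧
    ∃ κ : M → M, ∀ x, κ x ∈ S ∧ x ∈ bundleDom F E (κ x) := by
  obtain ⟨S, hS, hc⟩ := TopologicalSpace.countable_cover_nhds (f := bundleDom F E)
    fun x : M => (isOpen_bundleDom x).mem_nhds (mem_bundleDom x)
  refine ⟨S, hS, ?_⟩
  have : ∀ x : M, ∃ k, k ∈ S ∧ x ∈ bundleDom F E k := fun x => by
    have hx : x ∈ ⋃ k ∈ S, bundleDom F E k := hc ▸ Set.mem_univ x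
    simpa using hx
  choose κ hκ using this
  exact ⟨κ, hκ⟩

variable (F E) in
/-- A property that holds almost everywhere in each local domain holds almost everywhere. -/
theorem aeOnSurface_of_locDom {P : M → Prop}
    (h : ∀ x₀ : M, ∀ᵐ y : Plane, y ∈ interior (locDom F E x₀) → P ((extChartAt (𝓡∂ 2) x₀).symm y)) :
    AEOnSurface P := by
  intro x₀
  obtain ⟨S, hS, κ, hκ⟩ := exists_countable_cover F E
  -- `N k` is the exceptional set seen in the chart at k, restricted to points which the chart at x₀
  -- also covers.
  let N : M → Set Plane := fun k => {z | z ∈ locDom F E k ∩ (extChartAt (𝓡∂ 2) k).symm ⁻¹'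
    (chartAt (EuclideanHalfSpace 2) x₀).source ∧ ¬ P ((extChartAt (𝓡∂ 2) k).symm z)}
  have hN : ∀ k, volume (N k) = 0 := fun k => by
    refine measure_mono_null (fun z hz => ?_) (ae_iff.1 ((isHalfOpen_locDom k).ae_interior (h k)))
    simp only [Set.mem_ofPred_eq, not_forall]
    exact ⟨hz.1.1, hz.2⟩
  have hd : ∀ k, DifferentiableOn ℝ (chartChange k x₀) (N k) := fun k => by
    refine ((contDiffOn_ext_coord_change (I := 𝓡∂ 2) (n := ∞) x₀ k).differentiableOn
      (by simp)).mono fun z hz => ?_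
    rw [PartialEquiv.trans_source, PartialEquiv.symm_source]
    refine ⟨hz.1.1.1, ?_⟩
    rw [Set.mem_preimage, extChartAt_source]
    exact hz.1.2
  -- Coordinate changes are differentiable up to the boundary and hence carry null sets to null
  -- sets.
  have hI : volume (⋃ k ∈ S, chartChange k x₀ '' N k) = 0 :=
    (measure_biUnion_null_iff hS).2 fun k _ =>
      addHaar_image_eq_zero_of_differentiableOn_of_addHaar_eq_zero _ (hd k) (hN k)
  rw [ae_iff]
  refine measure_mono_null (fun y hy => ?_) hI
  simp only [Set.mem_ofPred_eq, Classical.not_imp] at hy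
  obtain ⟨hy, hP⟩ := hy
  set x := (extChartAt (𝓡∂ 2) x₀).symm y with hx
  obtain ⟨h1, h2⟩ := hκ x
  refine Set.mem_biUnion h1 ⟨extChartAt (𝓡∂ 2) (κ x) x, ⟨⟨extChartAt_mem_locDom h2, ?_⟩, ?_⟩, ?_⟩
  · rw [Set.mem_preimage, extChartAt_left_inv h2]
    exact symm_mem_source hy
  · rwa [extChartAt_left_inv h2]
  · rw [chartChange, extChartAt_left_inv h2]
    exact (extChartAt (𝓡∂ 2) x₀).right_inv hy

theorem form_ext {x₀ : M} {y : Plane} (hy : y ∈ locDom F E x₀) {w w' : FormField E}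
    (h : ∀ i, locRep F x₀ (component x₀ (stdVec i) w) y =
      locRep F x₀ (component x₀ (stdVec i) w') y) :
    w ((extChartAt (𝓡∂ 2) x₀).symm y) = w' _ := by
  ext v
  have h1 : ∀ a, locRep F x₀ (component x₀ a w) y = locRep F x₀ (component x₀ a w') y := by
    intro a
    rw [← locRep_component_sum, ← locRep_component_sum]
    exact Finset.sum_congr rfl fun i _ => by rw [h i]
  have h2 := eq_of_locRep_eq hy (h1 (tangentCoord x₀ _ v))
  rwa [component, component, coordVec_tangentCoord (symm_mem_source hy.1)] at h2

/-- Weak covariant derivatives are unique. -/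
theorem HasWeakCov.ae_unique {conn : CovariantDerivative (𝓡∂ 2) F E} {u : ∀ x, E x}
    {w w' : FormField E} (h : HasWeakCov conn u w) (h' : HasWeakCov conn u w') :
    AEOnSurface fun x => w x = w' x := by
  refine aeOnSurface_of_locDom F E fun x₀ => ?_
  have h1 : ∀ᵐ y : Plane, ∀ i, y ∈ interior (locDom F E x₀) →
      locRep F x₀ (component x₀ (stdVec i) w) y = locRep F x₀ (component x₀ (stdVec i) w') y := by
    rw [ae_all_iff]
    intro i
    filter_upwards [HasWeakDeriv.ae_unique isOpen_interior (h x₀ (stdVec i)) (h' x₀ (stdVec i))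
      (Filter.Eventually.of_forall fun _ _ => rfl)] with y hy hy'
    simpa using hy hy'
  filter_upwards [h1] with y hy hy'
  exact form_ext (interior_subset hy') fun i => hy i hy'

/-- The form with prescribed components `f i` in the chart at `x₁`. -/
def formOfComponents (x₁ : M) (f : Fin 2 → Plane → F) : FormField E := fun x =>
  ∑ i, ((EuclideanSpace.proj (𝕜 := ℝ) i).comp (tangentCoord x₁ x)).smulRight
    (constSec F E x₁ (f i (extChartAt (𝓡∂ 2) x₁ x)) x)

theorem locRep_formOfComponents {x₁ : M} (f : Fin 2 → Plane → F) {y : Plane}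
    (hy : y ∈ locDom F E x₁) (i : Fin 2) :
    locRep F x₁ (component x₁ (stdVec i) (formOfComponents (E := E) x₁ f)) y = f i y := by
  have h : component x₁ (stdVec i) (formOfComponents (E := E) x₁ f)
      ((extChartAt (𝓡∂ 2) x₁).symm y) = constSec F E x₁ (f i y) _ := by
    rw [component, formOfComponents, sum_apply]
    refine (Finset.sum_eq_single i (fun j _ hj => ?_) (by simp)).trans ?_ <;>
      rw [ContinuousLinearMap.smulRight_apply, ContinuousLinearMap.comp_apply,
        tangentCoord_coordVec (symm_mem_source hy.1), extChartAt_symm_eq hy]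
    · rw [show (EuclideanSpace.proj (𝕜 := ℝ) j) (stdVec i) = 0 by simp [stdVec, hj], zero_smul]
    · rw [show (EuclideanSpace.proj (𝕜 := ℝ) i) (stdVec i) = 1 by simp [stdVec], one_smul]
  rw [locRep_congr (v := constSec F E x₁ (f i y)) h, locRep_constSec hy]

/-- A section of class `H¹` has a weak covariant derivative. -/
theorem exists_hasWeakCov (conn : CovariantDerivative (𝓡∂ 2) F E)
    {u : ∀ x, E x} (hu : SecH1 F u) :
    ∃ w, HasWeakCov conn u w := by
  have h0 : ∀ x₀ : M, ∃ f' : Fin 2 → Plane → F, ∀ i,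
      HasWeakDeriv (interior (locDom F E x₀)) (stdVec i) (locRep F x₀ u) (f' i) := fun x₀ => by
    have := ((memSobolevLoc_one_iff).1 (hu x₀)).2
    choose f' hf' using this
    exact ⟨f', fun i => (hf' i).1⟩
  choose f' hf' using h0
  obtain ⟨S, hS, κ, hκ⟩ := exists_countable_cover F E
  -- In the chart at k the covariant derivative must have components ∂_i u + A_i u, with any chosen
  -- weak derivatives of u.
  let wk : M → FormField E := fun k => formOfComponents k fun i y =>
    f' k i y + connForm conn k (stdVec i) y (locRep F k u y)
  have hwk : ∀ k i, HasWeakDeriv (interior (locDom F E k)) (stdVec i) (locRep F k u)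
      (fun y => locRep F k (component k (stdVec i) (wk k)) y -
        connForm conn k (stdVec i) y (locRep F k u y)) := by
    intro k i
    refine (hf' k i).congr_ae isOpen_interior.measurableSet
      (Filter.Eventually.of_forall fun _ _ => rfl) (Filter.Eventually.of_forall fun y hy => ?_)
    rw [locRep_formOfComponents _ (interior_subset hy), add_sub_cancel_right]
  refine ⟨fun x => wk (κ x) x, fun x₀ a => ?_⟩
  refine (HasWeakDeriv.of_stdVec (hf' x₀) a).congr_ae isOpen_interior.measurableSet
      (Filter.Eventually.of_forall fun _ _ => rfl) ?_
  -- On each overlap the form built in the chart at k has the correct components in the chart at x₀,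
  -- almost everywhere. Since k runs through a countable set this holds for all k at once, so it
  -- does not matter which chart κ selects and κ needs no regularity.
  have h1 : ∀ k ∈ S, ∀ᵐ y : Plane, y ∈ overlap F E x₀ k → ∑ i, a i • f' x₀ i y =
      locRep F x₀ (component x₀ a (wk k)) y - connForm conn x₀ a y (locRep F x₀ u y) := fun k _ =>
    HasWeakDeriv.ae_unique (isOpen_overlap x₀ k)
      ((HasWeakDeriv.of_stdVec (hf' x₀) a).mono Set.inter_subset_left)
      (hasWeakDeriv_overlap conn x₀ k (hwk k) a) (Filter.Eventually.of_forall fun _ _ => rfl)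
  filter_upwards [(ae_ball_iff hS).2 h1] with y hy hy'
  obtain ⟨h2, h3⟩ := hκ ((extChartAt (𝓡∂ 2) x₀).symm y)
  rw [hy _ h2 ⟨hy', h3⟩]
  rfl

end WeakCovariantDerivative

end DiracSurface

end

/-! ### Clifford multiplication and chirality in coordinates; covariant derivatives of operators. -/

noncomputable section

namespace DiracSurface

section CliffordRegularity

set_option linter.unusedSectionVars false

variable {M : Type*} [TopologicalSpace M]
  [ChartedSpace (EuclideanHalfSpace 2) M]
  [IsManifold (𝓡∂ 2) ∞ M]
  {F : Type*} [NormedAddCommGroup F] [NormedSpace ℂ F]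
  {E : M → Type*} [∀ x, AddCommGroup (E x)] [∀ x, Module ℂ (E x)]
  [∀ x, TopologicalSpace (E x)] [∀ x, IsTopologicalAddGroup (E x)] [∀ x, ContinuousSMul ℂ (E x)]
  [TopologicalSpace (TotalSpace F E)] [FiberBundle F E] [VectorBundle ℂ F E]
  [FiniteDimensional ℂ F] [VectorBundle ℝ F E] [ContMDiffVectorBundle ∞ F E (𝓡∂ 2)]
  {g : SurfaceMetric M} {c : ComplexStructure M} (D : DiracBundle F E g)

theorem locMap_mul {x₀ : M} {y : Plane} (hy : y ∈ locDom F E x₀) (S T : ∀ x, E x →L[ℂ] E x) :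
    locMap (F := F) x₀ S y * locMap x₀ T y = locMap x₀ (fun x => (S x).comp (T x)) y := by
  ext f
  exact locMap_comp hy S T f

/-- The covariant derivative `∂_a T + [A(a), T]` of an operator `T` in a chart. -/
def covOp (conn : CovariantDerivative (𝓡∂ 2) F E) (x₀ : M) (a : Plane) (T : Plane → F →L[ℝ] F)
    (y : Plane) : F →L[ℝ] F :=
  fderiv ℝ T y a + connOp conn x₀ a y * T y - T y * connOp conn x₀ a y

theorem connOp_add_smul (conn : CovariantDerivative (𝓡∂ 2) F E) {x₀ : M} {y : Plane}
    (hy : y ∈ locDom F E x₀) (a : Plane) :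
    connOp conn x₀ a y = ∑ i, a i • connOp conn x₀ (stdVec i) y := by
  ext f
  rw [sum_apply, connOp_apply conn hy, connForm, ← locRep_component_sum]
  refine Finset.sum_congr rfl fun i _ => ?_
  rw [smul_apply, connOp_apply conn hy, connForm]

theorem covOp_of_stdVec (conn : CovariantDerivative (𝓡∂ 2) F E) {x₀ : M} {y : Plane}
    (hy : y ∈ locDom F E x₀) {T : Plane → F →L[ℝ] F} (h : ∀ i, covOp conn x₀ (stdVec i) T y = 0)
    (a : Plane) : covOp conn x₀ a T y = 0 := by
  have h1 : fderiv ℝ T y a = ∑ i, a i • fderiv ℝ T y (stdVec i) := by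
    conv_lhs => rw [plane_eq_sum a]
    rw [map_add, map_smul, map_smul, Fin.sum_univ_two]
  have h2 : covOp conn x₀ a T y = ∑ i, a i • covOp conn x₀ (stdVec i) T y := by
    simp only [covOp]
    rw [h1, connOp_add_smul conn hy a, Finset.sum_mul, Finset.mul_sum, ← Finset.sum_add_distrib,
      ← Finset.sum_sub_distrib]
    refine Finset.sum_congr rfl fun i _ => ?_
    rw [smul_mul_assoc, mul_smul_comm, smul_sub, smul_add]
  rw [h2]
  simp [h]

/-- `covOp` is a derivation: it is a directional derivative plus a commutator. -/
theorem covOp_mul (conn : CovariantDerivative (𝓡∂ 2) F E) (x₀ : M) (a : Plane) {y : Plane}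
    {S T : Plane → F →L[ℝ] F} (hS : DifferentiableAt ℝ S y) (hT : DifferentiableAt ℝ T y) :
    covOp conn x₀ a (fun z => S z * T z) y = covOp conn x₀ a S y * T y + S y * covOp conn x₀ a T y := by
  have h : fderiv ℝ (fun z => S z * T z) y a = S y * fderiv ℝ T y a + fderiv ℝ S y a * T y := by
    rw [fderiv_fun_mul' hS hT]; rfl
  simp only [covOp, h]
  noncomm_ring

theorem covOp_add (conn : CovariantDerivative (𝓡∂ 2) F E) (x₀ : M) (a : Plane) {y : Plane}
    {S T : Plane → F →L[ℝ] F} (hS : DifferentiableAt ℝ S y) (hT : DifferentiableAt ℝ T y) :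
    covOp conn x₀ a (fun z => S z + T z) y = covOp conn x₀ a S y + covOp conn x₀ a T y := by
  simp only [covOp, fderiv_fun_add hS hT, add_apply]
  noncomm_ring

theorem covOp_congr (conn : CovariantDerivative (𝓡∂ 2) F E) (x₀ : M) (a : Plane) {y : Plane}
    {S T : Plane → F →L[ℝ] F} (h : S =ᶠ[nhds y] T) : covOp conn x₀ a S y = covOp conn x₀ a T y := by
  simp only [covOp, h.fderiv_eq, h.self_of_nhds]

theorem covOp_real_const (conn : CovariantDerivative (𝓡∂ 2) F E) (x₀ : M) (a : Plane) (t : ℝ)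
    (y : Plane) : covOp conn x₀ a (fun _ => t • 1) y = 0 := by
  simp [covOp, fderiv_const_apply]

/-- Every 1-form is dual to a tangent vector. -/
theorem exists_metric_eq (hg : IsConformal g c) (x : M) (η : TangentSpace (𝓡∂ 2) x →L[ℝ] ℝ) :
    ∃ w, g.inner x w = η := by
  have hv := DiracBundle.tangentBasis_zero_ne_zero x
  set v := tangentBasis x 0
  refine ⟨(η v / g.inner x v v) • v + (η (c.J x v) / g.inner x v v) • c.J x v, ?_⟩
  ext z
  conv_rhs => rw [tangent_expansion hg x hv z]
  simp only [map_add, map_smul, add_apply, smul_apply, smul_eq_mul]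
  ring

namespace DiracBundle

/-- Clifford multiplication by `dx^j` in a chart and a trivialization. -/
def gammaOp (x₀ : M) (j : Fin 2) (y : Plane) : F →L[ℝ] F :=
  locMap x₀ (fun x => D.γ x (coordForm x₀ (EuclideanSpace.proj j) x)) y

/-- Clifford multiplication by a coordinate vector in a chart and a trivialization. -/
def clOp (x₀ : M) (a : Plane) (y : Plane) : F →L[ℝ] F :=
  locMap x₀ (fun x => D.cl x (coordVec x₀ a x)) y

variable (c) in
/-- The chirality operator in a chart and a trivialization. -/
def chirOp (x₀ : M) (y : Plane) : F →L[ℝ] F := locMap x₀ (D.chir c) y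

theorem coordForm_proj {x₀ x : M} (hx : x ∈ (chartAt (EuclideanHalfSpace 2) x₀).source)
    (η : TangentSpace (𝓡∂ 2) x →L[ℝ] ℝ) :
    η = ∑ j, η (coordVec x₀ (stdVec j) x) • coordForm x₀ (EuclideanSpace.proj j) x := by
  ext v
  rw [sum_apply]
  simp only [smul_apply, coordForm, ContinuousLinearMap.comp_apply, smul_eq_mul]
  conv_lhs => rw [← coordVec_tangentCoord hx v, plane_eq_sum (tangentCoord x₀ x v), coordVec_add,
    coordVec_smul, coordVec_smul, map_add, map_smul, map_smul]
  rw [Fin.sum_univ_two, smul_eq_mul, smul_eq_mul, mul_comm, mul_comm (tangentCoord x₀ x v 1)]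
  rfl

theorem clOp_eq {x₀ : M} {y : Plane} (hy : y ∈ locDom F E x₀) (a : Plane) :
    D.clOp x₀ a y = ∑ j, g.inner ((extChartAt (𝓡∂ 2) x₀).symm y) (coordVec x₀ a _)
      (coordVec x₀ (stdVec j) _) • D.gammaOp x₀ j y := by
  ext f
  rw [sum_apply]
  simp only [smul_apply, clOp, gammaOp]
  have h : D.cl ((extChartAt (𝓡∂ 2) x₀).symm y) (coordVec x₀ a _) =
      ∑ j, g.inner ((extChartAt (𝓡∂ 2) x₀).symm y) (coordVec x₀ a _) (coordVec x₀ (stdVec j) _) •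
        D.γ _ (coordForm x₀ (EuclideanSpace.proj j) _) := by
    rw [cl]
    conv_lhs => rw [coordForm_proj (symm_mem_source hy.1) (g.inner _ (coordVec x₀ a _))]
    rw [map_sum]
    exact Finset.sum_congr rfl fun j _ => map_smul _ _ _
  rw [locMap_apply, locRep, h, sum_apply, map_sum]
  refine Finset.sum_congr rfl fun j _ => ?_
  rw [smul_apply, ← Complex.coe_smul, map_smul, Complex.coe_smul]
  rfl

variable (c) in
/-- The coefficients of `J ∂_0` in the chart at `x₀`. -/
def coordJ (x₀ : M) (y : Plane) : Plane :=
  tangentCoord x₀ ((extChartAt (𝓡∂ 2) x₀).symm y)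
    (c.J _ (coordVec x₀ (stdVec 0) ((extChartAt (𝓡∂ 2) x₀).symm y)))

theorem coordVec_coordJ {x₀ : M} {y : Plane} (hy : y ∈ locDom F E x₀) :
    coordVec x₀ (coordJ c x₀ y) ((extChartAt (𝓡∂ 2) x₀).symm y) =
      c.J _ (coordVec x₀ (stdVec 0) _) := coordVec_tangentCoord (symm_mem_source hy.1) _

theorem clOp_sum (x₀ : M) (a : Plane) (y : Plane) :
    D.clOp x₀ a y = ∑ i, a i • D.clOp x₀ (stdVec i) y := by
  ext f
  conv_lhs => rw [plane_eq_sum a]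
  rw [sum_apply, Fin.sum_univ_two]
  simp only [smul_apply, clOp, locMap_apply, locRep]
  rw [coordVec_add, coordVec_smul, coordVec_smul, cl_add, cl_smul, cl_smul]
  rw [add_apply, map_add, smul_apply, smul_apply, ← Complex.coe_smul, ← Complex.coe_smul, map_smul,
    map_smul, Complex.coe_smul, Complex.coe_smul]

variable (c) in
/-- The operator `-i` times the chirality operator. -/
def volOp (x₀ : M) (y : Plane) : F →L[ℝ] F :=
  (metricMatrix g x₀ y 0 0)⁻¹ • (D.clOp x₀ (stdVec 0) y * ∑ i, coordJ c x₀ y i • D.clOp x₀ (stdVec i) y)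

variable (F) in
/-- Multiplication by the imaginary unit. -/
def mulI : F →L[ℝ] F := (Complex.I • ContinuousLinearMap.id ℂ F).restrictScalars ℝ

/-- By `chir_eq` the field ∂_0 of the fixed chart may replace `tangentBasis`. Hence Γ is i times a
polynomial in the coefficients of γ with smooth coefficients, and inherits their regularity. -/
theorem chirOp_eq (hg : IsConformal g c) {x₀ : M} {y : Plane} (hy : y ∈ locDom F E x₀) :
    D.chirOp c x₀ y = mulI F * D.volOp c x₀ y := by
  ext f
  have hx := symm_mem_source hy.1
  rw [volOp, ← clOp_sum, chirOp, locMap_apply]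
  have h1 : D.chir c ((extChartAt (𝓡∂ 2) x₀).symm y) (constSec F E x₀ f _) =
      (Complex.I / ((metricMatrix g x₀ y 0 0 : ℝ) : ℂ)) • D.cl _ (coordVec x₀ (stdVec 0) _)
        (D.cl _ (coordVec x₀ (coordJ c x₀ y) _) (constSec F E x₀ f _)) := by
    rw [coordVec_coordJ hy, D.chir_eq hg _ (coordVec_ne_zero hx stdVec_zero_ne_zero)]
    rfl
  rw [locRep_congr (v := fun x => (Complex.I / ((metricMatrix g x₀ y 0 0 : ℝ) : ℂ)) •
    D.cl _ (coordVec x₀ (stdVec 0) x) (D.cl _ (coordVec x₀ (coordJ c x₀ y) x)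
      (constSec F E x₀ f x))) h1, locRep_smul]
  rw [locRep_map hy (fun x => D.cl _ (coordVec x₀ (stdVec 0) x)), div_eq_mul_inv, mul_smul,
    ← Complex.ofReal_inv, Complex.coe_smul]
  rfl

theorem chirOp_mul_self (hg : IsConformal g c) {x₀ : M} {y : Plane} (hy : y ∈ locDom F E x₀) :
    D.chirOp c x₀ y * D.chirOp c x₀ y = 1 := by
  ext f
  rw [chirOp, locMap_mul hy, locMap_apply]
  rw [locRep_congr (v := constSec F E x₀ f) (D.chir_chir hg _ _), locRep_constSec hy]
  rfl

theorem chirOp_mul_gammaOp (hg : IsConformal g c) {x₀ : M} {y : Plane} (hy : y ∈ locDom F E x₀)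
    (j : Fin 2) : D.chirOp c x₀ y * D.gammaOp x₀ j y = -(D.gammaOp x₀ j y * D.chirOp c x₀ y) := by
  ext f
  rw [neg_apply, chirOp, gammaOp, locMap_mul hy, locMap_mul hy, locMap_apply, locMap_apply]
  obtain ⟨v, hv⟩ := exists_metric_eq hg _ (coordForm x₀ (EuclideanSpace.proj j)
    ((extChartAt (𝓡∂ 2) x₀).symm y))
  have h := D.chir_cl hg _ v (constSec F E x₀ f ((extChartAt (𝓡∂ 2) x₀).symm y))
  rw [cl, hv] at h
  have h2 := congrArg ((trivializationAt F E x₀).continuousLinearMapAt ℂ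
    ((extChartAt (𝓡∂ 2) x₀).symm y)) h
  rw [map_neg] at h2
  exact h2

theorem mulI_mul_locMap (x₀ : M) (T : ∀ x, E x →L[ℂ] E x) (y : Plane) :
    mulI F * locMap x₀ T y = locMap x₀ T y * mulI F := by
  ext f
  exact (locMap_smul x₀ T y Complex.I f).symm

theorem mulI_mul_self : mulI F * mulI F = -1 := by
  ext f
  show Complex.I • Complex.I • f = -f
  rw [smul_smul, Complex.I_mul_I, neg_one_smul]

theorem volOp_eq (hg : IsConformal g c) {x₀ : M} {y : Plane} (hy : y ∈ locDom F E x₀) :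
    D.volOp c x₀ y = -(mulI F * D.chirOp c x₀ y) := by
  rw [D.chirOp_eq hg hy, ← mul_assoc, mulI_mul_self, neg_one_mul, neg_neg]

theorem volOp_mul_self (hg : IsConformal g c) {x₀ : M} {y : Plane} (hy : y ∈ locDom F E x₀) :
    D.volOp c x₀ y * D.volOp c x₀ y = -1 := by
  have h1 := D.chirOp_mul_self hg hy
  have h2 : mulI F * D.chirOp c x₀ y = D.chirOp c x₀ y * mulI F := mulI_mul_locMap x₀ _ y
  rw [D.volOp_eq hg hy, neg_mul_neg]
  calc mulI F * D.chirOp c x₀ y * (mulI F * D.chirOp c x₀ y)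
      = mulI F * (D.chirOp c x₀ y * mulI F) * D.chirOp c x₀ y := by noncomm_ring
    _ = (mulI F * mulI F) * (D.chirOp c x₀ y * D.chirOp c x₀ y) := by rw [← h2]; noncomm_ring
    _ = -1 := by rw [h1, mulI_mul_self, mul_one]

theorem volOp_mul_gammaOp (hg : IsConformal g c) {x₀ : M} {y : Plane} (hy : y ∈ locDom F E x₀)
    (j : Fin 2) : D.volOp c x₀ y * D.gammaOp x₀ j y = -(D.gammaOp x₀ j y * D.volOp c x₀ y) := by
  have h2 : mulI F * D.gammaOp x₀ j y = D.gammaOp x₀ j y * mulI F := mulI_mul_locMap x₀ _ y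
  rw [D.volOp_eq hg hy, neg_mul, mul_assoc, D.chirOp_mul_gammaOp hg hy, mul_neg, ← mul_assoc, h2,
    mul_neg, neg_neg, mul_assoc, neg_neg]

end DiracBundle

end CliffordRegularity

end DiracSurface

end

/-! ### Clifford multiplication gains one derivative, and the chirality operator is parallel. -/

noncomputable section

namespace DiracSurface

/-- Commuting and anticommuting together give 2CN = 0, and N is invertible because N² = −1. It is
applied to N = −iΓ and C = ∇N. -/
theorem eq_zero_of_anticommute {R : Type*} [Ring R] [Module ℝ R] {N C : R} (hN : N * N = -1)
    (h1 : C * N + N * C = 0) (h2 : C * N = N * C) : C = 0 := by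
  have h3 : (2 : ℝ) • (C * N) = 0 := by rw [two_smul]; nth_rw 2 [h2]; exact h1
  have h4 : C * N = 0 := (smul_eq_zero.1 h3).resolve_left two_ne_zero
  have h5 : C * N * N = 0 := by rw [h4, zero_mul]
  rw [mul_assoc, hN, mul_neg_one, neg_eq_zero] at h5
  exact h5

section Parallel

set_option linter.unusedSectionVars false

variable {M : Type*} [TopologicalSpace M]
  [ChartedSpace (EuclideanHalfSpace 2) M]
  [IsManifold (𝓡∂ 2) ∞ M]
  {F : Type*} [NormedAddCommGroup F] [NormedSpace ℂ F]
  {E : M → Type*} [∀ x, AddCommGroup (E x)] [∀ x, Module ℂ (E x)]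
  [∀ x, TopologicalSpace (E x)] [∀ x, IsTopologicalAddGroup (E x)] [∀ x, ContinuousSMul ℂ (E x)]
  [TopologicalSpace (TotalSpace F E)] [FiberBundle F E] [VectorBundle ℂ F E]
  [FiniteDimensional ℂ F] [VectorBundle ℝ F E] [ContMDiffVectorBundle ∞ F E (𝓡∂ 2)]
  {g : SurfaceMetric M} {c : ComplexStructure M} (D : DiracBundle F E g)

namespace DiracBundle

theorem formCoeff_coordForm {x₀ : M} {y : Plane} (hy : y ∈ (extChartAt (𝓡∂ 2) x₀).target)
    (ℓ : Plane →L[ℝ] ℝ) (k : Fin 2) : formCoeff x₀ (coordForm x₀ ℓ) k y = ℓ (stdVec k) := by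
  rw [formCoeff, coordForm, ContinuousLinearMap.comp_apply,
    tangentCoord_coordVec (symm_mem_source hy)]

theorem leviCivitaForm_coordForm {x₀ : M} {y : Plane} (hy : y ∈ (extChartAt (𝓡∂ 2) x₀).target)
    (i j : Fin 2) : leviCivitaForm g x₀ i (coordForm x₀ (EuclideanSpace.proj j))
      ((extChartAt (𝓡∂ 2) x₀).symm y) =
      ∑ k, (-christoffel g x₀ j i k y) • coordForm x₀ (EuclideanSpace.proj k) _ := by
  rw [leviCivitaForm]
  refine Finset.sum_congr rfl fun k _ => ?_
  rw [(extChartAt (𝓡∂ 2) x₀).right_inv hy]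
  congr 1
  have h1 : fderivWithin ℝ (formCoeff x₀ (coordForm x₀ (EuclideanSpace.proj j)) k)
      (extChartAt (𝓡∂ 2) x₀).target y = 0 := by
    rw [fderivWithin_congr (fun z hz => formCoeff_coordForm hz _ k) (formCoeff_coordForm hy _ k)]
    exact fderivWithin_const_apply _
  have h2 : ∀ m, formCoeff x₀ (coordForm x₀ (EuclideanSpace.proj (𝕜 := ℝ) j)) m y =
      if m = j then 1 else 0 := fun m => by
    rw [formCoeff_coordForm hy]
    simp [stdVec, eq_comm]
  rw [h1]
  simp [h2]

/-- The Clifford multiplication is weakly parallel. -/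
theorem hasWeakDeriv_gammaOp (x₀ : M) (j i : Fin 2) (f : F) :
    HasWeakDeriv (interior (locDom F E x₀)) (stdVec i) (fun y => D.gammaOp x₀ j y f)
      (fun y => -(∑ k, christoffel g x₀ j i k y • D.gammaOp x₀ k y f) +
        D.gammaOp x₀ j y (connForm D.conn x₀ (stdVec i) y f) -
        connOp D.conn x₀ (stdVec i) y (D.gammaOp x₀ j y f)) := by
  -- The compatibility is used for η = dx^j and a section constant in the trivialization; the
  -- resulting right side contains no derivative of γ.
  have h := D.γ_compat x₀ i (coordForm x₀ (EuclideanSpace.proj j)) (constSec F E x₀ f)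
    (fun k => contDiffOn_const.congr fun y hy => formCoeff_coordForm hy.1 _ k)
    (contDiffOn_const.congr fun y hy => locRep_constSec hy f)
  refine h.congr_ae isOpen_interior.measurableSet (Filter.Eventually.of_forall fun y hy => rfl)
    (Filter.Eventually.of_forall fun y hy => ?_)
  have hy' := interior_subset hy
  rw [connOp_apply D.conn hy']
  congr 1
  rw [locRep_add]
  congr 1
  · rw [locRep, leviCivitaForm_coordForm hy'.1, map_sum, sum_apply, map_sum,
      ← Finset.sum_neg_distrib]
    refine Finset.sum_congr rfl fun k _ => ?_
    rw [map_smul, smul_apply, ← Complex.coe_smul, map_smul, Complex.coe_smul, neg_smul]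
    rfl
  · exact locRep_map hy' (fun x => D.γ x (coordForm x₀ (EuclideanSpace.proj j) x)) _

variable {D} {r s p : ℝ}

section Regularity

theorem HasRegularity.memHolderLoc_connOp (hD : D.HasRegularity r s p) (x₀ : M) (a : Plane) :
    MemHolderLoc r (connOp D.conn x₀ a) (locDom F E x₀) :=
  MemHolderLoc.opOf (isHalfOpen_locDom x₀) fun f => (hD.1 x₀ a f).1

theorem HasRegularity.memHolderLoc_gammaOp_aux (hD : D.HasRegularity r s p) (x₀ : M) (j : Fin 2) :
    MemHolderLoc r (D.gammaOp x₀ j) (locDom F E x₀) :=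
  MemHolderLoc.of_apply (isHalfOpen_locDom x₀) fun f => (hD.2 x₀ (EuclideanSpace.proj j) f).1

theorem memHolderLoc_of_target {x₀ : M} {θ : Plane → ℝ}
    (hθ : ContDiffOn ℝ ∞ θ (extChartAt (𝓡∂ 2) x₀).target) (ρ : ℝ) :
    MemHolderLoc ρ θ (locDom F E x₀) :=
  (isHalfOpen_locDom x₀).memHolderLoc_of_smooth (hθ.mono (locDom_subset x₀)) ρ

/-- The Clifford multiplication is of class `C^{r+1}`. -/
theorem HasRegularity.memHolderLoc_gammaOp (hD : D.HasRegularity r s p) (hr : 0 ≤ r) (x₀ : M)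
    (j : Fin 2) : MemHolderLoc (r + 1) (D.gammaOp x₀ j) (locDom F E x₀) := by
  have hS := isHalfOpen_locDom (F := F) (E := E) x₀
  have hγ := fun k (f : F) => (hD.memHolderLoc_gammaOp_aux x₀ k).clm_apply hS (hS.memHolderLoc_const f)
  refine MemHolderLoc.of_apply hS fun f => ?_
  -- Every weak derivative is built from products of Christoffel symbols, connection forms and γ
  -- itself, all of class C^r, so one derivative is gained.
  refine hS.memHolderLoc_succ_of_hasWeakDeriv hr (hγ j f).continuousOn (fun i => ?_)
    (D.hasWeakDeriv_gammaOp x₀ j · f)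
  refine MemHolderLoc.sub hS (MemHolderLoc.add hS ?_ ?_) ?_
  · refine ((MemHolderLoc.sum hS Finset.univ fun k _ => MemHolderLoc.smul hS (memHolderLoc_of_target
      (contDiffOn_christoffel g x₀ j i k) r) (hγ k f)).clm_comp hS
      (-ContinuousLinearMap.id ℝ F)).congr fun y _ => ?_
    simp
  · exact (hD.memHolderLoc_gammaOp_aux x₀ j).clm_apply hS (hD.1 x₀ (stdVec i) f).1
  · exact (hD.memHolderLoc_connOp x₀ (stdVec i)).clm_apply hS (hγ j f)

theorem differentiableAt_of_memHolderLoc {W : Type*} [NormedAddCommGroup W] [NormedSpace ℝ W]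
    (hr : 0 ≤ r) {x₀ : M} {f : Plane → W}
    (hf : MemHolderLoc (r + 1) f (locDom F E x₀)) {y : Plane} (hy : y ∈ interior (locDom F E x₀)) :
    DifferentiableAt ℝ f y :=
  ((hf.contDiffOn_one hr).contDiffAt (mem_interior_iff_mem_nhds.1 hy)).differentiableAt (by simp)

/-- `∇ γ(dx^j) = -∑ Γ^j_{ik} γ(dx^k)`. -/
theorem HasRegularity.covOp_gammaOp (hD : D.HasRegularity r s p) (hr : 0 ≤ r) {x₀ : M} {y : Plane}
    (hy : y ∈ interior (locDom F E x₀)) (j i : Fin 2) :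
    covOp D.conn x₀ (stdVec i) (D.gammaOp x₀ j) y =
      -∑ k, christoffel g x₀ j i k y • D.gammaOp x₀ k y := by
  have hS := isHalfOpen_locDom (F := F) (E := E) x₀
  have hγ := fun k (f : F) => (hD.memHolderLoc_gammaOp_aux x₀ k).clm_apply hS (hS.memHolderLoc_const f)
  have hd := differentiableAt_of_memHolderLoc hr (hD.memHolderLoc_gammaOp hr x₀ j) hy
  ext f
  -- The weak derivatives are continuous, hence classical; uniqueness of the derivative turns the
  -- weak identity into a pointwise one.
  have h1 : HasFDerivAt (fun y => D.gammaOp x₀ j y f) _ y :=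
    (hS.hasFDerivWithinAt_of_hasWeakDeriv (hγ j f).continuousOn (fun i => by
    refine ContinuousOn.sub (ContinuousOn.add (ContinuousOn.neg ?_) ?_) ?_
    · refine continuousOn_finsetSum _ fun k _ => ?_
      have hθ : ContinuousOn (christoffel g x₀ j i k) (locDom F E x₀) :=
        (contDiffOn_christoffel g x₀ j i k).continuousOn.mono (locDom_subset x₀)
      exact hθ.smul (hγ k f).continuousOn
    · exact (hD.memHolderLoc_gammaOp_aux x₀ j).continuousOn.clm_apply
        (hD.1 x₀ (stdVec i) f).1.continuousOn
    · exact (hD.memHolderLoc_connOp x₀ (stdVec i)).continuousOn.clm_apply (hγ j f).continuousOn)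
    (D.hasWeakDeriv_gammaOp x₀ j · f) (interior_subset hy)).hasFDerivAt
      (mem_interior_iff_mem_nhds.1 hy)
  have h2 := hd.hasFDerivAt.clm_apply (hasFDerivAt_const f y)
  rw [ContinuousLinearMap.comp_zero, zero_add] at h2
  have h3 := congrArg (fun T => T (stdVec i)) (h1.unique h2)
  have h4 : ∀ G : Fin 2 → F, (∑ m, (EuclideanSpace.proj m : Plane →L[ℝ] ℝ).smulRight (G m))
      (stdVec i) = G i := fun G => by
    rw [sum_apply]
    refine (Finset.sum_eq_single i (fun m _ hm => ?_) (by simp)).trans ?_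
    · simp [stdVec, hm]
    · simp [stdVec]
  have h5 := (h4 _).symm.trans h3
  rw [ContinuousLinearMap.flip_apply] at h5
  simp only [covOp, sub_apply, add_apply, mul_apply_eq_comp, neg_apply, sum_apply,
    smul_apply]
  rw [← h5, ← connOp_apply D.conn (interior_subset hy)]
  abel

theorem contDiffOn_coordJ (x₀ : M) :
    ContDiffOn ℝ ∞ (coordJ c x₀) (extChartAt (𝓡∂ 2) x₀).target := c.smooth x₀ (stdVec 0)

theorem contDiffOn_coordJ_apply (x₀ : M) (i : Fin 2) :
    ContDiffOn ℝ ∞ (fun y => coordJ c x₀ y i) (extChartAt (𝓡∂ 2) x₀).target :=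
  (EuclideanSpace.proj (𝕜 := ℝ) i).contDiff.comp_contDiffOn (contDiffOn_coordJ x₀)

theorem HasRegularity.memHolderLoc_clOp (hD : D.HasRegularity r s p) (hr : 0 ≤ r) (x₀ : M)
    (a : Plane) : MemHolderLoc (r + 1) (D.clOp x₀ a) (locDom F E x₀) := by
  have hS := isHalfOpen_locDom (F := F) (E := E) x₀
  exact (MemHolderLoc.sum hS Finset.univ fun j _ => MemHolderLoc.smul hS (memHolderLoc_of_target
    (contDiffOn_metric g x₀ a (stdVec j)) (r + 1)) (hD.memHolderLoc_gammaOp hr x₀ j)).congr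
    fun y hy => D.clOp_eq hy a

theorem HasRegularity.memHolderLoc_volOp (hD : D.HasRegularity r s p) (hr : 0 ≤ r) (x₀ : M) :
    MemHolderLoc (r + 1) (D.volOp c x₀) (locDom F E x₀) := by
  have hS := isHalfOpen_locDom (F := F) (E := E) x₀
  have h1 : MemHolderLoc (r + 1) (fun y => ∑ i, coordJ c x₀ y i • D.clOp x₀ (stdVec i) y)
      (locDom F E x₀) := MemHolderLoc.sum hS Finset.univ fun i _ => MemHolderLoc.smul hS
        (memHolderLoc_of_target (contDiffOn_coordJ_apply x₀ i) (r + 1)) (hD.memHolderLoc_clOp hr x₀ _)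
  have h2 := MemHolderLoc.bilin hS (ContinuousLinearMap.mul ℝ (F →L[ℝ] F))
    (hD.memHolderLoc_clOp hr x₀ (stdVec 0)) h1
  exact MemHolderLoc.smul hS (memHolderLoc_of_target ((contDiffOn_metricMatrix g x₀ 0 0).inv
    fun y hy => (metricMatrix_zero_zero_pos g hy).ne') (r + 1)) h2

theorem HasRegularity.memHolderLoc_chirOp (hD : D.HasRegularity r s p) (hr : 0 ≤ r)
    (hg : IsConformal g c) (x₀ : M) : MemHolderLoc (r + 1) (D.chirOp c x₀) (locDom F E x₀) := by
  have hS := isHalfOpen_locDom (F := F) (E := E) x₀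
  exact (MemHolderLoc.clm_comp hS (ContinuousLinearMap.mul ℝ (F →L[ℝ] F) (mulI F))
    (hD.memHolderLoc_volOp (c := c) hr x₀)).congr fun y hy => D.chirOp_eq hg hy

end Regularity

theorem connOp_mulI (x₀ : M) {y : Plane} (hy : y ∈ locDom F E x₀) (a : Plane) :
    connOp D.conn x₀ a y * mulI F = mulI F * connOp D.conn x₀ a y := by
  ext f
  show connOp D.conn x₀ a y (Complex.I • f) = Complex.I • connOp D.conn x₀ a y f
  rw [connOp_apply D.conn hy, connOp_apply D.conn hy]
  have h := D.conn_smul Complex.I (constSec F E x₀ f) _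
    (secDiffAt_constSec (symm_mem_source hy.1) hy.2 f)
  have e : constSec F E x₀ (Complex.I • f) = fun x => Complex.I • constSec F E x₀ f x := by
    funext x; exact map_smul _ _ _
  rw [connForm, connForm, locRep, locRep, component, component, e, h, smul_apply, map_smul]

/-- The chirality operator is parallel. -/
theorem HasRegularity.covOp_chirOp (hD : D.HasRegularity r s p) (hr : 0 ≤ r)
    (hg : IsConformal g c) {x₀ : M} {y : Plane} (hy : y ∈ interior (locDom F E x₀)) (a : Plane) :
    covOp D.conn x₀ a (D.chirOp c x₀) y = 0 := by
  have hy' := interior_subset hy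
  refine covOp_of_stdVec D.conn hy' (fun i => ?_) a
  have hev : ∀ᶠ z in nhds y, z ∈ locDom F E x₀ := mem_interior_iff_mem_nhds.1 hy
  have hN := differentiableAt_of_memHolderLoc hr (hD.memHolderLoc_volOp (c := c) hr x₀) hy
  have hγ := fun j => differentiableAt_of_memHolderLoc hr (hD.memHolderLoc_gammaOp hr x₀ j) hy
  set N := D.volOp c x₀ with hNdef
  set C := covOp D.conn x₀ (stdVec i) N y with hC
  -- Covariant derivative of N² = −1.
  have h1 : C * N y + N y * C = 0 := by
    rw [← covOp_mul D.conn x₀ (stdVec i) hN hN, covOp_congr (T := fun _ => (-1 : ℝ) • 1) D.conn x₀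
      (stdVec i) (hev.mono fun z hz => by rw [hNdef, D.volOp_mul_self hg hz, neg_one_smul])]
    exact covOp_real_const D.conn x₀ _ _ y
  -- Covariant derivative of Nγ + γN = 0. It also contains terms with ∇γ, which are removed by `h4`:
  -- ∇γ is a combination of γ's, and these anticommute with N.
  have h2 : ∀ j, C * D.gammaOp x₀ j y = -(D.gammaOp x₀ j y * C) := fun j => by
    have h3 : covOp D.conn x₀ (stdVec i) (fun z => N z * D.gammaOp x₀ j z + D.gammaOp x₀ j z * N z) y
        = 0 := by
      rw [covOp_congr (T := fun _ => (0 : ℝ) • 1) D.conn x₀ (stdVec i) (hev.mono fun z hz => by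
        show N z * D.gammaOp x₀ j z + D.gammaOp x₀ j z * N z = (0 : ℝ) • 1
        rw [hNdef, D.volOp_mul_gammaOp hg hz, neg_add_cancel, zero_smul])]
      exact covOp_real_const D.conn x₀ _ _ y
    rw [covOp_add (S := fun z => N z * D.gammaOp x₀ j z) (T := fun z => D.gammaOp x₀ j z * N z)
      D.conn x₀ _ (hN.mul (hγ j)) ((hγ j).mul hN), covOp_mul D.conn x₀ _ hN (hγ j),
      covOp_mul D.conn x₀ _ (hγ j) hN, hD.covOp_gammaOp hr hy] at h3
    have h4 : N y * -∑ k, christoffel g x₀ j i k y • D.gammaOp x₀ k y +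
        (-∑ k, christoffel g x₀ j i k y • D.gammaOp x₀ k y) * N y = 0 := by
      rw [mul_neg, neg_mul, Finset.mul_sum, Finset.sum_mul, ← neg_add, ← Finset.sum_add_distrib,
        neg_eq_zero]
      refine Finset.sum_eq_zero fun k _ => ?_
      rw [mul_smul_comm, smul_mul_assoc, hNdef, D.volOp_mul_gammaOp hg hy', ← smul_add,
        neg_add_cancel, smul_zero]
    have h5 : C * D.gammaOp x₀ j y + D.gammaOp x₀ j y * C +
      (N y * -∑ k, christoffel g x₀ j i k y • D.gammaOp x₀ k y +
        (-∑ k, christoffel g x₀ j i k y • D.gammaOp x₀ k y) * N y) = 0 := by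
      rw [← h3]; abel
    rw [h4, add_zero] at h5
    exact eq_neg_of_add_eq_zero_left h5
  have h6 : ∀ b, C * D.clOp x₀ b y = -(D.clOp x₀ b y * C) := fun b => by
    rw [D.clOp_eq hy', Finset.mul_sum, Finset.sum_mul, ← Finset.sum_neg_distrib]
    refine Finset.sum_congr rfl fun j _ => ?_
    rw [mul_smul_comm, smul_mul_assoc, h2, smul_neg]
  -- N is a product of two Clifford multiplications; C anticommutes with each, so the two signs
  -- cancel.
  have h7 : C * N y = N y * C := by
    rw [hNdef, volOp, ← clOp_sum, mul_smul_comm, smul_mul_assoc, ← mul_assoc, h6, neg_mul, mul_assoc,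
      h6, mul_neg, neg_neg, mul_assoc]
  have h8 : C = 0 := eq_zero_of_anticommute (D.volOp_mul_self hg hy') h1 h7
  -- Finally Γ = iN, and multiplication by i is parallel since the connection is complex linear.
  rw [covOp_congr (T := fun z => mulI F * N z) D.conn x₀ (stdVec i) (hev.mono fun z hz =>
    D.chirOp_eq hg hz), covOp_mul D.conn x₀ _ (differentiableAt_const _) hN, ← hC, h8, mul_zero,
    add_zero, covOp, fderiv_const_apply, connOp_mulI x₀ hy']
  simp

end DiracBundle

end Parallel

end DiracSurface

end

/-! ### The splitting and the subbundle: regularity, rank and invariance of H¹. -/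

noncomputable section

namespace DiracSurface

section Splitting

set_option linter.unusedSectionVars false

variable {M : Type*} [TopologicalSpace M]
  [ChartedSpace (EuclideanHalfSpace 2) M]
  [IsManifold (𝓡∂ 2) ∞ M]
  {F : Type*} [NormedAddCommGroup F] [NormedSpace ℂ F]
  {E : M → Type*} [∀ x, AddCommGroup (E x)] [∀ x, Module ℂ (E x)]
  [∀ x, TopologicalSpace (E x)] [∀ x, IsTopologicalAddGroup (E x)] [∀ x, ContinuousSMul ℂ (E x)]
  [TopologicalSpace (TotalSpace F E)] [FiberBundle F E] [VectorBundle ℂ F E]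
  [FiniteDimensional ℂ F] [VectorBundle ℝ F E] [ContMDiffVectorBundle ∞ F E (𝓡∂ 2)]
  {g : SurfaceMetric M} {c : ComplexStructure M} {D : DiracBundle F E g} {r s p : ℝ}

/-- A parallel endomorphism commutes with weak covariant differentiation. -/
theorem HasWeakCov.map {conn : CovariantDerivative (𝓡∂ 2) F E} {u : ∀ x, E x} {w : FormField E}
    (h : HasWeakCov conn u w) (T : ∀ x, E x →L[ℂ] E x)
    (hT : ∀ x₀ : M, ContDiffOn ℝ 1 (locMap (F := F) x₀ T) (locDom F E x₀))
    (hT' : ∀ (x₀ : M) (a : Plane), ∀ y ∈ interior (locDom F E x₀),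
      covOp conn x₀ a (locMap x₀ T) y = 0) :
    HasWeakCov conn (fun x => T x (u x)) (DiracBundle.compForm T w) := by
  intro x₀ a
  refine ((h x₀ a).clm_apply isOpen_interior ((hT x₀).mono interior_subset)).congr_ae
    isOpen_interior.measurableSet (Filter.Eventually.of_forall fun y hy =>
      (locRep_map (interior_subset hy) T u).symm) (Filter.Eventually.of_forall fun y hy => ?_)
  have hy' := interior_subset hy
  have h1 := congrArg (fun S => S (locRep F x₀ u y)) (hT' x₀ a y hy)
  simp only [covOp, sub_apply, add_apply, mul_apply_eq_comp, zero_apply] at h1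
  rw [locRep_map hy' T u, ← connOp_apply conn hy', ← connOp_apply conn hy', map_sub]
  have h2 : locRep F x₀ (component x₀ a (DiracBundle.compForm T w)) y =
      locMap x₀ T y (locRep F x₀ (component x₀ a w) y) := locRep_map hy' T (component x₀ a w)
  rw [h2, ← sub_eq_zero, ← h1]
  abel

theorem covOp_const_smul (conn : CovariantDerivative (𝓡∂ 2) F E) (x₀ : M) (a : Plane) {y : Plane}
    (t : ℝ) {T : Plane → F →L[ℝ] F} (hT : DifferentiableAt ℝ T y) :
    covOp conn x₀ a (fun z => t • T z) y = t • covOp conn x₀ a T y := by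
  simp only [covOp, fderiv_fun_const_smul hT, smul_apply, mul_smul_comm, smul_mul_assoc, smul_sub,
    smul_add]

namespace DiracBundle

theorem locMap_projPlus {x₀ : M} {y : Plane} (hy : y ∈ locDom F E x₀) :
    locMap x₀ (D.projPlus c) y = (1 / 2 : ℝ) • 1 + (1 / 2 : ℝ) • D.chirOp c x₀ y := by
  ext f
  have h := locRep_constSec hy f
  rw [locMap_apply]
  simp only [projPlus_apply, smul_add]
  rw [locRep_add, locRep_smul, locRep_smul, h]
  simp only [add_apply, smul_apply, ← Complex.coe_smul]
  push_cast
  rfl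

theorem locMap_projMinus {x₀ : M} {y : Plane} (hy : y ∈ locDom F E x₀) :
    locMap x₀ (D.projMinus c) y = (1 / 2 : ℝ) • 1 + (-(1 / 2) : ℝ) • D.chirOp c x₀ y := by
  ext f
  have h := locRep_constSec hy f
  rw [locMap_apply]
  simp only [projMinus_apply, smul_sub]
  rw [locRep_sub, locRep_smul, locRep_smul, h, sub_eq_add_neg, ← neg_smul]
  simp only [add_apply, smul_apply, ← Complex.coe_smul]
  push_cast
  rfl

theorem HasRegularity.memHolderLoc_affine (hD : D.HasRegularity r s p) (hr : 0 ≤ r)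
    (hg : IsConformal g c) (x₀ : M) (t t' : ℝ) :
    MemHolderLoc (r + 1) (fun y => t • 1 + t' • D.chirOp c x₀ y) (locDom F E x₀) := by
  have hS := isHalfOpen_locDom (F := F) (E := E) x₀
  exact MemHolderLoc.add hS (hS.memHolderLoc_const _)
    ((hD.memHolderLoc_chirOp hr hg x₀).clm_comp hS (t' • ContinuousLinearMap.id ℝ (F →L[ℝ] F)))

theorem HasRegularity.covOp_affine (hD : D.HasRegularity r s p) (hr : 0 ≤ r)
    (hg : IsConformal g c) {x₀ : M} {y : Plane} (hy : y ∈ interior (locDom F E x₀)) (a : Plane)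
    (t t' : ℝ) : covOp D.conn x₀ a (fun y => t • 1 + t' • D.chirOp c x₀ y) y = 0 := by
  have hd := differentiableAt_of_memHolderLoc hr (hD.memHolderLoc_chirOp hr hg x₀) hy
  rw [covOp_add (S := fun _ => t • 1) (T := fun y => t' • D.chirOp c x₀ y) D.conn x₀ a
    (differentiableAt_const _) (hd.const_smul t'), covOp_real_const, covOp_const_smul _ _ _ _ hd,
    hD.covOp_chirOp hr hg hy, smul_zero, add_zero]

theorem HasRegularity.memHolderLoc_projPlus (hD : D.HasRegularity r s p) (hr : 0 ≤ r)
    (hg : IsConformal g c) (x₀ : M) :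
    MemHolderLoc (r + 1) (locMap (F := F) x₀ (D.projPlus c)) (locDom F E x₀) :=
  (hD.memHolderLoc_affine hr hg x₀ (1 / 2) (1 / 2)).congr fun _ hy => locMap_projPlus hy

theorem HasRegularity.memHolderLoc_projMinus (hD : D.HasRegularity r s p) (hr : 0 ≤ r)
    (hg : IsConformal g c) (x₀ : M) :
    MemHolderLoc (r + 1) (locMap (F := F) x₀ (D.projMinus c)) (locDom F E x₀) :=
  (hD.memHolderLoc_affine hr hg x₀ (1 / 2) (-(1 / 2))).congr fun _ hy => locMap_projMinus hy

theorem HasRegularity.hasWeakCov_projPlus (hD : D.HasRegularity r s p) (hr : 0 ≤ r)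
    (hg : IsConformal g c) {u : ∀ x, E x} {w : FormField E} (h : HasWeakCov D.conn u w) :
    HasWeakCov D.conn (fun x => D.projPlus c x (u x)) (compForm (D.projPlus c) w) :=
  h.map _ (fun x₀ => (hD.memHolderLoc_projPlus hr hg x₀).contDiffOn_one hr) fun x₀ a y hy => by
    have hev : ∀ᶠ z in nhds y, z ∈ locDom F E x₀ := mem_interior_iff_mem_nhds.1 hy
    exact (covOp_congr D.conn x₀ a (hev.mono fun _ hz => locMap_projPlus hz)).trans
      (hD.covOp_affine hr hg hy a _ _)

theorem HasRegularity.hasWeakCov_projMinus (hD : D.HasRegularity r s p) (hr : 0 ≤ r)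
    (hg : IsConformal g c) {u : ∀ x, E x} {w : FormField E} (h : HasWeakCov D.conn u w) :
    HasWeakCov D.conn (fun x => D.projMinus c x (u x)) (compForm (D.projMinus c) w) :=
  h.map _ (fun x₀ => (hD.memHolderLoc_projMinus hr hg x₀).contDiffOn_one hr) fun x₀ a y hy => by
    have hev : ∀ᶠ z in nhds y, z ∈ locDom F E x₀ := mem_interior_iff_mem_nhds.1 hy
    exact (covOp_congr D.conn x₀ a (hev.mono fun _ hz => locMap_projMinus hz)).trans
      (hD.covOp_affine hr hg hy a _ _)

/-! ### The components of the splitting in coordinates -/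

variable (D c) in
/-- The component along `a` of the form `toForm (P₋ u)`, as an operator on `u`. -/
def formOp (x₀ : M) (a : Plane) (y : Plane) : F →L[ℝ] F :=
  (-(1 / Real.sqrt 2)) • (D.clOp x₀ a y * locMap x₀ (D.projMinus c) y)

variable (D) in
/-- The operator that recovers `P₋ u` from the component of `toForm (P₋ u)` along `∂_0`. -/
def backOp (x₀ : M) (y : Plane) : F →L[ℝ] F :=
  (Real.sqrt 2 * (metricMatrix g x₀ y 0 0)⁻¹) • D.clOp x₀ (stdVec 0) y

theorem locRep_toForm_projMinus {x₀ : M} {y : Plane} (hy : y ∈ locDom F E x₀) (a : Plane)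
    (u : ∀ x, E x) :
    locRep F x₀ (component x₀ a fun x => D.toForm x (D.projMinus c x (u x))) y =
      formOp c D x₀ a y (locRep F x₀ u y) := by
  have h : (component x₀ a fun x => D.toForm x (D.projMinus c x (u x))) = fun x =>
      -((1 / Real.sqrt 2 : ℝ) : ℂ) • D.cl x (coordVec x₀ a x) (D.projMinus c x (u x)) := rfl
  rw [h, locRep_smul, locRep_map hy (fun x => D.cl x (coordVec x₀ a x)), locRep_map hy, formOp,
    smul_apply, ← Complex.coe_smul, Complex.ofReal_neg]
  rfl

/-- The inverse of the splitting in coordinates. Only the component of the form along ∂_0 enters,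
because that one value determines a form of type (0,1). -/
theorem locRep_eq_add {x₀ : M} {y : Plane} (hy : y ∈ locDom F E x₀) (u : ∀ x, E x) :
    locRep F x₀ u y = locRep F x₀ (fun x => D.projPlus c x (u x)) y +
      backOp D x₀ y (locRep F x₀
        (component x₀ (stdVec 0) fun x => D.toForm x (D.projMinus c x (u x))) y) := by
  have hv := coordVec_ne_zero (symm_mem_source hy.1) stdVec_zero_ne_zero
  have h1 : D.projMinus c _ (u ((extChartAt (𝓡∂ 2) x₀).symm y)) =
      ((Real.sqrt 2 * (metricMatrix g x₀ y 0 0)⁻¹ : ℝ) : ℂ) • D.cl _ (coordVec x₀ (stdVec 0) _)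
        (component x₀ (stdVec 0) (fun x => D.toForm x (D.projMinus c x (u x))) _) := by
    conv_lhs => rw [← D.ofForm_toForm hv (D.projMinus c _ (u _))]
    rw [ofForm, Complex.ofReal_mul, Complex.ofReal_inv, ← div_eq_mul_inv]
    rfl
  have h2 : locRep F x₀ (fun x => D.projMinus c x (u x)) y =
      backOp D x₀ y (locRep F x₀
        (component x₀ (stdVec 0) fun x => D.toForm x (D.projMinus c x (u x))) y) := by
    rw [locRep_congr (v := fun x => ((Real.sqrt 2 * (metricMatrix g x₀ y 0 0)⁻¹ : ℝ) : ℂ) •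
      D.cl _ (coordVec x₀ (stdVec 0) x)
        (component x₀ (stdVec 0) (fun x => D.toForm x (D.projMinus c x (u x))) x)) h1, locRep_smul,
      locRep_map hy (fun x => D.cl x (coordVec x₀ (stdVec 0) x)), Complex.coe_smul]
    rfl
  rw [← h2, ← locRep_add]
  exact locRep_congr (D.projPlus_add_projMinus _ _).symm

theorem HasRegularity.memHolderLoc_formOp (hD : D.HasRegularity r s p) (hr : 0 ≤ r)
    (hg : IsConformal g c) (x₀ : M) (a : Plane) :
    MemHolderLoc (r + 1) (formOp c D x₀ a) (locDom F E x₀) := by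
  have hS := isHalfOpen_locDom (F := F) (E := E) x₀
  exact (MemHolderLoc.bilin hS (ContinuousLinearMap.mul ℝ (F →L[ℝ] F)) (hD.memHolderLoc_clOp hr x₀ a)
    (hD.memHolderLoc_projMinus hr hg x₀)).clm_comp hS
      ((-(1 / Real.sqrt 2)) • ContinuousLinearMap.id ℝ (F →L[ℝ] F))

theorem HasRegularity.memHolderLoc_backOp (hD : D.HasRegularity r s p) (hr : 0 ≤ r) (x₀ : M) :
    MemHolderLoc (r + 1) (backOp D x₀) (locDom F E x₀) := by
  have hS := isHalfOpen_locDom (F := F) (E := E) x₀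
  exact MemHolderLoc.smul hS (memHolderLoc_of_target (contDiffOn_const.mul
    ((contDiffOn_metricMatrix g x₀ 0 0).inv fun y hy => (metricMatrix_zero_zero_pos g hy).ne'))
      (r + 1)) (hD.memHolderLoc_clOp hr x₀ _)

theorem HasRegularity.secH1_projPlus (hD : D.HasRegularity r s p) (hr : 0 ≤ r)
    (hg : IsConformal g c) {u : ∀ x, E x} (hu : SecH1 F u) :
    SecH1 F fun x => D.projPlus c x (u x) := fun x₀ =>
  (MemSobolevLoc.clm_apply (isHalfOpen_locDom x₀) (hu x₀)
    ((hD.memHolderLoc_projPlus hr hg x₀).contDiffOn_one hr)).congr fun _ hy =>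
      (locRep_map hy _ u).symm

theorem HasRegularity.formH1_toForm (hD : D.HasRegularity r s p) (hr : 0 ≤ r)
    (hg : IsConformal g c) {u : ∀ x, E x} (hu : SecH1 F u) :
    FormH1 F fun x => D.toForm x (D.projMinus c x (u x)) := fun x₀ a =>
  (MemSobolevLoc.clm_apply (isHalfOpen_locDom x₀) (hu x₀)
    ((hD.memHolderLoc_formOp hr hg x₀ a).contDiffOn_one hr)).congr fun _ hy =>
      (locRep_toForm_projMinus hy a u).symm

theorem HasRegularity.secH1_of_splitting (hD : D.HasRegularity r s p) (hr : 0 ≤ r)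
    {u : ∀ x, E x} (h : SecH1 F fun x => D.projPlus c x (u x))
    (h' : FormH1 F fun x => D.toForm x (D.projMinus c x (u x))) : SecH1 F u := fun x₀ =>
  ((h x₀).add (MemSobolevLoc.clm_apply (isHalfOpen_locDom x₀) (h' x₀ (stdVec 0))
    ((hD.memHolderLoc_backOp hr x₀).contDiffOn_one hr))).congr fun _ hy => (locRep_eq_add hy u).symm

/-- The splitting is an isomorphism of class `C^{r+1}`. -/
theorem HasRegularity.isBundleIso (hD : D.HasRegularity r s p) (hr : 0 ≤ r)
    (hg : IsConformal g c) : IsBundleIso F c (r + 1) (D.posBundle c) (D.splitting c hg) := by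
  intro U u hU
  have hS := fun x₀ => isHalfOpen_locDom_inter (F := F) (E := E) x₀ hU
  have hm := fun x₀ : M => (Set.inter_subset_left :
    locDom F E x₀ ∩ (extChartAt (𝓡∂ 2) x₀).symm ⁻¹' U ⊆ locDom F E x₀)
  have hL := fun x₀ : M => isHalfOpen_locDom (F := F) (E := E) x₀
  constructor
  · intro hu
    refine ⟨fun x₀ => ?_, fun x₀ a => ?_⟩
    · exact (MemHolderLoc.clm_apply (hS x₀) ((hL x₀).mono (hS x₀) (hm x₀)
        (hD.memHolderLoc_projPlus hr hg x₀)) (hu x₀)).congr fun y hy => locRep_map hy.1 _ u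
    · exact (MemHolderLoc.clm_apply (hS x₀) ((hL x₀).mono (hS x₀) (hm x₀)
        (hD.memHolderLoc_formOp hr hg x₀ a)) (hu x₀)).congr fun y hy =>
          locRep_toForm_projMinus hy.1 a u
  · intro h x₀
    exact (MemHolderLoc.add (hS x₀) (h.1 x₀) (MemHolderLoc.clm_apply (hS x₀) ((hL x₀).mono (hS x₀)
      (hm x₀) (hD.memHolderLoc_backOp hr x₀)) (h.2 x₀ (stdVec 0)))).congr fun y hy =>
        locRep_eq_add hy.1 u

/-! ### The subbundle -/

variable (F E) in
theorem exists_fibreEquiv (x : M) : Nonempty (E x ≃ₗ[ℂ] F) :=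
  ⟨((trivializationAt F E x).continuousLinearEquivAt ℂ x
    (FiberBundle.mem_baseSet_trivializationAt F E x)).toLinearEquiv⟩

/-- The projection P₊ has range E₊ and kernel E₋. Clifford multiplication by a nonzero vector embeds
each eigenspace in the other, so their dimensions agree, and rank–nullity gives n. -/
theorem finrank_posBundle (hg : IsConformal g c) {n : ℕ} (hF : Module.finrank ℂ F = 2 * n) (x : M) :
    Module.finrank ℂ (D.posBundle c x) = n := by
  have hfd : FiniteDimensional ℂ (E x) := (exists_fibreEquiv F E x).some.symm.finiteDimensional
  have hv := tangentBasis_zero_ne_zero x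
  set v := tangentBasis x 0
  let P : E x →ₗ[ℂ] E x := D.projPlus c x
  have hker : ∀ s, s ∈ LinearMap.ker P ↔ D.chir c x s = -s := fun s => by
    rw [LinearMap.mem_ker]
    constructor
    · intro h
      have h1 := D.projPlus_add_projMinus (c := c) x s
      rw [show D.projPlus c x s = 0 from h, zero_add] at h1
      rw [← h1, D.chir_projMinus hg]
    · exact D.projPlus_of_chir_neg
  have hrange : LinearMap.range P = D.posBundle c x := by
    ext s
    rw [D.mem_posBundle]
    constructor
    · rintro ⟨t, rfl⟩
      exact D.chir_projPlus hg x t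
    · intro h
      exact ⟨s, D.projPlus_of_chir h⟩
  have h1 : Module.finrank ℂ (D.posBundle c x) ≤ Module.finrank ℂ (LinearMap.ker P) := by
    refine LinearMap.finrank_le_finrank_of_injective (f := ((D.cl x v : E x →ₗ[ℂ] E x).comp
      (D.posBundle c x).subtype).codRestrict (LinearMap.ker P) fun s => ?_) fun s t h => ?_
    · rw [hker]
      exact (D.chir_cl hg x v s).trans (by rw [D.mem_posBundle.1 s.2]; rfl)
    · exact Subtype.ext (D.cl_injective x hv (congrArg Subtype.val h))
  have h2 : Module.finrank ℂ (LinearMap.ker P) ≤ Module.finrank ℂ (D.posBundle c x) := by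
    refine LinearMap.finrank_le_finrank_of_injective (f := ((D.cl x v : E x →ₗ[ℂ] E x).comp
      (LinearMap.ker P).subtype).codRestrict (D.posBundle c x) fun s => ?_) fun s t h => ?_
    · rw [D.mem_posBundle]
      exact (D.chir_cl hg x v s).trans (by rw [(hker s).1 s.2, map_neg, neg_neg]; rfl)
    · exact Subtype.ext (D.cl_injective x hv (congrArg Subtype.val h))
  have h3 := LinearMap.finrank_range_add_finrank_ker P
  obtain ⟨e⟩ := exists_fibreEquiv F E x
  rw [hrange, e.finrank_eq, hF] at h3
  omega

/-- The positive eigenbundle is a subbundle of rank `n` and of class `C^{r+1}`. -/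
theorem HasRegularity.isSubbundle (hD : D.HasRegularity r s p) (hr : 0 ≤ r)
    (hg : IsConformal g c) {n : ℕ} (hF : Module.finrank ℂ F = 2 * n) :
    IsSubbundle F (r + 1) n (D.posBundle c) := by
  intro x₁
  have hfd : ∀ x, FiniteDimensional ℂ (E x) := fun x =>
    (exists_fibreEquiv F E x).some.symm.finiteDimensional
  have hx₁ := mem_bundleDom (F := F) (E := E) x₁
  -- A basis of the fibre at x₁ is extended by sections constant in the trivialization and projected
  -- by P₊; at x₁ the projection leaves it unchanged.
  let b := Module.finBasisOfFinrankEq ℂ (D.posBundle c x₁) (D.finrank_posBundle hg hF x₁)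
  let f : Fin n → F := fun j => (trivializationAt F E x₁).continuousLinearMapAt ℂ x₁ (b j)
  let e : Fin n → ∀ x, E x := fun j x => D.projPlus c x (constSec F E x₁ (f j) x)
  have he₁ : ∀ j, e j x₁ = b j := fun j => by
    have h : constSec F E x₁ (f j) x₁ = b j :=
      (trivializationAt F E x₁).symmL_continuousLinearMapAt (R := ℂ) hx₁.2 _
    show D.projPlus c x₁ (constSec F E x₁ (f j) x₁) = b j
    rw [h, D.projPlus_of_chir (D.mem_posBundle.1 (b j).2)]
  -- The frame is read in the fixed space F, where linear independence is an open condition; its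
  -- preimage is the required neighbourhood.
  let Θ : M → Fin n → F := fun x j => locMap (F := F) x₁ (D.projPlus c) (extChartAt (𝓡∂ 2) x₁ x) (f j)
  have hΘ : ∀ x ∈ bundleDom F E x₁, ∀ j,
      Θ x j = (trivializationAt F E x₁).continuousLinearMapAt ℂ x (e j x) := fun x hx j =>
    locRep_extChartAt hx.1 (e j)
  have hΘc : ContinuousOn Θ (bundleDom F E x₁) := by
    refine continuousOn_pi.2 fun j => ContinuousOn.clm_apply ?_ continuousOn_const
    refine (hD.memHolderLoc_projPlus hr hg x₁).continuousOn.comp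
      ((continuousOn_extChartAt x₁).mono fun x hx => ?_) fun x hx => extChartAt_mem_locDom hx
    rw [extChartAt_source]
    exact hx.1
  have hU := hΘc.isOpen_inter_preimage (isOpen_bundleDom x₁)
    (isOpen_setOfPred_linearIndependent (𝕜 := ℂ) (E := F) (ι := Fin n))
  refine ⟨_, hU, ⟨hx₁, ?_⟩, e, fun j x₀ => ?_, fun x hx => ?_⟩
  · show LinearIndependent ℂ (Θ x₁)
    have h1 : Θ x₁ = ((trivializationAt F E x₁).continuousLinearEquivAt ℂ x₁ hx₁.2 :
        E x₁ →ₗ[ℂ] F) ∘ (D.posBundle c x₁).subtype ∘ b := by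
      funext j
      rw [hΘ x₁ hx₁, he₁]
      exact (congrFun ((trivializationAt F E x₁).coe_continuousLinearEquivAt_eq (R := ℂ) hx₁.2) _).symm
    rw [h1]
    refine LinearIndependent.map' (LinearIndependent.map' b.linearIndependent _
      (Submodule.ker_subtype _)) _ (LinearMap.ker_eq_bot.2 ?_)
    exact ((trivializationAt F E x₁).continuousLinearEquivAt ℂ x₁ hx₁.2).injective
  · have hS := isHalfOpen_locDom_inter (F := F) (E := E) x₀ hU
    have hL := isHalfOpen_locDom (F := F) (E := E) x₀
    exact (MemHolderLoc.clm_apply hS (hL.mono hS Set.inter_subset_left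
      (hD.memHolderLoc_projPlus hr hg x₀)) (hS.memHolderLoc_of_smooth
        ((contDiffOn_locRep_constSec x₀ x₁ (f j)).mono fun y hy => ⟨hy.1, hy.2.1⟩) (r + 1))).congr
          fun y hy => locRep_map hy.1 _ _
  · have hli : LinearIndependent ℂ fun j => e j x := by
      have h1 : LinearIndependent ℂ (Θ x) := hx.2
      rw [show Θ x = ((trivializationAt F E x₁).continuousLinearMapAt ℂ x : E x →ₗ[ℂ] F) ∘
        fun j => e j x from funext (hΘ x hx.1)] at h1
      exact h1.of_comp _
    -- The frame consists of n independent vectors of E₊, which has dimension n, so it spans.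
    refine ⟨hli, Submodule.eq_of_le_of_finrank_eq (Submodule.span_le.2 ?_) ?_⟩
    · rintro _ ⟨j, rfl⟩
      exact D.mem_posBundle.2 (D.chir_projPlus hg x _)
    · rw [finrank_span_eq_card hli, D.finrank_posBundle hg hF, Fintype.card_fin]

end DiracBundle

end Splitting

end DiracSurface

end

/-! ### Integration by parts against compactly supported coefficients. -/

noncomputable section

namespace DiracSurface

section CompactlySupported

variable {V W : Type*} [NormedAddCommGroup V] [NormedSpace ℝ V] [NormedAddCommGroup W]
  [NormedSpace ℝ W] {Ω : Set Plane}

theorem integrableOn_clm_apply_of_isCompact {K : Set Plane} (hK : IsCompact K) {f : Plane → V}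
    (hf : IntegrableOn f K) {T : Plane → V →L[ℝ] W} (hT : ContinuousOn T K) :
    IntegrableOn (fun y => T y (f y)) K := by
  obtain ⟨C, hC⟩ := hK.exists_bound_of_continuousOn hT
  refine Integrable.mono' (hf.norm.const_mul C) ?_ ?_
  · exact (ContinuousLinearMap.apply ℝ W).aestronglyMeasurable_comp₂ hf.1
      (hT.aestronglyMeasurable_of_isCompact hK hK.measurableSet)
  · filter_upwards [ae_restrict_mem hK.measurableSet] with y hy
    exact ((T y).le_opNorm _).trans (mul_le_mul_of_nonneg_right (hC y hy) (norm_nonneg _))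

theorem LocallyIntegrableOn.clm_apply (hΩ : IsOpen Ω) {f : Plane → V}
    (hf : LocallyIntegrableOn f Ω) {T : Plane → V →L[ℝ] W} (hT : ContinuousOn T Ω) :
    LocallyIntegrableOn (fun y => T y (f y)) Ω := by
  rw [locallyIntegrableOn_iff hΩ.isLocallyClosed] at hf ⊢
  exact fun K hKΩ hK => integrableOn_clm_apply_of_isCompact hK (hf K hKΩ hK) (hT.mono hKΩ)

theorem LocallyIntegrableOn.integrableOn_clm_apply (hΩ : MeasurableSet Ω) {f : Plane → V}
    (hf : LocallyIntegrableOn f Ω) {T : Plane → V →L[ℝ] W} (hT : ContinuousOn T Ω) {K : Set Plane}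
    (hKΩ : K ⊆ Ω) (hK : IsCompact K) (hTK : ∀ y ∈ Ω, y ∉ K → T y = 0) :
    IntegrableOn (fun y => T y (f y)) Ω :=
  (integrableOn_clm_apply_of_isCompact hK (hf.integrableOn_compact_subset hKΩ hK)
    (hT.mono hKΩ)).of_forall_sdiff_eq_zero hΩ fun y hy => by rw [hTK y hy.1 hy.2]; rfl

theorem fderiv_eq_zero_of_forall_notMem (hΩ : IsOpen Ω) {T : Plane → W} {K : Set Plane}
    (hK : IsCompact K) (hTK : ∀ y ∈ Ω, y ∉ K → T y = 0) {y : Plane} (hy : y ∈ Ω) (hyK : y ∉ K) :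
    fderiv ℝ T y = 0 := by
  have h : T =ᶠ[nhds y] fun _ => 0 := by
    filter_upwards [hΩ.mem_nhds hy, hK.isClosed.isOpen_compl.mem_nhds hyK] with z hz hzK
    exact hTK z hz hzK
  rw [h.fderiv_eq, fderiv_const_apply]

/-- Integration by parts against a compactly supported family of linear maps. -/
theorem HasWeakDeriv.integral_clm_apply [FiniteDimensional ℝ V] [FiniteDimensional ℝ W]
    (hΩ : IsOpen Ω) {a : Plane} {f f' : Plane → V} (h : HasWeakDeriv Ω a f f')
    {T : Plane → V →L[ℝ] W} (hT : ContDiffOn ℝ 1 T Ω) {K : Set Plane} (hKΩ : K ⊆ Ω)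
    (hK : IsCompact K) (hTK : ∀ y ∈ Ω, y ∉ K → T y = 0) :
    ∫ y in Ω, (fderiv ℝ T y a (f y) + T y (f' y)) = 0 := by
  have hW := h.clm_apply hΩ hT
  -- The weak derivative of y ↦ T y (f y) is tested against a cutoff equal to 1 near K. On K the
  -- derivative of the cutoff vanishes and off K the coefficient T vanishes, so neither side sees
  -- the cutoff.
  obtain ⟨φ, hφ, hφc, hφs, hφ1⟩ : ∃ φ : Plane → ℝ, ContDiff ℝ 1 φ ∧ HasCompactSupport φ ∧
      tsupport φ ⊆ Ω ∧ ∀ y ∈ K, φ =ᶠ[nhds y] fun _ => 1 := by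
    obtain ⟨L, hL, hKL, hLΩ⟩ := exists_compact_between hK hΩ hKΩ
    obtain ⟨φ, h1, h2, -⟩ := exists_contMDiffMap_one_nhds_of_subset_interior 𝓘(ℝ, Plane)
      (n := 1) hK.isClosed hKL
    have hs : tsupport φ ⊆ L := closure_minimal (fun y hy => by
      by_contra h
      exact hy (h2 y h)) hL.isClosed
    exact ⟨φ, φ.contMDiff.contDiff, hL.of_isClosed_subset (isClosed_tsupport _) hs, hs.trans hLΩ,
      fun y hy => eventually_nhdsSet_iff_forall.1 h1 y hy⟩
  have h2 := hW.2.2 φ hφ hφc hφs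
  have h3 : ∫ y in Ω, fderiv ℝ φ y a • T y (f y) = 0 := by
    refine setIntegral_eq_zero_of_forall_eq_zero fun y hy => ?_
    by_cases hyK : y ∈ K
    · rw [(hφ1 y hyK).fderiv_eq, fderiv_const_apply, zero_apply, zero_smul]
    · rw [hTK y hy hyK, zero_apply, smul_zero]
  rw [h3, zero_eq_neg] at h2
  rw [← h2]
  refine setIntegral_congr_fun hΩ.measurableSet fun y hy => ?_
  by_cases hyK : y ∈ K
  · simp only [(hφ1 y hyK).self_of_nhds, one_smul]
  · simp only [hTK y hy hyK, fderiv_eq_zero_of_forall_notMem hΩ hK hTK hy hyK, zero_apply,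
      add_zero, smul_zero]

end CompactlySupported

/-! ### The Hermitian metric and the contraction in coordinates. -/

section IntegrationByParts

set_option linter.unusedSectionVars false

variable {M : Type*} [TopologicalSpace M]
  [ChartedSpace (EuclideanHalfSpace 2) M]
  [IsManifold (𝓡∂ 2) ∞ M]
  {F : Type*} [NormedAddCommGroup F] [NormedSpace ℂ F]
  {E : M → Type*} [∀ x, AddCommGroup (E x)] [∀ x, Module ℂ (E x)]
  [∀ x, TopologicalSpace (E x)] [∀ x, IsTopologicalAddGroup (E x)] [∀ x, ContinuousSMul ℂ (E x)]
  [TopologicalSpace (TotalSpace F E)] [FiberBundle F E] [VectorBundle ℂ F E]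
  [FiniteDimensional ℂ F] [VectorBundle ℝ F E] [ContMDiffVectorBundle ∞ F E (𝓡∂ 2)]
  {g : SurfaceMetric M} {c : ComplexStructure M} {D : DiracBundle F E g} {r s p : ℝ}

/-- The Leibniz rule for a bundle endomorphism in coordinates. -/
theorem locRep_conn_map (conn : CovariantDerivative (𝓡∂ 2) F E) {x₀ : M} {y : Plane}
    (hy : y ∈ interior (locDom F E x₀)) {T : ∀ x, E x →L[ℂ] E x}
    (hT : DifferentiableAt ℝ (locMap (F := F) x₀ T) y) {ψ : ∀ x, E x}
    (hψ : DifferentiableAt ℝ (locRep F x₀ ψ) y) (a : Plane) :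
    locRep F x₀ (component x₀ a (conn fun x => T x (ψ x))) y =
      covOp conn x₀ a (locMap x₀ T) y (locRep F x₀ ψ y) +
        locMap x₀ T y (locRep F x₀ (component x₀ a (conn ψ)) y) := by
  have hy' := interior_subset hy
  have hev : locRep F x₀ (fun x => T x (ψ x)) =ᶠ[nhds y] fun z => locMap x₀ T z (locRep F x₀ ψ z) := by
    filter_upwards [mem_interior_iff_mem_nhds.1 hy] with z hz using locRep_map hz T ψ
  have hd := (hT.clm_apply hψ).congr_of_eventuallyEq hev
  rw [locRep_conn conn hy' hd, locRep_conn conn hy' hψ, hev.fderiv_eq, fderiv_clm_apply hT hψ,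
    locRep_map hy' T ψ]
  simp only [covOp, sub_apply, add_apply, mul_apply_eq_comp, map_add,
    ContinuousLinearMap.comp_apply, ContinuousLinearMap.flip_apply]
  abel

theorem mfderiv_coordVec_of_eventuallyEq {W : Type*} [NormedAddCommGroup W] [NormedSpace ℝ W]
    {x₀ x : M} (hx : x ∈ (chartAt (EuclideanHalfSpace 2) x₀).source) {f : Plane → W} {u : M → W}
    (hf : DifferentiableAt ℝ f (extChartAt (𝓡∂ 2) x₀ x))
    (hu : u =ᶠ[nhds x] fun z => f (extChartAt (𝓡∂ 2) x₀ z)) (a : Plane) :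
    (mfderiv (𝓡∂ 2) 𝓘(ℝ, W) u x (coordVec x₀ a x) : W) =
      fderiv ℝ f (extChartAt (𝓡∂ 2) x₀ x) a := by
  rw [← mfderiv_comp_extChartAt hx hf a]
  exact congrArg (fun L : TangentSpace (𝓡∂ 2) x →L[ℝ] W => L (coordVec x₀ a x)) hu.mfderiv_eq

namespace DiracBundle

variable (D) in
/-- The Hermitian metric in a chart and a trivialization. -/
def hermOp (x₀ : M) (y : Plane) : F →L[ℝ] F →L[ℝ] ℂ :=
  opOf fun f => opOf fun f' => D.herm ((extChartAt (𝓡∂ 2) x₀).symm y)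
    (constSec F E x₀ f _) (constSec F E x₀ f' _)

theorem hermOp_apply (x₀ : M) (y : Plane) (f f' : F) :
    D.hermOp x₀ y f f' = D.herm ((extChartAt (𝓡∂ 2) x₀).symm y)
      (constSec F E x₀ f _) (constSec F E x₀ f' _) := by
  have h1 : ∀ f, IsLinearMap ℝ fun f' => D.herm ((extChartAt (𝓡∂ 2) x₀).symm y)
      (constSec F E x₀ f _) (constSec F E x₀ f' _) := fun f => by
    constructor
    · intro a b
      simp only [constSec, map_add]
    · intro t a
      simp only [constSec, ← Complex.coe_smul, map_smul]
  have h2 : IsLinearMap ℝ fun f => opOf fun f' => D.herm ((extChartAt (𝓡∂ 2) x₀).symm y)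
      (constSec F E x₀ f _) (constSec F E x₀ f' _) := by
    constructor
    · intro a b
      ext f'
      rw [add_apply, opOf_apply (h1 _), opOf_apply (h1 _), opOf_apply (h1 _)]
      simp only [constSec, map_add, add_apply]
    · intro t a
      ext f'
      rw [smul_apply, opOf_apply (h1 _), opOf_apply (h1 _)]
      simp only [constSec, ← Complex.coe_smul, map_smul, map_smulₛₗ, smul_apply, Complex.conj_ofReal]
  rw [hermOp, opOf_apply h2, opOf_apply (h1 f)]

theorem hermOp_locRep {x₀ : M} {y : Plane} (hy : y ∈ locDom F E x₀) (u v : ∀ x, E x) :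
    D.hermOp x₀ y (locRep F x₀ u y) (locRep F x₀ v y) =
      D.herm ((extChartAt (𝓡∂ 2) x₀).symm y) (u _) (v _) := by
  rw [hermOp_apply, constSec_locRep hy, constSec_locRep hy]

theorem contDiffOn_hermOp (x₀ : M) : ContDiffOn ℝ ∞ (D.hermOp x₀) (locDom F E x₀) :=
  contDiffOn_opOf fun f => contDiffOn_opOf fun f' => D.herm_smooth x₀ f f'

theorem differentiableAt_hermOp {x₀ : M} {y : Plane} (hy : y ∈ interior (locDom F E x₀)) :
    DifferentiableAt ℝ (D.hermOp x₀) y :=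
  ((contDiffOn_hermOp x₀).contDiffAt (mem_interior_iff_mem_nhds.1 hy)).differentiableAt (by simp)

/-- The connection is Hermitian, in coordinates. -/
theorem fderiv_hermOp {x₀ : M} {y : Plane} (hy : y ∈ interior (locDom F E x₀)) {s t : ∀ x, E x}
    (hs : DifferentiableAt ℝ (locRep F x₀ s) y) (ht : DifferentiableAt ℝ (locRep F x₀ t) y)
    (a : Plane) :
    fderiv ℝ (fun z => D.hermOp x₀ z (locRep F x₀ s z) (locRep F x₀ t z)) y a =
      D.hermOp x₀ y (locRep F x₀ (component x₀ a (D.conn s)) y) (locRep F x₀ t y) +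
        D.hermOp x₀ y (locRep F x₀ s y) (locRep F x₀ (component x₀ a (D.conn t)) y) := by
  have hy' := interior_subset hy
  have hx := symm_mem_source hy'.1
  have hG : DifferentiableAt ℝ (fun z => D.hermOp x₀ z (locRep F x₀ s z) (locRep F x₀ t z)) y :=
    ((differentiableAt_hermOp hy).clm_apply hs).clm_apply ht
  have h1 := D.conn_herm s t _ (secDiffAt_of_differentiableAt hy' hs)
    (secDiffAt_of_differentiableAt hy' ht) (coordVec x₀ a _)
  have h2 : (fun x => D.herm x (s x) (t x)) =ᶠ[nhds ((extChartAt (𝓡∂ 2) x₀).symm y)]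
      fun x => (fun z => D.hermOp x₀ z (locRep F x₀ s z) (locRep F x₀ t z))
        (extChartAt (𝓡∂ 2) x₀ x) := by
    refine eventually_nhds_symm hy' (Filter.Eventually.of_forall fun z hz => ?_)
    beta_reduce
    rw [extChartAt_symm_eq hz, hermOp_locRep hz]
  have h3 := mfderiv_coordVec_of_eventuallyEq hx (by rwa [extChartAt_symm_eq hy']) h2 a
  rw [extChartAt_symm_eq hy'] at h3
  rw [hermOp_locRep hy', hermOp_locRep hy']
  exact h3.symm.trans h1

/-- The Clifford contraction in coordinates. -/
theorem locRep_contract {x₀ : M} {y : Plane} (hy : y ∈ locDom F E x₀) (w : FormField E) :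
    locRep F x₀ (D.contract w) y =
      ∑ i, D.gammaOp x₀ i y (locRep F x₀ (component x₀ (stdVec i) w) y) := by
  have hx := symm_mem_source hy.1
  have h1 : D.contract w ((extChartAt (𝓡∂ 2) x₀).symm y) =
      ∑ i, D.γ _ (coordForm x₀ (EuclideanSpace.proj i) _) (component x₀ (stdVec i) w _) := by
    refine D.contract_eq_of_dual w _ (fun i => coordVec x₀ (stdVec i) _)
      (fun i => coordForm x₀ (EuclideanSpace.proj i) _) fun v => ?_
    have h2 := coordVec_tangentCoord hx v
    rw [plane_eq_sum (tangentCoord x₀ _ v), coordVec_add, coordVec_smul, coordVec_smul] at h2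
    rw [Fin.sum_univ_two]
    exact h2.symm
  rw [locRep, h1, map_sum]
  refine Finset.sum_congr rfl fun i _ => ?_
  exact locRep_map hy (fun x => D.γ x (coordForm x₀ (EuclideanSpace.proj i) x)) _

end DiracBundle

end IntegrationByParts

end DiracSurface

end

/-! ### Green's formula: the Dirac operator is formally self-adjoint. -/

noncomputable section

namespace DiracSurface

section GreenFormula

set_option linter.unusedSectionVars false

variable {M : Type*} [TopologicalSpace M]
  [ChartedSpace (EuclideanHalfSpace 2) M]
  [IsManifold (𝓡∂ 2) ∞ M]
  {F : Type*} [NormedAddCommGroup F] [NormedSpace ℂ F]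
  {E : M → Type*} [∀ x, AddCommGroup (E x)] [∀ x, Module ℂ (E x)]
  [∀ x, TopologicalSpace (E x)] [∀ x, IsTopologicalAddGroup (E x)] [∀ x, ContinuousSMul ℂ (E x)]
  [TopologicalSpace (TotalSpace F E)] [FiberBundle F E] [VectorBundle ℂ F E]
  [FiniteDimensional ℂ F] [VectorBundle ℝ F E] [ContMDiffVectorBundle ∞ F E (𝓡∂ 2)]
  {g : SurfaceMetric M} {c : ComplexStructure M} {D : DiracBundle F E g} {r s p : ℝ}

namespace DiracBundle

variable (D) in
/-- The functional `√g ⟨γ(dx^i) ψ, ·⟩` in a chart and a trivialization. -/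
def pairing (x₀ : M) (ψ : ∀ x, E x) (i : Fin 2) (y : Plane) : F →L[ℝ] ℂ :=
  areaDensity g x₀ y • D.hermOp x₀ y (D.gammaOp x₀ i y (locRep F x₀ ψ y))

theorem HasRegularity.contDiffOn_pairing (hD : D.HasRegularity r s p) (hr : 0 ≤ r) {x₀ : M}
    {ψ : ∀ x, E x} (hψ : ContDiffOn ℝ 1 (locRep F x₀ ψ) (locDom F E x₀)) (i : Fin 2) :
    ContDiffOn ℝ 1 (D.pairing x₀ ψ i) (locDom F E x₀) :=
  (((contDiffOn_areaDensity g x₀).mono (locDom_subset x₀)).of_le (by simp)).smul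
    (((contDiffOn_hermOp x₀).of_le (by simp)).clm_apply
      (((hD.memHolderLoc_gammaOp hr x₀ i).contDiffOn_one hr).clm_apply hψ))

/-- The Leibniz rule with three inputs: ∂_i √g = √g Γ^k_{ki}, the connection is Hermitian, and ∇γ is
given by Christoffel symbols. The last term is the connection form acting on the constant vector f.
-/
theorem HasRegularity.fderiv_pairing (hD : D.HasRegularity r s p) (hr : 0 ≤ r) {x₀ : M}
    {y : Plane} (hy : y ∈ interior (locDom F E x₀)) {ψ : ∀ x, E x}
    (hψ : ContDiffOn ℝ 1 (locRep F x₀ ψ) (locDom F E x₀)) (i : Fin 2) (f : F) :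
    fderiv ℝ (D.pairing x₀ ψ i) y (stdVec i) f =
      (∑ k, christoffel g x₀ k k i y) • D.pairing x₀ ψ i y f -
      (∑ k, christoffel g x₀ i i k y • D.pairing x₀ ψ k y f) +
      areaDensity g x₀ y • D.hermOp x₀ y (D.gammaOp x₀ i y
        (locRep F x₀ (component x₀ (stdVec i) (D.conn ψ)) y)) f +
      D.pairing x₀ ψ i y (connOp D.conn x₀ (stdVec i) y f) := by
  have hy' := interior_subset hy
  have hn := mem_interior_iff_mem_nhds.1 hy
  have hψd := (hψ.contDiffAt hn).differentiableAt one_ne_zero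
  have hγ := differentiableAt_of_memHolderLoc hr (hD.memHolderLoc_gammaOp hr x₀ i) hy
  have hA : DifferentiableAt ℝ (areaDensity g x₀) y := ((contDiffOn_areaDensity g x₀).contDiffAt
    (Filter.mem_of_superset hn (locDom_subset x₀))).differentiableAt (by simp)
  have hP := ((hD.contDiffOn_pairing hr hψ i).contDiffAt hn).differentiableAt one_ne_zero
  set σ : ∀ x, E x := fun x => D.γ x (coordForm x₀ (EuclideanSpace.proj i) x) (ψ x) with hσ
  have hσe : ∀ z ∈ locDom F E x₀, locRep F x₀ σ z = D.gammaOp x₀ i z (locRep F x₀ ψ z) :=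
    fun z hz => locRep_map hz (fun x => D.γ x (coordForm x₀ (EuclideanSpace.proj i) x)) ψ
  have hσd : DifferentiableAt ℝ (locRep F x₀ σ) y :=
    (hγ.clm_apply hψd).congr_of_eventuallyEq (by filter_upwards [hn] with z hz using hσe z hz)
  have htd : DifferentiableAt ℝ (locRep F x₀ (constSec F E x₀ f)) y :=
    (differentiableAt_const f).congr_of_eventuallyEq
      (by filter_upwards [hn] with z hz using locRep_constSec hz f)
  have ht0 : fderiv ℝ (locRep F x₀ (constSec F E x₀ f)) y = 0 := by
    have : locRep F x₀ (constSec F E x₀ f) =ᶠ[nhds y] fun _ => f := by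
      filter_upwards [hn] with z hz using locRep_constSec hz f
    rw [this.fderiv_eq, fderiv_const_apply]
  have hG : DifferentiableAt ℝ (fun z => D.hermOp x₀ z (locRep F x₀ σ z)
      (locRep F x₀ (constSec F E x₀ f) z)) y :=
    ((differentiableAt_hermOp hy).clm_apply hσd).clm_apply htd
  have h1 : (fun z => D.pairing x₀ ψ i z f) =ᶠ[nhds y] fun z => areaDensity g x₀ z •
      D.hermOp x₀ z (locRep F x₀ σ z) (locRep F x₀ (constSec F E x₀ f) z) := by
    filter_upwards [hn] with z hz
    rw [hσe z hz, locRep_constSec hz]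
    rfl
  have h2 : fderiv ℝ (D.pairing x₀ ψ i) y (stdVec i) f =
      fderiv ℝ (fun z => D.pairing x₀ ψ i z f) y (stdVec i) := by
    rw [fderiv_clm_apply hP (differentiableAt_const f)]
    simp
  have h3 := locRep_conn_map D.conn hy
    (T := fun x => D.γ x (coordForm x₀ (EuclideanSpace.proj i) x)) hγ hψd (stdVec i)
  have h4 := hD.covOp_gammaOp hr hy i i
  have h5 : locRep F x₀ (component x₀ (stdVec i) (D.conn σ)) y =
      D.gammaOp x₀ i y (locRep F x₀ (component x₀ (stdVec i) (D.conn ψ)) y) -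
        ∑ k, christoffel g x₀ i i k y • D.gammaOp x₀ k y (locRep F x₀ ψ y) := by
    refine h3.trans ?_
    have h6 : covOp D.conn x₀ (stdVec i)
        (locMap x₀ fun x => D.γ x (coordForm x₀ (EuclideanSpace.proj i) x)) y =
          -∑ k, christoffel g x₀ i i k y • D.gammaOp x₀ k y := h4
    rw [h6, neg_apply, sum_apply, neg_add_eq_sub]
    rfl
  rw [h2, h1.fderiv_eq, fderiv_fun_smul hA hG, add_apply, smul_apply,
    ContinuousLinearMap.smulRight_apply, fderiv_areaDensity g
      (interior_mono (locDom_subset x₀) hy), fderiv_hermOp hy hσd htd, h5,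
    locRep_conn D.conn hy' htd, ht0, hσe y hy', locRep_constSec hy']
  simp only [pairing, map_sub, map_add, add_apply, map_smul, sub_apply, smul_apply, zero_apply,
    zero_add, Fin.sum_univ_two, smul_add, smul_sub, Complex.real_smul, Complex.ofReal_mul,
    Complex.ofReal_add]
  ring

/-- Summed over i, the Christoffel terms coming from √g and from γ cancel after renaming indices;
what is left of the divergence is the pairing with D ψ. -/
theorem HasRegularity.sum_fderiv_pairing (hD : D.HasRegularity r s p) (hr : 0 ≤ r) {x₀ : M}
    {y : Plane} (hy : y ∈ interior (locDom F E x₀)) {ψ : ∀ x, E x}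
    (hψ : ContDiffOn ℝ 1 (locRep F x₀ ψ) (locDom F E x₀)) (f : F) :
    ∑ i, (fderiv ℝ (D.pairing x₀ ψ i) y (stdVec i) f -
      D.pairing x₀ ψ i y (connOp D.conn x₀ (stdVec i) y f)) =
      areaDensity g x₀ y • D.hermOp x₀ y (locRep F x₀ (D.contract (D.conn ψ)) y) f := by
  simp only [hD.fderiv_pairing hr hy hψ, locRep_contract (interior_subset hy), Fin.sum_univ_two,
    map_add, add_apply, smul_add, add_smul]
  abel

/-- The Dirac operator is formally self-adjoint. -/
theorem HasRegularity.integral_contract (hD : D.HasRegularity r s p) (hr : 0 ≤ r) {x₀ : M}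
    {ψ : ∀ x, E x} (hψ : ContDiffOn ℝ 1 (locRep F x₀ ψ) (locDom F E x₀)) {K : Set Plane}
    (hKΩ : K ⊆ interior (locDom F E x₀)) (hK : IsCompact K)
    (hψK : ∀ y ∈ locDom F E x₀, y ∉ K → ψ ((extChartAt (𝓡∂ 2) x₀).symm y) = 0)
    {u : ∀ x, E x} {w : FormField E} (h : HasWeakCov D.conn u w) :
    ∫ y in interior (locDom F E x₀), (areaDensity g x₀ y : ℂ) *
        D.herm ((extChartAt (𝓡∂ 2) x₀).symm y) (ψ _) (D.contract w _) =
      ∫ y in interior (locDom F E x₀), (areaDensity g x₀ y : ℂ) *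
        D.herm ((extChartAt (𝓡∂ 2) x₀).symm y) (D.contract (D.conn ψ) _) (u _) := by
  set Ω := interior (locDom F E x₀) with hΩ
  have hΩo : IsOpen Ω := isOpen_interior
  have hΩL : Ω ⊆ locDom F E x₀ := interior_subset
  have hP := fun i => (hD.contDiffOn_pairing hr hψ i).mono hΩL
  have hPK : ∀ i, ∀ y ∈ Ω, y ∉ K → D.pairing x₀ ψ i y = 0 := fun i y hy hyK => by
    have h0 : locRep F x₀ ψ y = 0 := by
      rw [locRep, hψK y (hΩL hy) hyK]
      exact map_zero _
    rw [pairing, h0, map_zero, map_zero]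
    exact smul_zero (M := ℝ) (A := F →L[ℝ] ℂ) _
  let f' : Fin 2 → Plane → F := fun i y => locRep F x₀ (component x₀ (stdVec i) w) y -
    connForm D.conn x₀ (stdVec i) y (locRep F x₀ u y)
  have hw : ∀ i, HasWeakDeriv Ω (stdVec i) (locRep F x₀ u) (f' i) := fun i => h x₀ (stdVec i)
  let T : Fin 2 → Plane → F →L[ℝ] ℂ := fun i y => fderiv ℝ (D.pairing x₀ ψ i) y (stdVec i)
  have hT : ∀ i, ContinuousOn (T i) Ω := fun i =>
    ((hP i).continuousOn_fderiv_of_isOpen hΩo le_rfl).clm_apply continuousOn_const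
  have hTK : ∀ i, ∀ y ∈ Ω, y ∉ K → T i y = 0 := fun i y hy hyK => by
    show fderiv ℝ _ y _ = 0
    rw [fderiv_eq_zero_of_forall_notMem hΩo hK (hPK i) hy hyK, zero_apply]
  -- The connection term occurs on both sides of the formula; it is isolated so that every summand
  -- is integrable on its own.
  let C : Fin 2 → Plane → F →L[ℝ] ℂ := fun i y =>
    (D.pairing x₀ ψ i y).comp (connOp D.conn x₀ (stdVec i) y)
  have hC : ∀ i, ContinuousOn (C i) Ω := fun i =>
    (hP i).continuousOn.clm_comp ((hD.memHolderLoc_connOp x₀ _).continuousOn.mono hΩL)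
  have hCK : ∀ i, ∀ y ∈ Ω, y ∉ K → C i y = 0 := fun i y hy hyK => by
    show ContinuousLinearMap.comp _ _ = 0
    rw [hPK i y hy hyK, ContinuousLinearMap.zero_comp]
  have i1 := fun i => LocallyIntegrableOn.integrableOn_clm_apply hΩo.measurableSet (hw i).1 (hT i) hKΩ hK (hTK i)
  have i2 := fun i => LocallyIntegrableOn.integrableOn_clm_apply hΩo.measurableSet (hw i).1 (hC i) hKΩ hK (hCK i)
  have i3 := fun i => LocallyIntegrableOn.integrableOn_clm_apply hΩo.measurableSet (hw i).2.1
    (hP i).continuousOn hKΩ hK (hPK i)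
  have h0 := fun i => (hw i).integral_clm_apply hΩo (hP i) hKΩ hK (hPK i)
  -- Skewness of γ moves it from w to ψ, which accounts for the minus sign; the weak derivative plus
  -- the connection term is the covariant component.
  have eA : ∀ y ∈ Ω, (areaDensity g x₀ y : ℂ) *
      D.herm ((extChartAt (𝓡∂ 2) x₀).symm y) (ψ _) (D.contract w _) =
        -∑ i, (D.pairing x₀ ψ i y (f' i y) + C i y (locRep F x₀ u y)) := fun y hy => by
    have hy' := hΩL hy
    have e1 : ∀ i, D.pairing x₀ ψ i y (f' i y) + C i y (locRep F x₀ u y) =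
        D.pairing x₀ ψ i y (locRep F x₀ (component x₀ (stdVec i) w) y) := fun i => by
      show D.pairing x₀ ψ i y (_ - _) + D.pairing x₀ ψ i y (connOp D.conn x₀ (stdVec i) y _) = _
      rw [connOp_apply _ hy', map_sub, sub_add_cancel]
    have e2 : ∀ i, D.hermOp x₀ y (D.gammaOp x₀ i y (locRep F x₀ ψ y))
        (locRep F x₀ (component x₀ (stdVec i) w) y) =
        -D.hermOp x₀ y (locRep F x₀ ψ y)
          (D.gammaOp x₀ i y (locRep F x₀ (component x₀ (stdVec i) w) y)) := fun i => by
      have e3 := fun v => locRep_map hy' (fun x => D.γ x (coordForm x₀ (EuclideanSpace.proj i) x)) v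
      rw [gammaOp, ← e3, ← e3, hermOp_locRep hy', hermOp_locRep hy', D.γ_skew]
    rw [Finset.sum_congr rfl fun i _ => e1 i]
    simp only [pairing, smul_apply, e2, ← hermOp_locRep hy', locRep_contract hy',
      Fin.sum_univ_two, smul_neg, Complex.real_smul, map_add, mul_add]
    ring
  have eB : ∀ y ∈ Ω, (areaDensity g x₀ y : ℂ) *
      D.herm ((extChartAt (𝓡∂ 2) x₀).symm y) (D.contract (D.conn ψ) _) (u _) =
        ∑ i, (T i y (locRep F x₀ u y) - C i y (locRep F x₀ u y)) := fun y hy => by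
    rw [← hermOp_locRep (hΩL hy), ← Complex.real_smul, ← hD.sum_fderiv_pairing hr hy hψ]
    rfl
  have a1 := integral_finsetSum (μ := volume.restrict Ω) Finset.univ
    (f := fun i y => D.pairing x₀ ψ i y (f' i y) + C i y (locRep F x₀ u y))
    fun i _ => (i3 i).add (i2 i)
  have a2 := integral_finsetSum (μ := volume.restrict Ω) Finset.univ
    (f := fun i y => T i y (locRep F x₀ u y) - C i y (locRep F x₀ u y))
    fun i _ => (i1 i).sub (i2 i)
  rw [setIntegral_congr_fun hΩo.measurableSet eA, setIntegral_congr_fun hΩo.measurableSet eB,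
    integral_neg, a1, a2, ← Finset.sum_neg_distrib]
  refine Finset.sum_congr rfl fun i _ => ?_
  -- The two sides differ, for each i, by the integral of (∂_i P)u + P(∂_i u) with P the pairing
  -- functional, which vanishes by integration by parts.
  have h1 := h0 i
  rw [integral_add (i1 i) (i3 i)] at h1
  rw [integral_add (i3 i) (i2 i), integral_sub (i1 i) (i2 i)]
  linear_combination -h1

end DiracBundle

end GreenFormula

end DiracSurface

end

/-! ### Integrability, and what test sections of the subbundle detect. -/

noncomputable section

namespace DiracSurface

section Equivalence

set_option linter.unusedSectionVars false

variable {M : Type*} [TopologicalSpace M]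
  [ChartedSpace (EuclideanHalfSpace 2) M]
  [IsManifold (𝓡∂ 2) ∞ M]
  {F : Type*} [NormedAddCommGroup F] [NormedSpace ℂ F]
  {E : M → Type*} [∀ x, AddCommGroup (E x)] [∀ x, Module ℂ (E x)]
  [∀ x, TopologicalSpace (E x)] [∀ x, IsTopologicalAddGroup (E x)] [∀ x, ContinuousSMul ℂ (E x)]
  [TopologicalSpace (TotalSpace F E)] [FiberBundle F E] [VectorBundle ℂ F E]
  [FiniteDimensional ℂ F] [VectorBundle ℝ F E] [ContMDiffVectorBundle ∞ F E (𝓡∂ 2)]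
  {g : SurfaceMetric M} {c : ComplexStructure M} {D : DiracBundle F E g} {r s p : ℝ}

theorem AEOnSurface.mono₂ {P Q R : M → Prop} (hP : AEOnSurface P) (hQ : AEOnSurface Q)
    (h : ∀ x, P x → Q x → R x) : AEOnSurface R := fun x₀ => by
  filter_upwards [hP x₀, hQ x₀] with y h1 h2 hy using h _ (h1 hy) (h2 hy)

theorem SecL2.locallyIntegrableOn {u : ∀ x, E x} (hu : SecL2 F u) (x₀ : M) :
    LocallyIntegrableOn (locRep F x₀ u) (interior (locDom F E x₀)) :=
  (hu x₀).locallyIntegrableOn isOpen_interior interior_subset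

theorem SecL2.congr_ae {u v : ∀ x, E x} (hu : SecL2 F u) (h : AEOnSurface fun x => u x = v x) :
    SecL2 F v := fun x₀ =>
  (hu x₀).congr_ae ((h x₀).mono fun _ hy hy' => locRep_congr (hy (locDom_subset x₀ hy')))

theorem SecL2.sub {u v : ∀ x, E x} (hu : SecL2 F u) (hv : SecL2 F v) :
    SecL2 F fun x => u x - v x := fun x₀ =>
  ((hu x₀).add ((hv x₀).const_smul (-1 : ℂ))).congr_ae (Filter.Eventually.of_forall fun y _ => by
    rw [locRep_sub, neg_one_smul, sub_eq_add_neg])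

theorem SecL2.const_smul {u : ∀ x, E x} (hu : SecL2 F u) (t : ℂ) :
    SecL2 F fun x => t • u x := fun x₀ =>
  ((hu x₀).const_smul t).congr_ae (Filter.Eventually.of_forall fun y _ =>
    (locRep_smul x₀ t u y).symm)

namespace DiracBundle

theorem HasRegularity.secL2_projPlus (hD : D.HasRegularity r s p) (hr : 0 ≤ r)
    (hg : IsConformal g c) {u : ∀ x, E x} (hu : SecL2 F u) :
    SecL2 F fun x => D.projPlus c x (u x) := fun x₀ =>
  ((hu x₀).clm_apply (hD.memHolderLoc_projPlus hr hg x₀).continuousOn).congr_ae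
    (Filter.Eventually.of_forall fun _ hy => (locRep_map hy _ u).symm)

/-- The Dirac operator maps `H¹` to `L²`. -/
theorem HasRegularity.secL2_contract (hD : D.HasRegularity r s p) (hr : 0 ≤ r)
    {u : ∀ x, E x} (hu : SecH1 F u) {w : FormField E} (hw : HasWeakCov D.conn u w) :
    SecL2 F (D.contract w) := by
  intro x₀
  have hS := isHalfOpen_locDom (F := F) (E := E) x₀
  have h1 := memSobolevLoc_one_iff.1 (hu x₀)
  have h2 : ∀ i, MemLpLoc 2 (locRep F x₀ (component x₀ (stdVec i) w)) (locDom F E x₀) := fun i => by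
    obtain ⟨f', hf', hL⟩ := h1.2 i
    -- Almost everywhere the components of w are ∂_i u + A_i u. This is known in the interior, and
    -- the boundary is a null set.
    refine (hL.add (h1.1.clm_apply (hD.memHolderLoc_connOp x₀ (stdVec i)).continuousOn)).of_interior
      hS ?_
    filter_upwards [hf'.ae_unique isOpen_interior (hw x₀ (stdVec i))
      (Filter.Eventually.of_forall fun _ _ => rfl)] with y hy hy'
    rw [hy hy', connOp_apply D.conn (interior_subset hy'), sub_add_cancel]
  exact (MemLpLoc.sum Finset.univ fun i _ => (h2 i).clm_apply
    (hD.memHolderLoc_gammaOp hr x₀ i).continuousOn).congr_ae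
      (Filter.Eventually.of_forall fun _ hy => (locRep_contract hy w).symm)

theorem integrableOn_herm_test {E₀ : ∀ x, Submodule ℂ (E x)} {x₀ : M} {ψ : ∀ x, E x}
    (hψ : IsTestSection (F := F) E₀ x₀ ψ) {v : ∀ x, E x}
    (hv : LocallyIntegrableOn (locRep F x₀ v) (interior (locDom F E x₀))) :
    IntegrableOn (fun y => (areaDensity g x₀ y : ℂ) *
      D.herm ((extChartAt (𝓡∂ 2) x₀).symm y) (ψ _) (v _)) (interior (locDom F E x₀)) := by
  obtain ⟨-, hψ1, K, hKΩ, hK, hψK⟩ := hψ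
  have hΩL : interior (locDom F E x₀) ⊆ locDom F E x₀ := interior_subset
  have h := LocallyIntegrableOn.integrableOn_clm_apply isOpen_interior.measurableSet hv
    (T := fun y => areaDensity g x₀ y • D.hermOp x₀ y (locRep F x₀ ψ y))
    (((contDiffOn_areaDensity g x₀).continuousOn.mono (hΩL.trans (locDom_subset x₀))).smul
      (((contDiffOn_hermOp x₀).continuousOn.mono hΩL).clm_apply (hψ1.continuousOn.mono hΩL)))
    hKΩ hK fun y hy hyK => by
      have h0 : locRep F x₀ ψ y = 0 := by
        rw [locRep, hψK y (hΩL hy) hyK]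
        exact map_zero _
      rw [h0, map_zero]
      exact smul_zero (M := ℝ) (A := F →L[ℝ] ℂ) _
  refine h.congr_fun (fun y hy => ?_) isOpen_interior.measurableSet
  rw [← hermOp_locRep (hΩL hy), ← Complex.real_smul]
  rfl

/-- The supply of test sections: P₊ of a section constant in the trivialization, times a scalar test
function. They are C¹ because P₊ is C^{r+1}, even though E₀ has no smooth frame in general. -/
theorem HasRegularity.isTestSection_projPlus (hD : D.HasRegularity r s p) (hr : 0 ≤ r)
    (hg : IsConformal g c) {x₀ : M} {φ : Plane → ℝ} (hφ : ContDiff ℝ 1 φ)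
    (hc : HasCompactSupport φ) (hs : tsupport φ ⊆ interior (locDom F E x₀)) (f : F) :
    IsTestSection (F := F) (D.posBundle c) x₀ fun x =>
      (φ (extChartAt (𝓡∂ 2) x₀ x) : ℂ) • D.projPlus c x (constSec F E x₀ f x) := by
  refine ⟨fun x => Submodule.smul_mem _ _ (D.mem_posBundle.2 (D.chir_projPlus hg x _)), ?_,
    tsupport φ, hs, hc, fun y hy hyK => ?_⟩
  · have h1 : ContDiffOn ℝ 1 (fun y => φ y • locMap (F := F) x₀ (D.projPlus c) y f)
        (locDom F E x₀) := hφ.contDiffOn.smul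
      (((hD.memHolderLoc_projPlus hr hg x₀).contDiffOn_one hr).clm_apply contDiffOn_const)
    refine h1.congr fun y hy => ?_
    have h := locRep_real_smul (F := F) x₀ (fun x => φ (extChartAt (𝓡∂ 2) x₀ x))
      (fun x => D.projPlus c x (constSec F E x₀ f x)) y
    simp only [← Complex.coe_smul] at h
    rw [h, extChartAt_symm_eq hy, locMap_apply, ← Complex.coe_smul]
  · beta_reduce
    rw [extChartAt_symm_eq hy, image_eq_zero_of_notMem_tsupport hyK, Complex.ofReal_zero, zero_smul]

/-- The positive part of a section is determined by its pairings with the test sections. -/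
theorem HasRegularity.ae_projPlus_eq_zero (hD : D.HasRegularity r s p) (hr : 0 ≤ r)
    (hg : IsConformal g c) {x₀ : M} {v : ∀ x, E x}
    (hv : LocallyIntegrableOn (locRep F x₀ v) (interior (locDom F E x₀)))
    (h : ∀ ψ, IsTestSection (F := F) (D.posBundle c) x₀ ψ →
      ∫ y in interior (locDom F E x₀), (areaDensity g x₀ y : ℂ) *
        D.herm ((extChartAt (𝓡∂ 2) x₀).symm y) (ψ _) (v _) = 0) :
    ∀ᵐ y : Plane, y ∈ interior (locDom F E x₀) →
      D.projPlus c ((extChartAt (𝓡∂ 2) x₀).symm y) (v _) = 0 := by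
  set Ω := interior (locDom F E x₀) with hΩ
  have hΩo : IsOpen Ω := isOpen_interior
  have hΩL : Ω ⊆ locDom F E x₀ := interior_subset
  let T : F → Plane → F →L[ℝ] ℂ := fun f y =>
    areaDensity g x₀ y • D.hermOp x₀ y (locMap (F := F) x₀ (D.projPlus c) y f)
  have hT : ∀ f, ContinuousOn (T f) Ω := fun f =>
    ((contDiffOn_areaDensity g x₀).continuousOn.mono (hΩL.trans (locDom_subset x₀))).smul
      (((contDiffOn_hermOp x₀).continuousOn.mono hΩL).clm_apply
        (((hD.memHolderLoc_projPlus hr hg x₀).continuousOn.mono hΩL).clm_apply continuousOn_const))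
  have hT' : ∀ f, ∀ y ∈ Ω, T f y (locRep F x₀ v y) = (areaDensity g x₀ y : ℂ) *
      D.herm ((extChartAt (𝓡∂ 2) x₀).symm y) (D.projPlus c _ (constSec F E x₀ f _)) (v _) :=
    fun f y hy => by
      rw [← hermOp_locRep (hΩL hy) (fun x => D.projPlus c x (constSec F E x₀ f x)) v,
        ← Complex.real_smul]
      rfl
  -- For a fixed f the scalar factor φ can be taken out of the pairing, and the fundamental lemma
  -- gives pointwise vanishing.
  have h0 : ∀ f, ∀ᵐ y : Plane, y ∈ Ω → T f y (locRep F x₀ v y) = 0 := fun f => by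
    refine hΩo.ae_eq_zero_of_integral_contDiff_smul_eq_zero (μ := volume)
      (LocallyIntegrableOn.clm_apply hΩo hv (hT f)) fun φ hφ hc hs => ?_
    rw [← setIntegral_smul_of_tsupport _ hs, ← h _ (hD.isTestSection_projPlus hr hg
      (hφ.of_le (by simp)) hc hs f)]
    refine setIntegral_congr_fun hΩo.measurableSet fun y hy => ?_
    rw [hT' f y hy, extChartAt_symm_eq (hΩL hy), Complex.real_smul, map_smulₛₗ, smul_apply,
      Complex.conj_ofReal, smul_eq_mul]
    ring
  -- A finite basis of F keeps the exceptional set null. Afterwards f may depend on y by linearity,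
  -- and f = v(y) gives ⟨P₊v, v⟩ = 0.
  have h1 := ae_all_iff.2 fun j => h0 (Module.finBasis ℝ F j)
  filter_upwards [h1] with y hy hyΩ
  have hy' := hΩL hyΩ
  have h2 : ((D.hermOp x₀ y).comp (locMap (F := F) x₀ (D.projPlus c) y)).flip
      (locRep F x₀ v y) = 0 := by
    refine ContinuousLinearMap.coe_injective ((Module.finBasis ℝ F).ext fun j => ?_)
    have h3 := hy j hyΩ
    exact (smul_eq_zero.1 h3).resolve_left (areaDensity_pos g (locDom_subset x₀ hy')).ne'
  have h3 : D.hermOp x₀ y (locMap (F := F) x₀ (D.projPlus c) y (locRep F x₀ v y))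
      (locRep F x₀ v y) = 0 := congrArg (fun L => L (locRep F x₀ v y)) h2
  rw [← locRep_map hy', hermOp_locRep hy'] at h3
  by_contra hne
  have h4 := D.herm_pos _ _ hne
  -- P₊ is a self-adjoint projection, so ⟨P₊v, v⟩ = |P₊v|², which contradicts positivity unless P₊v
  -- = 0.
  rw [← D.herm_projPlus hg, D.projPlus_of_chir (D.chir_projPlus hg _ _), h3] at h4
  simp at h4

end DiracBundle

end Equivalence

end DiracSurface

end

/-! ### Equality of the graphs of the two operators. -/

noncomputable section

namespace DiracSurface

section Equivalence

set_option linter.unusedSectionVars false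

variable {M : Type*} [TopologicalSpace M]
  [ChartedSpace (EuclideanHalfSpace 2) M]
  [IsManifold (𝓡∂ 2) ∞ M]
  {F : Type*} [NormedAddCommGroup F] [NormedSpace ℂ F]
  {E : M → Type*} [∀ x, AddCommGroup (E x)] [∀ x, Module ℂ (E x)]
  [∀ x, TopologicalSpace (E x)] [∀ x, IsTopologicalAddGroup (E x)] [∀ x, ContinuousSMul ℂ (E x)]
  [TopologicalSpace (TotalSpace F E)] [FiberBundle F E] [VectorBundle ℂ F E]
  [FiniteDimensional ℂ F] [VectorBundle ℝ F E] [ContMDiffVectorBundle ∞ F E (𝓡∂ 2)]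
  {g : SurfaceMetric M} {c : ComplexStructure M} {D : DiracBundle F E g} {r s p : ℝ}

namespace DiracBundle

theorem sqrt_two_mul_inv_sqrt_two : (Real.sqrt 2 : ℂ) * (Real.sqrt 2 : ℂ)⁻¹ = 1 :=
  mul_inv_cancel₀ (by exact_mod_cast (by positivity : Real.sqrt 2 ≠ 0))

/-- Pairing a test section with `P₊ D u` is pairing its `∂̄` with the form part of `u`. -/
theorem HasRegularity.integral_projPlus_contract (hD : D.HasRegularity r s p) (hr : 0 ≤ r)
    (hg : IsConformal g c) {u : ∀ x, E x} {w : FormField E} (hw : HasWeakCov D.conn u w)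
    {x₀ : M} {ψ : ∀ x, E x} (hψ : IsTestSection (F := F) (D.posBundle c) x₀ ψ) :
    ∫ y in interior (locDom F E x₀), (areaDensity g x₀ y : ℂ) *
        D.herm ((extChartAt (𝓡∂ 2) x₀).symm y) (ψ _)
          ((Real.sqrt 2 : ℂ)⁻¹ • D.projPlus c _ (D.contract w _)) =
      ∫ y in interior (locDom F E x₀), (areaDensity g x₀ y : ℂ) *
        D.formInner c ((extChartAt (𝓡∂ 2) x₀).symm y) (zeroOnePart c (D.conn ψ) _)
          (D.toForm _ (D.projMinus c _ (u _))) := by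
  obtain ⟨-, hψ1, K, hKΩ, hK, hψK⟩ := hψ
  -- Green's formula is applied to P₋u, whose weak covariant derivative is P₋w; contracting P₋w
  -- gives the positive part of D u.
  have h := hD.integral_contract hr hψ1 hKΩ hK hψK (hD.hasWeakCov_projMinus hr hg hw)
  have h1 : ∀ y, (areaDensity g x₀ y : ℂ) * D.herm ((extChartAt (𝓡∂ 2) x₀).symm y) (ψ _)
      ((Real.sqrt 2 : ℂ)⁻¹ • D.projPlus c _ (D.contract w _)) = (Real.sqrt 2 : ℂ)⁻¹ *
        ((areaDensity g x₀ y : ℂ) * D.herm ((extChartAt (𝓡∂ 2) x₀).symm y) (ψ _)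
          (D.contract (compForm (D.projMinus c) w) _)) := fun y => by
    rw [projPlus_contract D hg, map_smul, smul_eq_mul]
    ring
  have h2 : ∀ y, (areaDensity g x₀ y : ℂ) * D.formInner c ((extChartAt (𝓡∂ 2) x₀).symm y)
      (zeroOnePart c (D.conn ψ) _) (D.toForm _ (D.projMinus c _ (u _))) = (Real.sqrt 2 : ℂ)⁻¹ *
        ((areaDensity g x₀ y : ℂ) * D.herm ((extChartAt (𝓡∂ 2) x₀).symm y)
          (D.contract (D.conn ψ) _) (D.projMinus c _ (u _))) := fun y => by
    rw [D.formInner_zeroOnePart hg (D.conn ψ) (D.chir_projMinus hg _ _)]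
    linear_combination (-(areaDensity g x₀ y : ℂ) * D.formInner c _ (zeroOnePart c (D.conn ψ) _)
      (D.toForm _ (D.projMinus c _ (u _)))) * sqrt_two_mul_inv_sqrt_two
  simp only [h1, h2, integral_const_mul]
  rw [h]

/-- Contraction exchanges chirality, so the negative part of D u comes only from the positive part
of w, where `toForm_contract` applies. -/
theorem toForm_projMinus_contract (hg : IsConformal g c) (w : FormField E) (x : M) :
    D.toForm x (D.projMinus c x (D.contract w x)) =
      (Real.sqrt 2 : ℂ) • zeroOnePart c (compForm (D.projPlus c) w) x := by
  rw [D.projMinus_contract hg]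
  exact D.toForm_contract hg fun v => D.chir_projPlus hg x _

theorem HasRegularity.isDolbeaultDirac_of_isDirac (hD : D.HasRegularity r s p) (hr : 0 ≤ r)
    (hg : IsConformal g c) {u f : ∀ x, E x} (h : D.IsDirac u f) :
    D.IsDolbeaultDirac c (D.posBundle c) (fun x => D.splitting c hg x (u x))
      (fun x => D.splitting c hg x (f x)) := by
  obtain ⟨hu, w, hw, hf⟩ := h
  -- The adjoint component is prescribed by B f up to √2, and the ∂̄-component is the (0,1)-part of
  -- P₊w, the weak covariant derivative of P₊u.
  refine ⟨fun x => (Real.sqrt 2 : ℂ)⁻¹ • D.projPlus c x (f x),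
    zeroOnePart c (compForm (D.projPlus c) w), ⟨hD.secH1_projPlus hr hg hu, _,
      hD.hasWeakCov_projPlus hr hg hw, fun x₀ => Filter.Eventually.of_forall fun _ _ => rfl⟩,
    ⟨hD.formH1_toForm hr hg hu, ?_, fun x₀ ψ hψ => ?_⟩, ?_⟩
  · refine ((hD.secL2_projPlus hr hg (hD.secL2_contract hr hu hw)).const_smul
      (Real.sqrt 2 : ℂ)⁻¹).congr_ae fun x₀ => ?_
    filter_upwards [hf x₀] with y hy hy'
    rw [hy hy']
  · refine Eq.trans ?_ (hD.integral_projPlus_contract hr hg hw hψ)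
    refine setIntegral_congr_ae isOpen_interior.measurableSet ?_
    filter_upwards [hf x₀] with y hy hy'
    rw [hy (locDom_subset x₀ (interior_subset hy'))]
  · intro x₀
    filter_upwards [hf x₀] with y hy hy'
    refine ⟨?_, ?_⟩
    · rw [splitting_fst, smul_smul, sqrt_two_mul_inv_sqrt_two, one_smul]
    · rw [splitting_snd, hy hy', D.toForm_projMinus_contract hg]

/-- The H¹ section u is rebuilt from its two components and therefore has some weak covariant
derivative w. Uniqueness compares P₊w with the given derivative of P₊u, and test sections compare
the given adjoint with P₊D u. -/
theorem HasRegularity.isDirac_of_isDolbeaultDirac [SecondCountableTopology M]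
    (hD : D.HasRegularity r s p) (hr : 0 ≤ r)
    (hg : IsConformal g c) {u f : ∀ x, E x}
    (h : D.IsDolbeaultDirac c (D.posBundle c) (fun x => D.splitting c hg x (u x))
      (fun x => D.splitting c hg x (f x))) : D.IsDirac u f := by
  obtain ⟨a, b, ⟨hσ, w', hw', hb⟩, ⟨hτ, ha, hadj⟩, hT⟩ := h
  have hu : SecH1 F u := hD.secH1_of_splitting hr hσ hτ
  obtain ⟨w, hw⟩ := exists_hasWeakCov D.conn hu
  refine ⟨hu, w, hw, ?_⟩
  have h1 : AEOnSurface fun x => compForm (D.projPlus c) w x = w' x :=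
    (hD.hasWeakCov_projPlus hr hg hw).ae_unique hw'
  -- Both sections have the same pairing with every test section of E₀, and such pairings detect
  -- exactly the positive part of the difference.
  have h2 : AEOnSurface fun x => D.projPlus c x
      (a x - (Real.sqrt 2 : ℂ)⁻¹ • D.projPlus c x (D.contract w x)) = 0 := by
    refine aeOnSurface_of_locDom F E fun x₀ => ?_
    have hd := (hD.secL2_projPlus hr hg (hD.secL2_contract hr hu hw)).const_smul (Real.sqrt 2 : ℂ)⁻¹
    refine hD.ae_projPlus_eq_zero hr hg ((ha.sub hd).locallyIntegrableOn x₀) fun ψ hψ => ?_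
    have e1 := hadj x₀ ψ hψ
    have e2 := hD.integral_projPlus_contract hr hg hw hψ
    have e3 := integrableOn_herm_test (D := D) hψ (ha.locallyIntegrableOn x₀)
    have e4 := integrableOn_herm_test (D := D) hψ (hd.locallyIntegrableOn x₀)
    simp only [map_sub, mul_sub]
    rw [integral_sub e3 e4, e2, e1]
    exact sub_self _
  have h3 : AEOnSurface fun x => D.projMinus c x (f x) = D.projMinus c x (D.contract w x) := by
    refine (hT.mono₂ hb fun x hx hx' => And.intro hx.2 hx').mono₂ h1 fun x hx hx' => ?_
    have e1 : D.toForm x (D.projMinus c x (f x)) =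
        D.toForm x (D.projMinus c x (D.contract w x)) := by
      rw [D.toForm_projMinus_contract hg]
      refine hx.1.trans ?_
      rw [hx.2, zeroOnePart, zeroOnePart, hx']
    have hv := tangentBasis_zero_ne_zero x
    rw [← D.ofForm_toForm hv (D.projMinus c x (f x)), e1, D.ofForm_toForm hv]
  refine (hT.mono₂ h2 fun x hx hx' => And.intro hx.1 hx').mono₂ h3 fun x hx hx' => ?_
  have e1 : D.projPlus c x (f x) = (Real.sqrt 2 : ℂ) • a x := hx.1
  have e2 := hx.2
  have e3 : ∀ s, D.projPlus c x (D.projPlus c x s) = D.projPlus c x s := fun s =>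
    D.projPlus_of_chir (D.chir_projPlus hg x s)
  -- Nothing forces a to lie in E₀ beforehand, but √2 a = P₊f does at this point, so nothing is lost
  -- by applying P₊.
  have e4 : D.projPlus c x (f x) = D.projPlus c x (D.contract w x) := by
    rw [map_sub, map_smul, e3, sub_eq_zero] at e2
    rw [← e3 (f x), e1, map_smul, e2, smul_smul, sqrt_two_mul_inv_sqrt_two, one_smul]
  rw [← D.projPlus_add_projMinus (c := c) x (f x), e4, hx', projPlus_add_projMinus]

end DiracBundle

end Equivalence

end DiracSurface

end

theorem mainTheorem7
    {M : Type*} [TopologicalSpace M] [T2Space M] [SecondCountableTopology M]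
    [ChartedSpace (EuclideanHalfSpace 2) M] [IsManifold (𝓡∂ 2) ∞ M]
    (c : ComplexStructure M) (g : SurfaceMetric M) (hg : IsConformal g c)
    {F : Type*} [NormedAddCommGroup F] [NormedSpace ℂ F] [FiniteDimensional ℂ F]
    {E : M → Type*} [∀ x, AddCommGroup (E x)] [∀ x, Module ℂ (E x)]
    [∀ x, TopologicalSpace (E x)] [∀ x, IsTopologicalAddGroup (E x)]
    [∀ x, ContinuousSMul ℂ (E x)]
    [TopologicalSpace (TotalSpace F E)] [FiberBundle F E] [VectorBundle ℂ F E]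
    [VectorBundle ℝ F E] [ContMDiffVectorBundle ∞ F E (𝓡∂ 2)]
    (n : ℕ) (hF : Module.finrank ℂ F = 2 * n)
    (r s p : ℝ) (hr : 0 < r) (hrs : r < s) (hp : 1 < p) (hrs1 : 1 < r + s)
    (hrN : ∀ m : ℕ, r ≠ m) (hsp : 2 * n + 2 < s * p)
    (D : DiracBundle F E g) (hD : D.HasRegularity r s p) :
    ∃ E₀ : ∀ x, Submodule ℂ (E x),
      IsSubbundle F (r + 1) n E₀ ∧
      ∃ B : ∀ x, E x ≃ₗ[ℂ] (E₀ x × ZeroOneForms c E₀ x),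
        IsBundleIso F c (r + 1) E₀ B ∧
        ∀ u f : ∀ x, E x,
          D.IsDirac u f ↔
            D.IsDolbeaultDirac c E₀ (fun x => B x (u x)) (fun x => B x (f x)) := by
  exact ⟨D.posBundle c, hD.isSubbundle hr.le hg hF, D.splitting c hg, hD.isBundleIso hr.le hg,
    fun u f => ⟨hD.isDolbeaultDirac_of_isDirac hr.le hg, hD.isDirac_of_isDolbeaultDirac hr.le hg⟩⟩
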